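/- Fix an integer $N\ge 1$. For $k,l\ge 0$ let $\mathscr P_{N\text{-lin}}(k,l)$ be the complex vector space with basis the set of partitions of $k$ upper and $l$ lower points, with the usual category operations: the tensor product (side by side, bilinear), the composition $qp$ ($q$ placed below $p$, each connected component without outer points being replaced by a factor $N$, bilinear) and the involution (reflection, antilinear). A linear category of partitions is a family of subspaces $\mathscr K(k,l)\subset\mathscr P_{N\text{-lin}}(k,l)$ that contains the identity partition $|\in\mathscr P(1,1)$ and the pair partition in $\mathscr P(0,2)$ and is closed under the category operations; $\langle p\rangle$ is the smallest one containing $p$. It is easy if every $\mathscr K(k,l)$ is spanned by partitions. Let $d\in\mathscr P(1,1)$ be the partition into two singletons, $\tau=|-\frac2N d$, and $\mathcal T_{(N)}p=\tau^{\otimes l}\,p\,\tau^{\otimes k}$ for $p\in\mathscr P_{N\text{-lin}}(k,l)$. For $I\subset\{1,2,3,4\}$ let $b_{4,I}\in\mathscr P(0,4)$ be the partition in which the points of $I$ are singletons and the other points form one block, and let $b_4=b_{4,\emptyset}$ be the four-block partition. For a partition $p\in\mathscr P(k,l)$ let $T_p:(\mathbb C^N)^{\otimes k}\to(\mathbb C^N)^{\otimes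 l}$ be the map $e_{i_1}\otimes\cdots\otimes e_{i_k}\mapsto\sum_{\mathbf j}\delta_p(\mathbf i,\mathbf j)\,e_{j_1}\otimes\cdots\otimes e_{j_l}$, where $\delta_p(\mathbf i,\mathbf j)=1$ if points in the same block carry equal labels and $0$ otherwise, extended linearly in $p$. A compact matrix quantum group $G=(C(G),u)$ corresponds to $\mathscr K$ if $S_N\subset G\subset O_N^+$ and $\{T\mid Tu^{\otimes k}=u^{\otimes l}T\}=\{T_p\mid p\in\mathscr K(k,l)\}$ for all $k,l$. For $p\in\mathscr P_{N\text{-lin}}(0,4)$ let $G_p$ be given by the universal C*-algebra $$C(G_p)=C^*(u_{ij},\ 1\le i,j\le N\mid u=\bar u,\ uu^t=u^tu=1,\ T_p=u^{\otimes 4}T_p),$$ and let $H_N^+=G_{b_4}$. Then the following hold. 1. $$\mathcal T_{(N)}b_4=b_4-\frac2N\sum_{|I|=1}b_{4,I}+\frac4{N^2}\sum_{|I|=2}b_{4,I}-\frac{16}{N^3}\,b_{4,\{1,2,3,4\}}.$$ 2. $\mathcal T_{(N)}$ restricts to a monoidal $*$-isomorphism from $\langle b_4\rangle$ onto $\langle\mathcal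 T_{(N)}b_4\rangle$. 3. $\mathcal T_{(N)}b_4\notin\langle b_4\rangle$; hence $\langle\mathcal T_{(N)}b_4\rangle\ne\langle b_4\rangle$, and the linear category $\langle\mathcal T_{(N)}b_4\rangle$ is not easy. 4. $H_N^+$ and $G:=G_{\mathcal T_{(N)}b_4}$ are compact matrix quantum groups, $H_N^+$ corresponds to $\langle b_4\rangle$, and $G$ corresponds to $\langle\mathcal T_{(N)}b_4\rangle$. They are similar: $G=T_\tau H_N^+T_\tau^{-1}$, that is, there is a $*$-isomorphism $C(G)\to C(H_N^+)$ sending $u^G_{ij}$ to $[T_\tau uT_\tau^{-1}]_{ij}$, where $u$ is the fundamental representation of $H_N^+$. 5. If $N\ge 3$, then $G$ and $H_N^+$ are not identical: no $*$-isomorphism $C(G)\to C(H_N^+)$ sends $u^G_{ij}$ to $u_{ij}$ for all $i,j$. -/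

import Mathlib

open scoped TensorProduct ENNReal

noncomputable section

namespace LinPart

/-! ### Partitions, their formal linear combinations, and the category operations -/

/-- Partitions of `k` upper (left summand) and `l` lower (right summand) points. -/
abbrev Part (k l : ℕ) : Type := Setoid (Fin k ⊕ Fin l)

/-- Formal complex linear combinations of partitions of `k` upper and `l` lower points. -/
abbrev PLin (k l : ℕ) : Type := Part k l →₀ ℂ

/-- A partition as an element of the space of formal linear combinations. -/
def single {k l : ℕ} (p : Part k l) : PLin k l := Finsupp.single p 1

/-- Side by side placement: the first `k` upper and the first `l` lower points carry `p`, the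
remaining ones carry `q`, and no block of `p` is joined to a block of `q`. -/
def tensorPart {k l k' l' : ℕ} (p : Part k l) (q : Part k' l') : Part (k + k') (l + l') :=
  Setoid.comap
    (fun x => Equiv.sumSumSumComm (Fin k) (Fin k') (Fin l) (Fin l')
      (Sum.map finSumFinEquiv.symm finSumFinEquiv.symm x))
    (Setoid.ker (Sum.map (Quotient.mk p) (Quotient.mk q)))

/-- Reflection at the horizontal axis. -/
def starPart {k l : ℕ} (p : Part k l) : Part l k := Setoid.comap Sum.swap p

/-- The diagram with `q` put below `p`: the points are the `k` upper points, the `l` middle points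
and the `m` lower points, and the classes are the connected components. -/
def glue {k l m : ℕ} (q : Part l m) (p : Part k l) : Setoid (Fin k ⊕ (Fin l ⊕ Fin m)) :=
  Setoid.map p (Sum.map id Sum.inl) ⊔ Setoid.map q Sum.inr

/-- The inclusion of the outer (upper and lower) points in the glued diagram. -/
def outer (k l m : ℕ) : Fin k ⊕ Fin m → Fin k ⊕ (Fin l ⊕ Fin m) := Sum.map id Sum.inr

/-- The partition of the outer points induced by the glued diagram. -/
def compPart {k l m : ℕ} (q : Part l m) (p : Part k l) : Part k m :=
  Setoid.comap (outer k l m) (glue q p)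

/-- The number of connected components of the glued diagram without outer points. -/
def loops {k l m : ℕ} (q : Part l m) (p : Part k l) : ℕ :=
  Nat.card {c : Quotient (glue q p) // ∀ x, Quotient.mk (glue q p) (outer k l m x) ≠ c}

/-- The tensor product, extended bilinearly. -/
def tensor {k l k' l' : ℕ} : PLin k l →ₗ[ℂ] PLin k' l' →ₗ[ℂ] PLin (k + k') (l + l') :=
  Finsupp.linearCombination ℂ fun p : Part k l =>
    (Finsupp.linearCombination ℂ fun q : Part k' l' => single (tensorPart p q) :
      PLin k' l' →ₗ[ℂ] PLin (k + k') (l + l'))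

/-- The composition `q p` with a factor `N` for every removed component, extended bilinearly. -/
def comp (N : ℕ) {k l m : ℕ} : PLin l m →ₗ[ℂ] PLin k l →ₗ[ℂ] PLin k m :=
  Finsupp.linearCombination ℂ fun q : Part l m =>
    (Finsupp.linearCombination ℂ fun p : Part k l =>
      ((N : ℂ) ^ loops q p) • single (compPart q p) : PLin k l →ₗ[ℂ] PLin k m)

/-- The involution, extended antilinearly. -/
def involution {k l : ℕ} (p : PLin k l) : PLin l k :=
  p.sum fun q a => star a • single (starPart q)

/-- The partition without points. -/
def emptyPart : Part 0 0 := ⊥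

/-- The identity partition: one upper and one lower point in one block. -/
def idPart : Part 1 1 := ⊤

/-- The pair partition: two lower points in one block. -/
def pairPart : Part 0 2 := ⊤

/-- One upper and one lower point, each of them a singleton. -/
def discPart : Part 1 1 := ⊥

/-- The four-block partition: four lower points in one block. -/
def fourPart : Part 0 4 := ⊤

/-- The partition of `k` lower points whose blocks are the singletons `{i}`, `i ∈ I`, and the set
of all remaining points. -/
def blockWithSingletons {k : ℕ} (I : Finset (Fin k)) : Part 0 k where
  r x y := x = y ∨ ((∀ i ∈ I, x ≠ Sum.inr i) ∧ (∀ i ∈ I, y ≠ Sum.inr i))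
  iseqv :=
    { refl := fun _ => Or.inl rfl
      symm := by
        rintro x y (h | ⟨h, h'⟩)
        · exact Or.inl h.symm
        · exact Or.inr ⟨h', h⟩
      trans := by
        rintro x y z (rfl | ⟨h, h'⟩) (rfl | ⟨g, g'⟩)
        · exact Or.inl rfl
        · exact Or.inr ⟨g, g'⟩
        · exact Or.inr ⟨h, h'⟩
        · exact Or.inr ⟨h, g'⟩ }

/-- `p ⊗ ⋯ ⊗ p` with `n` factors, for `p` with one upper and one lower point. -/
def tensorPow (p : PLin 1 1) : (n : ℕ) → PLin n n
  | 0 => single emptyPart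
  | n + 1 => tensor (tensorPow p n) p

/-! ### Linear categories of partitions -/

/-- Linear categories of partitions with loop parameter `N`. -/
structure LinCat (N : ℕ) where
  hom : (k l : ℕ) → Submodule ℂ (PLin k l)
  id_mem : single idPart ∈ hom 1 1
  pair_mem : single pairPart ∈ hom 0 2
  tensor_mem : ∀ {k l k' l' : ℕ} {p : PLin k l} {q : PLin k' l'},
    p ∈ hom k l → q ∈ hom k' l' → tensor p q ∈ hom (k + k') (l + l')
  comp_mem : ∀ {k l m : ℕ} {q : PLin l m} {p : PLin k l},
    q ∈ hom l m → p ∈ hom k l → comp N q p ∈ hom k m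
  involution_mem : ∀ {k l : ℕ} {p : PLin k l}, p ∈ hom k l → involution p ∈ hom l k

/-- Sets of linear combinations of partitions with arbitrary numbers of points. -/
abbrev Gens : Type := Set (Σ kl : ℕ × ℕ, PLin kl.1 kl.2)

/-- The set with the only element `p`. -/
def gen {k l : ℕ} (p : PLin k l) : Gens := {⟨(k, l), p⟩}

/-- `K` contains all elements of `S`. -/
def LinCat.Contains {N : ℕ} (K : LinCat N) (S : Gens) : Prop :=
  ∀ x ∈ S, x.2 ∈ K.hom x.1.1 x.1.2

/-- The smallest linear category of partitions that contains `S`. -/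
def generated (N : ℕ) (S : Gens) : LinCat N where
  hom k l := ⨅ (K : LinCat N) (_ : K.Contains S), K.hom k l
  id_mem := by
    simp only [Submodule.mem_iInf]
    exact fun K _ => K.id_mem
  pair_mem := by
    simp only [Submodule.mem_iInf]
    exact fun K _ => K.pair_mem
  tensor_mem := by
    simp only [Submodule.mem_iInf]
    exact fun hp hq K hK => K.tensor_mem (hp K hK) (hq K hK)
  comp_mem := by
    simp only [Submodule.mem_iInf]
    exact fun hq hp K hK => K.comp_mem (hq K hK) (hp K hK)
  involution_mem := by
    simp only [Submodule.mem_iInf]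
    exact fun hp K hK => K.involution_mem (hp K hK)

/-- A linear category of partitions is easy if all its morphism spaces are spanned by
partitions. -/
def LinCat.IsEasy {N : ℕ} (K : LinCat N) : Prop :=
  ∃ C : (k l : ℕ) → Set (Part k l), ∀ k l, K.hom k l = Submodule.span ℂ (single '' C k l)

/-- The family `F` of linear maps restricts to a monoidal `*`-isomorphism from `K` onto `L`, acting
as the identity on objects. -/
structure IsMonoidalStarIso {N : ℕ} (F : (k l : ℕ) → PLin k l →ₗ[ℂ] PLin k l)
    (K L : LinCat N) : Prop where
  bijOn : ∀ k l, Set.BijOn (F k l) (K.hom k l) (L.hom k l)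
  map_id : ∀ k, F k k (tensorPow (single idPart) k) = tensorPow (single idPart) k
  map_tensor : ∀ (k l k' l' : ℕ), ∀ p ∈ K.hom k l, ∀ q ∈ K.hom k' l',
    F (k + k') (l + l') (tensor p q) = tensor (F k l p) (F k' l' q)
  map_comp : ∀ (k l m : ℕ), ∀ q ∈ K.hom l m, ∀ p ∈ K.hom k l,
    F k m (comp N q p) = comp N (F l m q) (F k l p)
  map_involution : ∀ (k l : ℕ), ∀ p ∈ K.hom k l,
    F l k (involution p) = involution (F k l p)

/-- `τ_(N) = id - (2/N) disc`. -/
def tau (N : ℕ) : PLin 1 1 := single idPart - (2 / (N : ℂ)) • single discPart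

/-- `𝒯_(N)` sends `p` with `k` upper and `l` lower points to `τ^{⊗ l} p τ^{⊗ k}`. -/
def scriptT (N : ℕ) (k l : ℕ) : PLin k l →ₗ[ℂ] PLin k l :=
  (comp N (tensorPow (tau N) l)) ∘ₗ ((comp N).flip (tensorPow (tau N) k))

/-! ### Linear maps associated to partitions and intertwiners -/

open Classical in
/-- The matrix of `T_p : (ℂ^N)^{⊗ k} → (ℂ^N)^{⊗ l}` in the standard bases: the entry at `(j, i)` is
`1` if any two points in the same block of `p` carry the same label, and `0` otherwise. -/
def mapOfPart (N : ℕ) {k l : ℕ} (p : Part k l) :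
    Matrix (Fin l → Fin N) (Fin k → Fin N) ℂ :=
  Matrix.of fun j i => if ∀ x y, p x y → Sum.elim i j x = Sum.elim i j y then 1 else 0

/-- `p ↦ T_p`, extended linearly. -/
def mapT (N : ℕ) {k l : ℕ} :
    PLin k l →ₗ[ℂ] Matrix (Fin l → Fin N) (Fin k → Fin N) ℂ :=
  Finsupp.linearCombination ℂ (mapOfPart N)

section Intertwiners

variable {N : ℕ} {A : Type} [Ring A] [Algebra ℂ A]

/-- A scalar matrix as a matrix over the algebra `A`. -/
def scalarMatrix (A : Type) [Ring A] [Algebra ℂ A] {m n : Type} (T : Matrix m n ℂ) :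
    Matrix m n A :=
  T.map (algebraMap ℂ A)

/-- The `k`-fold tensor power `u^{⊗ k}`, with entries `u_{s_1 t_1} ⋯ u_{s_k t_k}`. -/
def tensorMatrix (u : Matrix (Fin N) (Fin N) A) (k : ℕ) :
    Matrix (Fin k → Fin N) (Fin k → Fin N) A :=
  Matrix.of fun s t => (List.ofFn fun a => u (s a) (t a)).prod

/-- `Mor(u^{⊗ k}, u^{⊗ l})`: all `T` with `T u^{⊗ k} = u^{⊗ l} T`. -/
def Mor (u : Matrix (Fin N) (Fin N) A) (k l : ℕ) :
    Set (Matrix (Fin l → Fin N) (Fin k → Fin N) ℂ) :=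
  {T | scalarMatrix A T * tensorMatrix u k = tensorMatrix u l * scalarMatrix A T}

/-- The relations `u = ū`, `u uᵗ = uᵗ u = 1`, and `T_p u^{⊗ k} = u^{⊗ l} T_p` for `p ∈ S`. -/
structure Relations [StarRing A] (S : Gens) (u : Matrix (Fin N) (Fin N) A) : Prop where
  selfAdjoint : ∀ i j, star (u i j) = u i j
  mul_transpose : u * u.transpose = 1
  transpose_mul : u.transpose * u = 1
  intertwines : ∀ x ∈ S, mapT N x.2 ∈ Mor u x.1.1 x.1.2

end Intertwiners

/-! ### Compact matrix quantum groups -/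

/-- A unital C*-algebra with an `N × N` matrix over it. -/
structure MatrixPair (N : ℕ) where
  alg : Type
  [cstar : CStarAlgebra alg]
  u : Matrix (Fin N) (Fin N) alg

attribute [instance] MatrixPair.cstar

/-- Bounded operators on a complex Hilbert space. -/
abbrev Op (H : Type) [NormedAddCommGroup H] [InnerProductSpace ℂ H] : Type := H →L[ℂ] H

/-- The Hilbert space tensor product. -/
abbrev HTensor (H : Type) [NormedAddCommGroup H] [InnerProductSpace ℂ H] : Type :=
  UniformSpace.Completion (H ⊗[ℂ] H)

/-- Compact matrix quantum groups. The minimal tensor product `A ⊗_min A` is the spatial one: for a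
faithful representation `π` of `A` on a Hilbert space `H` it is the C*-algebra of operators on
`H ⊗ H` generated by the operators `π a ⊗ π b`. A unital `*`-homomorphism from `A` to the operators
on `H ⊗ H` that sends `u_ij` to `∑ₖ π u_ik ⊗ π u_kj` has values in it, since the `u_ij` generate
`A`. -/
structure MatrixPair.IsCMQG {N : ℕ} (G : MatrixPair N) : Prop where
  generates :
    (StarAlgebra.adjoin ℂ (Set.range fun ij : Fin N × Fin N => G.u ij.1 ij.2)).topologicalClosure
      = ⊤
  isUnit_u : IsUnit G.u
  isUnit_transpose : IsUnit G.u.transpose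
  comultiplication :
    ∃ (H : Type) (_ : NormedAddCommGroup H) (_ : InnerProductSpace ℂ H) (_ : CompleteSpace H)
      (π : G.alg →⋆ₐ[ℂ] Op H) (Δ : G.alg →⋆ₐ[ℂ] Op (HTensor H)),
      Function.Injective π ∧
      ∀ (i j : Fin N) (x y : H),
        Δ (G.u i j) ((x ⊗ₜ[ℂ] y : H ⊗[ℂ] H) : HTensor H) =
          ∑ k, ((π (G.u i k) x ⊗ₜ[ℂ] π (G.u k j) y : H ⊗[ℂ] H) : HTensor H)

/-- `H ⊆ G`: a surjective unital `*`-homomorphism from `C(G)` to `C(H)` sends `u_ij` to `v_ij`. -/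
def MatrixPair.IsSubgroup {N : ℕ} (H G : MatrixPair N) : Prop :=
  ∃ φ : G.alg →⋆ₐ[ℂ] H.alg, Function.Surjective φ ∧ ∀ i j, φ (G.u i j) = H.u i j

/-- `G` and `H` are identical. -/
def MatrixPair.Identical {N : ℕ} (G H : MatrixPair N) : Prop :=
  ∃ φ : G.alg ≃⋆ₐ[ℂ] H.alg, ∀ i j, φ (G.u i j) = H.u i j

/-- `G = T H T⁻¹` for the regular matrix `T`. -/
def MatrixPair.SimilarVia {N : ℕ} (T : Matrix (Fin N) (Fin N) ℂ) (G H : MatrixPair N) : Prop :=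
  IsUnit T ∧ ∃ φ : G.alg ≃⋆ₐ[ℂ] H.alg, ∀ i j,
    φ (G.u i j) = (scalarMatrix H.alg T * H.u * scalarMatrix H.alg T⁻¹) i j

/-- The symmetric group `S_N` with the functions `u_ij(σ) = δ_{i σ(j)}`. -/
def symmetricGroup (N : ℕ) : MatrixPair N where
  alg := Equiv.Perm (Fin N) → ℂ
  u := Matrix.of fun i j σ => if i = σ j then 1 else 0

/-! ### Universal C*-algebras -/

/-- The Hilbert space `ℓ²(κ)`, `κ ⊆ ℕ`. Every separable complex Hilbert space is of this form. -/
abbrev SepHilbert (κ : Set ℕ) : Type := lp (fun _ : κ => ℂ) 2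

/-- Matrices of operators on a nonzero separable Hilbert space that satisfy the relations. -/
structure Rep (N : ℕ) (S : Gens) where
  index : Set ℕ
  nonempty : index.Nonempty
  v : Matrix (Fin N) (Fin N) (Op (SepHilbert index))
  relations : Relations S v

instance {N : ℕ} {S : Gens} (r : Rep N S) : Nontrivial (SepHilbert r.index) := by
  obtain ⟨n, hn⟩ := r.nonempty
  refine ⟨lp.single 2 (⟨n, hn⟩ : r.index) (1 : ℂ), 0, fun h => ?_⟩
  have h' := congrArg (fun f : SepHilbert r.index => f ⟨n, hn⟩) h
  simp at h'

theorem Rep.norm_le {N : ℕ} {S : Gens} (r : Rep N S) (i j : Fin N) : ‖r.v i j‖ ≤ 1 := by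
  refine ContinuousLinearMap.opNorm_le_bound _ zero_le_one fun x => ?_
  have key : ∀ m, (inner ℂ (r.v i m (r.v i m x)) x : ℂ) = ((‖r.v i m x‖ ^ 2 : ℝ) : ℂ) := by
    intro m
    have h := r.relations.selfAdjoint i m
    rw [ContinuousLinearMap.star_eq_adjoint] at h
    have h2 := ContinuousLinearMap.adjoint_inner_left (r.v i m) x (r.v i m x)
    rw [h] at h2
    rw [h2, inner_self_eq_norm_sq_to_K]
    push_cast
    rfl
  have hsum : (∑ m, r.v i m * r.v i m) = (1 : Op (SepHilbert r.index)) := by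
    have h := congrFun (congrFun r.relations.mul_transpose i) i
    simpa [Matrix.mul_apply] using h
  have h1 : (∑ m, ‖r.v i m x‖ ^ 2 : ℝ) = ‖x‖ ^ 2 := by
    have h2 : (inner ℂ ((∑ m, r.v i m * r.v i m) x) x : ℂ) = ((‖x‖ ^ 2 : ℝ) : ℂ) := by
      rw [hsum, ContinuousLinearMap.one_apply, inner_self_eq_norm_sq_to_K]
      push_cast
      rfl
    rw [ContinuousLinearMap.sum_apply, sum_inner] at h2
    simp only [ContinuousLinearMap.mul_apply, key] at h2
    exact_mod_cast h2
  have h3 : ‖r.v i j x‖ ^ 2 ≤ ‖x‖ ^ 2 := by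
    rw [← h1]
    exact Finset.single_le_sum (f := fun m => ‖r.v i m x‖ ^ 2) (fun _ _ => sq_nonneg _)
      (Finset.mem_univ j)
  rw [one_mul]
  exact (sq_le_sq₀ (norm_nonneg _) (norm_nonneg _)).1 h3

/-- The C*-algebra of bounded families of operators, indexed by all representations of the
relations on nonzero separable Hilbert spaces. -/
abbrev RepProduct (N : ℕ) (S : Gens) : Type :=
  lp (fun r : Rep N S => Op (SepHilbert r.index)) ∞

instance (N : ℕ) (S : Gens) : CStarAlgebra (RepProduct N S) where

/-- The universal generators. -/
def universalGen (N : ℕ) (S : Gens) (i j : Fin N) : RepProduct N S :=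
  ⟨fun r => r.v i j, memℓp_infty ⟨1, by rintro _ ⟨r, rfl⟩; exact r.norm_le i j⟩⟩

/-- The universal C*-algebra with self-adjoint generators `u_ij` and the relations
`u uᵗ = uᵗ u = 1` and `T_p u^{⊗ k} = u^{⊗ l} T_p` for `p ∈ S`, as the C*-algebra generated by
the `u_ij` in the product of all representations of the relations on separable Hilbert spaces
(every representation restricts to a separable invariant subspace around any given vector). -/
def universalAlgebra (N : ℕ) (S : Gens) : StarSubalgebra ℂ (RepProduct N S) :=
  (StarAlgebra.adjoin ℂ
    (Set.range fun ij : Fin N × Fin N => universalGen N S ij.1 ij.2)).topologicalClosure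

instance (N : ℕ) (S : Gens) : IsClosed (universalAlgebra N S : Set (RepProduct N S)) :=
  StarSubalgebra.isClosed_topologicalClosure _

/-- The universal C*-algebra with its generators:
`C*(u_ij | u = ū, u uᵗ = uᵗ u = 1, T_p u^{⊗ k} = u^{⊗ l} T_p for all p ∈ S)`. -/
def quantumGroup (N : ℕ) (S : Gens) : MatrixPair N where
  alg := universalAlgebra N S
  cstar := StarSubalgebra.cstarAlgebra (universalAlgebra N S)
  u := Matrix.of fun i j => ⟨universalGen N S i j,
    StarSubalgebra.le_topologicalClosure _ (StarAlgebra.subset_adjoin ℂ _ ⟨(i, j), rfl⟩)⟩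

/-- The free orthogonal quantum group `O_N⁺`. -/
def freeOrthogonal (N : ℕ) : MatrixPair N := quantumGroup N ∅

/-- The free hyperoctahedral quantum group `H_N⁺`. -/
def freeHyperoctahedral (N : ℕ) : MatrixPair N := quantumGroup N (gen (single fourPart))

/-- `G` lies between `S_N` and `O_N⁺`, and its intertwiner spaces are given by `K`. -/
structure MatrixPair.CorrespondsTo {N : ℕ} (G : MatrixPair N) (K : LinCat N) : Prop where
  isCMQG : G.IsCMQG
  symmetric_le : (symmetricGroup N).IsSubgroup G
  le_orthogonal : G.IsSubgroup (freeOrthogonal N)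
  mor_eq : ∀ k l, Mor G.u k l = mapT N '' (K.hom k l : Set (PLin k l))

/-- The matrix of `T_{τ_(N)}` on `ℂ^N`. -/
def tauMatrix (N : ℕ) : Matrix (Fin N) (Fin N) ℂ :=
  Matrix.of fun i j => mapT N (tau N) (fun _ => i) (fun _ => j)

end LinPart

end

open scoped TensorProduct ENNReal

noncomputable section

namespace LinPart

/-! ### The functor `p ↦ T_p` on partitions -/

/-! The partition `τ = | - (2/N) d` is a reflection: composing `d` with itself leaves one closed
component, so `d² = N d`, `d / N` is a projection and `τ² = |`. Moreover `τ` is self-adjoint and `τ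
⊗ τ` fixes the pair partition. So `scriptT` is an involutive monoidal `*`-functor that fixes
identity and pair, and it exchanges the categories generated by `p` and by `𝒯 p`
(`isMonoidalStarIso_scriptT`). Expanding `τ^{⊗4} b_4` over the sets of cut legs gives the explicit
formula (`scriptT_fourPart`). The laws of the category operations behind this are read off from
matrices: for two labels, `T_p` determines `p` and the exponent of a factor `2^a` in front of it, so
each law follows from the corresponding law for matrices.

The category `⟨b_4⟩` lies in the span of the partitions with even blocks, whereas `𝒯 b_4` has
coefficient `-2/N` at a partition with blocks of sizes 1 and 3; hence `𝒯 b_4 ∉ ⟨b_4⟩`. If `⟨𝒯 b_4⟩`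
were easy, it would contain `b_4`, which occurs in `𝒯 b_4` with coefficient 1; applying `𝒯` would
put `𝒯 b_4` into `⟨b_4⟩`.

For every set of relations the universal C*-algebra is a compact matrix quantum group with the
expected intertwiners (`correspondsTo_quantumGroup`). The comultiplication comes from the universal
property (`exists_lift`), applied to `∑ₖ u_ik ⊗ u_kj`. The hard inclusion is Tannaka–Krein duality
(`TensorSystem.mem_hom_of_mem_Mor`). The Hilbert–Schmidt projections onto the spaces `C(k, l)` play
the role of the Haar state: their entries form a Gram matrix on the coefficients of all tensor
powers. It is positive because the projection onto a `*`-algebra of matrices is completely positive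
(`choiMatrix_posSemidef`). The generators act on the resulting Hilbert space and satisfy the
relations, and testing an intertwiner `T` on the vacuum vector shows that `T` equals its projection
to `C(k, l)`.

Conjugation by `T_τ` exchanges the relations of `b_4` and `𝒯 b_4`, so the universal property yields
mutually inverse homomorphisms (`similarVia_tauMatrix`). The two groups differ because the diagonal
sign matrices are points of `H_N⁺`, but for `N ≥ 3` some of them do not fix the vector of `𝒯 b_4`
(`not_identical`). -/

theorem map_le_ker_iff {α β γ : Type*} (r : Setoid α) (f : α → β) (g : β → γ) :
    Setoid.map r f ≤ Setoid.ker g ↔ r ≤ Setoid.ker (g ∘ f) := by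
  constructor
  · intro h x y hxy
    exact h (Relation.EqvGen.rel _ _ ⟨x, y, hxy, rfl, rfl⟩)
  · intro h
    refine Setoid.eqvGen_le ?_
    rintro _ _ ⟨x, y, hxy, rfl, rfl⟩
    exact h hxy

/-- A labelling is constant on connected components as soon as it is constant on the blocks of both
diagrams; no description of the generated equivalence relation is needed. -/
theorem glue_le_ker_iff {γ : Type*} {k l m : ℕ} (q : Part l m) (p : Part k l)
    (f : Fin k ⊕ (Fin l ⊕ Fin m) → γ) :
    glue q p ≤ Setoid.ker f ↔
      p ≤ Setoid.ker (f ∘ Sum.map id Sum.inl) ∧ q ≤ Setoid.ker (f ∘ Sum.inr) := by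
  rw [glue, sup_le_iff, map_le_ker_iff, map_le_ker_iff]

open Classical in
theorem mapOfPart_apply (M : ℕ) {k l : ℕ} (p : Part k l) (j : Fin l → Fin M) (i : Fin k → Fin M) :
    mapOfPart M p j i = if p ≤ Setoid.ker (Sum.elim i j) then 1 else 0 := by
  simp only [mapOfPart, Matrix.of_apply]
  congr 1

/-- After regrouping the points into those of `p` and those of `q`, the relation becomes the kernel
of a map into a disjoint sum, so no condition links the two sides. -/
theorem tensorPart_le_ker_iff {γ : Type*} {k l k' l' : ℕ} (p : Part k l) (q : Part k' l')
    (i : Fin (k + k') → γ) (j : Fin (l + l') → γ) :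
    tensorPart p q ≤ Setoid.ker (Sum.elim i j) ↔
      p ≤ Setoid.ker (Sum.elim (i ∘ Fin.castAdd k') (j ∘ Fin.castAdd l')) ∧
      q ≤ Setoid.ker (Sum.elim (i ∘ Fin.natAdd k) (j ∘ Fin.natAdd l)) := by
  set E : Fin (k + k') ⊕ Fin (l + l') ≃ (Fin k ⊕ Fin l) ⊕ (Fin k' ⊕ Fin l') :=
    (Equiv.sumCongr finSumFinEquiv.symm finSumFinEquiv.symm).trans
      (Equiv.sumSumSumComm (Fin k) (Fin k') (Fin l) (Fin l')) with hE
  have hf : Sum.elim (Sum.elim (i ∘ Fin.castAdd k') (j ∘ Fin.castAdd l'))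
      (Sum.elim (i ∘ Fin.natAdd k) (j ∘ Fin.natAdd l)) = Sum.elim i j ∘ E.symm := by
    funext x
    rcases x with (x | x) | (x | x) <;> simp [hE]
  set A := Sum.elim (i ∘ Fin.castAdd k') (j ∘ Fin.castAdd l')
  set B := Sum.elim (i ∘ Fin.natAdd k) (j ∘ Fin.natAdd l)
  have key : tensorPart p q ≤ Setoid.ker (Sum.elim i j) ↔
      ∀ X Y, Sum.map (Quotient.mk p) (Quotient.mk q) X = Sum.map (Quotient.mk p) (Quotient.mk q) Y →
        Sum.elim A B X = Sum.elim A B Y := by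
    rw [hf]
    constructor
    · intro h X Y hXY
      refine @h (E.symm X) (E.symm Y) ?_
      change Sum.map _ _ (E (E.symm X)) = Sum.map _ _ (E (E.symm Y))
      simpa using hXY
    · intro h x y hxy
      have := h (E x) (E y) hxy
      simpa using this
  rw [key]
  constructor
  · intro h
    refine ⟨fun x y hxy => ?_, fun x y hxy => ?_⟩
    · exact h (Sum.inl x) (Sum.inl y) (congrArg Sum.inl (Quotient.sound hxy))
    · exact h (Sum.inr x) (Sum.inr y) (congrArg Sum.inr (Quotient.sound hxy))
  · rintro ⟨h1, h2⟩ (x | x) (y | y) hxy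
    · exact h1 (Quotient.exact (Sum.inl_injective hxy))
    · cases hxy
    · cases hxy
    · exact h2 (Quotient.exact (Sum.inr_injective hxy))

theorem mapOfPart_tensorPart (M : ℕ) {k l k' l' : ℕ} (p : Part k l) (q : Part k' l')
    (j : Fin (l + l') → Fin M) (i : Fin (k + k') → Fin M) :
    mapOfPart M (tensorPart p q) j i =
      mapOfPart M p (j ∘ Fin.castAdd l') (i ∘ Fin.castAdd k') *
        mapOfPart M q (j ∘ Fin.natAdd l) (i ∘ Fin.natAdd k) := by
  classical
  simp only [mapOfPart_apply, tensorPart_le_ker_iff]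
  split_ifs <;> simp_all

theorem mapOfPart_starPart (M : ℕ) {k l : ℕ} (p : Part k l) (i : Fin k → Fin M)
    (j : Fin l → Fin M) : mapOfPart M (starPart p) i j = mapOfPart M p j i := by
  classical
  simp only [mapOfPart_apply]
  congr 1
  refine propext ⟨fun h x y hxy => ?_, fun h x y hxy => ?_⟩
  · have := @h x.swap y.swap (by
      change p x.swap.swap y.swap.swap
      simpa using hxy)
    rcases x with x | x <;> rcases y with y | y <;> simpa using this
  · have := @h x.swap y.swap hxy
    rcases x with x | x <;> rcases y with y | y <;> simpa using this

/-- The values on the image of `o` are forced, those on the classes missed by `o` are free. With `Q`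
the components of a glued diagram and `X` its outer points, the missed classes are the closed
components. -/
theorem card_extensions {X Q : Type} [Finite Q] (M : ℕ) (o : X → Q) (c : X → Fin M)
    (h : ∀ x y, o x = o y → c x = c y) :
    Nat.card {F : Q → Fin M // ∀ x, F (o x) = c x} = M ^ Nat.card {q : Q // ∀ x, o x ≠ q} := by
  classical
  have e : {F : Q → Fin M // ∀ x, F (o x) = c x} ≃ ({q : Q // ∀ x, o x ≠ q} → Fin M) :=
    { toFun := fun F q => F.1 q.1
      invFun := fun g => ⟨fun q => if h : ∃ x, o x = q then c h.choose else g ⟨q, not_exists.1 h⟩,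
        fun x => by
          have hx : ∃ y, o y = o x := ⟨x, rfl⟩
          simp only [dif_pos hx]
          exact h _ _ hx.choose_spec⟩
      left_inv := fun F => by
        ext1
        funext q
        by_cases hq : ∃ x, o x = q
        · simp only [dif_pos hq]
          rw [← F.2, hq.choose_spec]
        · simp only [dif_neg hq]
      right_inv := fun g => by
        funext q
        have hq : ¬ ∃ x, o x = q.1 := not_exists.2 q.2
        simp only [dif_neg hq] }
  rw [Nat.card_congr e, Nat.card_fun]
  simp

/-- An entry of the product counts the labellings of the middle points compatible with both
diagrams. These are the labellings of the components with prescribed outer values: none if the outer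
labels clash, and otherwise `M` choices for each closed component. -/
theorem mapOfPart_mul (M : ℕ) {k l m : ℕ} (q : Part l m) (p : Part k l) :
    mapOfPart M q * mapOfPart M p = ((M : ℂ) ^ loops q p) • mapOfPart M (compPart q p) := by
  classical
  ext j i
  have h1 : (mapOfPart M q * mapOfPart M p) j i =
      Nat.card {s : Fin l → Fin M // glue q p ≤ Setoid.ker (Sum.elim i (Sum.elim s j))} := by
    rw [Matrix.mul_apply, Nat.card_eq_fintype_card, Fintype.card_subtype, Finset.card_filter]
    push_cast
    refine Finset.sum_congr rfl fun s _ => ?_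
    rw [mapOfPart_apply, mapOfPart_apply, glue_le_ker_iff]
    have e1 : Sum.elim i (Sum.elim s j) ∘ Sum.map id Sum.inl = Sum.elim i s := by
      funext x; rcases x with x | x <;> rfl
    have e2 : Sum.elim i (Sum.elim s j) ∘ Sum.inr = Sum.elim s j := rfl
    rw [e1, e2]
    split_ifs <;> simp_all
  have e : {s : Fin l → Fin M // glue q p ≤ Setoid.ker (Sum.elim i (Sum.elim s j))} ≃
      {F : Quotient (glue q p) → Fin M //
        ∀ x, F (Quotient.mk (glue q p) (outer k l m x)) = Sum.elim i j x} :=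
    { toFun := fun s => ⟨Quotient.lift (Sum.elim i (Sum.elim s.1 j)) (fun _ _ h => s.2 h),
        fun x => by rcases x with x | x <;> rfl⟩
      invFun := fun F => ⟨fun a => F.1 (Quotient.mk _ (Sum.inr (Sum.inl a))), by
        have : Sum.elim i (Sum.elim (fun a => F.1 (Quotient.mk _ (Sum.inr (Sum.inl a)))) j) =
            fun x => F.1 (Quotient.mk _ x) := by
          funext x
          rcases x with x | x | x
          · exact (F.2 (Sum.inl x)).symm
          · rfl
          · exact (F.2 (Sum.inr x)).symm
        rw [this]
        exact fun x y hxy => congrArg F.1 (Quotient.sound hxy)⟩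
      left_inv := fun s => by ext1; rfl
      right_inv := fun F => by
        ext1
        funext x
        induction x using Quotient.ind with
        | _ x =>
          rcases x with x | x | x
          · exact (F.2 (Sum.inl x)).symm
          · rfl
          · exact (F.2 (Sum.inr x)).symm }
  rw [h1, Nat.card_congr e, Matrix.smul_apply, mapOfPart_apply]
  split_ifs with h
  · have h2 := card_extensions M (fun x => Quotient.mk (glue q p) (outer k l m x)) (Sum.elim i j)
      (fun x y hxy => @h x y (show glue q p (outer k l m x) (outer k l m y) from
        Quotient.exact hxy))
    rw [h2]
    simp [loops]
  · rw [smul_zero, Nat.cast_eq_zero, Nat.card_eq_zero]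
    left
    refine ⟨fun F => h fun x y hxy => ?_⟩
    change Sum.elim i j x = Sum.elim i j y
    rw [← F.2 x, ← F.2 y]
    exact congrArg F.1 (Quotient.sound hxy)

/-- Two labels suffice to recognise a block, by labelling it with 1 and all other points with 0. -/
theorem mapOfPart_two_injective {k l : ℕ} :
    Function.Injective (mapOfPart 2 : Part k l → _) := by
  classical
  have key : ∀ p q : Part k l, mapOfPart 2 p = mapOfPart 2 q → p ≤ q := by
    intro p q h x y hxy
    -- The indicator of the `q`-block of `x` is admissible for `q`, hence for `p`, and so forces `y`
    -- into that block.
    set f : Fin k ⊕ Fin l → Fin 2 := fun z => if q x z then 1 else 0 with hf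
    have hq : mapOfPart 2 q (f ∘ Sum.inr) (f ∘ Sum.inl) = 1 := by
      rw [mapOfPart_apply, Sum.elim_comp_inl_inr, if_pos]
      intro a b hab
      have : q x a ↔ q x b := ⟨fun h => q.trans h hab, fun h => q.trans h (q.symm hab)⟩
      simp [hf, Setoid.ker_def, this]
    rw [← h, mapOfPart_apply, Sum.elim_comp_inl_inr] at hq
    split_ifs at hq with hp
    · have h2 : f x = f y := hp hxy
      by_contra h4
      exact absurd h2 (by simp [hf, show ¬ q x y from h4])
    · simp at hq
  exact fun p q h => le_antisymm (key p q h) (key q p h.symm)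

theorem mapOfPart_const {k l : ℕ} (p : Part k l) :
    mapOfPart 2 p (fun _ => 0) (fun _ => 0) = 1 := by
  classical
  rw [mapOfPart_apply, if_pos]
  rintro (x | x) (y | y) _ <;> rfl

/-- The entry at constant labels is 1 for every partition, so the scalar is visible there. This
turns one matrix identity into both the equality of partitions and that of loop numbers. -/
theorem eq_of_smul_mapOfPart {k l : ℕ} {p q : Part k l} {a b : ℕ}
    (h : ((2 : ℕ) : ℂ) ^ a • mapOfPart 2 p = ((2 : ℕ) : ℂ) ^ b • mapOfPart 2 q) :
    p = q ∧ a = b := by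
  have h1 := congrFun (congrFun h fun _ => 0) fun _ => 0
  simp only [Matrix.smul_apply, mapOfPart_const, smul_eq_mul, mul_one] at h1
  have h2 : a = b := by
    have : 2 ^ a = 2 ^ b := by exact_mod_cast h1
    exact Nat.pow_right_injective le_rfl this
  subst h2
  refine ⟨mapOfPart_two_injective ?_, rfl⟩
  exact smul_right_injective _ (pow_ne_zero a (by norm_num)) h

/-! ### The laws of the category operations on partitions -/

theorem compPart_assoc {k l m n : ℕ} (r : Part m n) (q : Part l m) (p : Part k l) :
    compPart r (compPart q p) = compPart (compPart r q) p ∧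
      loops q p + loops r (compPart q p) = loops r q + loops (compPart r q) p := by
  apply eq_of_smul_mapOfPart
  rw [pow_add, mul_smul, ← mapOfPart_mul, ← Matrix.mul_smul, ← mapOfPart_mul, ← Matrix.mul_assoc,
    mapOfPart_mul, Matrix.smul_mul, mapOfPart_mul, smul_smul, pow_add]

theorem sum_prod_append {M : ℕ} {k k' : ℕ} {R : Type*} [AddCommMonoid R]
    (f : (Fin (k + k') → Fin M) → R) :
    ∑ s, f s = ∑ a : Fin k → Fin M, ∑ b : Fin k' → Fin M, f (Fin.append a b) := by
  rw [← Fintype.sum_prod_type', ← (Fin.appendEquiv k k').sum_comp]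
  rfl

theorem append_comp_castAdd {α : Type*} {k k' : ℕ} (a : Fin k → α) (b : Fin k' → α) :
    Fin.append a b ∘ Fin.castAdd k' = a := funext fun x => by simp

theorem append_comp_natAdd {α : Type*} {k k' : ℕ} (a : Fin k → α) (b : Fin k' → α) :
    Fin.append a b ∘ Fin.natAdd k = b := funext fun x => by simp

theorem compPart_tensorPart {k l m k' l' m' : ℕ} (q : Part l m) (p : Part k l)
    (q' : Part l' m') (p' : Part k' l') :
    compPart (tensorPart q q') (tensorPart p p') = tensorPart (compPart q p) (compPart q' p') ∧
      loops (tensorPart q q') (tensorPart p p') = loops q p + loops q' p' := by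
  apply eq_of_smul_mapOfPart
  rw [← mapOfPart_mul]
  ext j i
  have h1 := congrFun (congrFun (mapOfPart_mul 2 q p) (j ∘ Fin.castAdd m')) (i ∘ Fin.castAdd k')
  have h2 := congrFun (congrFun (mapOfPart_mul 2 q' p') (j ∘ Fin.natAdd m)) (i ∘ Fin.natAdd k)
  rw [Matrix.smul_apply, mapOfPart_tensorPart, pow_add, smul_eq_mul, mul_mul_mul_comm]
  rw [Matrix.smul_apply, smul_eq_mul] at h1 h2
  rw [← h1, ← h2, Matrix.mul_apply, Matrix.mul_apply, Matrix.mul_apply, sum_prod_append,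
    Finset.sum_mul_sum]
  refine Finset.sum_congr rfl fun a _ => Finset.sum_congr rfl fun b _ => ?_
  simp only [mapOfPart_tensorPart, append_comp_castAdd, append_comp_natAdd]
  ring

theorem starPart_compPart {k l m : ℕ} (q : Part l m) (p : Part k l) :
    starPart (compPart q p) = compPart (starPart p) (starPart q) ∧
      loops q p = loops (starPart p) (starPart q) := by
  apply eq_of_smul_mapOfPart
  rw [← mapOfPart_mul]
  ext i j
  have h1 := congrFun (congrFun (mapOfPart_mul 2 q p) j) i
  rw [Matrix.smul_apply] at h1
  rw [Matrix.smul_apply, mapOfPart_starPart, ← h1, Matrix.mul_apply, Matrix.mul_apply]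
  exact Finset.sum_congr rfl fun s _ => by
    rw [mapOfPart_starPart, mapOfPart_starPart, mul_comm]

theorem starPart_tensorPart {k l k' l' : ℕ} (p : Part k l) (q : Part k' l') :
    starPart (tensorPart p q) = tensorPart (starPart p) (starPart q) := by
  apply mapOfPart_two_injective
  ext i j
  simp only [mapOfPart_starPart, mapOfPart_tensorPart]

/-- A last factor on `1 + 1` points suffices for the recursion of `tensorPow`, and it makes the two
index types definitionally equal, so no cast appears. -/
theorem tensorPart_assoc {k l k' l' : ℕ} (p : Part k l) (q : Part k' l') (r : Part 1 1) :
    tensorPart (k := k + k') (l := l + l') (tensorPart p q) r =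
      tensorPart (k' := k' + 1) (l' := l' + 1) p (tensorPart q r) := by
  apply mapOfPart_two_injective
  ext j i
  erw [mapOfPart_tensorPart, mapOfPart_tensorPart, mapOfPart_tensorPart, mapOfPart_tensorPart,
    mul_assoc]
  have hj : j ∘ Fin.natAdd (l + l') = (j ∘ Fin.natAdd l) ∘ Fin.natAdd l' :=
    funext fun x => congrArg j (Fin.ext (Nat.add_assoc _ _ _))
  have hi : i ∘ Fin.natAdd (k + k') = (i ∘ Fin.natAdd k) ∘ Fin.natAdd k' :=
    funext fun x => congrArg i (Fin.ext (Nat.add_assoc _ _ _))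
  rw [hj, hi]
  rfl

theorem mapOfPart_emptyPart (M : ℕ) (j i : Fin 0 → Fin M) : mapOfPart M emptyPart j i = 1 := by
  classical
  rw [mapOfPart_apply, if_pos]
  rintro (x | x) <;> exact x.elim0

theorem tensorPart_emptyPart {k l : ℕ} (p : Part k l) : tensorPart p emptyPart = p := by
  apply mapOfPart_two_injective
  ext j i
  erw [mapOfPart_tensorPart, mapOfPart_emptyPart, mul_one]
  rfl

/-- `| ⊗ ⋯ ⊗ |` as a partition. -/
def idPow : (n : ℕ) → Part n n
  | 0 => emptyPart
  | n + 1 => tensorPart (idPow n) idPart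

theorem mapOfPart_idPart (M : ℕ) (j i : Fin 1 → Fin M) :
    mapOfPart M idPart j i = if j = i then 1 else 0 := by
  classical
  rw [mapOfPart_apply]
  congr 1
  refine propext ⟨fun h => ?_, fun h => ?_⟩
  · funext x
    exact (@h (Sum.inr x) (Sum.inl x) trivial)
  · subst h
    rintro (x | x) (y | y) _ <;> exact congrArg j (Subsingleton.elim _ _)

theorem mapOfPart_idPow (M n : ℕ) : mapOfPart M (idPow n) = 1 := by
  induction n with
  | zero =>
    ext j i
    rw [idPow, mapOfPart_emptyPart, Subsingleton.elim j i, Matrix.one_apply_eq]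
  | succ n ih =>
    ext j i
    erw [idPow, mapOfPart_tensorPart, ih, mapOfPart_idPart, Matrix.one_apply, Matrix.one_apply]
    have : j = i ↔ j ∘ Fin.castAdd 1 = i ∘ Fin.castAdd 1 ∧ j ∘ Fin.natAdd n = i ∘ Fin.natAdd n := by
      refine ⟨by rintro rfl; exact ⟨rfl, rfl⟩, fun ⟨h1, h2⟩ => funext fun x => ?_⟩
      refine Fin.addCases (fun y => congrFun h1 y) (fun y => congrFun h2 y) x
    simp only [this]
    split_ifs <;> simp_all

theorem idPow_compPart {k l : ℕ} (p : Part k l) :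
    compPart (idPow l) p = p ∧ loops (idPow l) p = 0 := by
  apply eq_of_smul_mapOfPart
  rw [← mapOfPart_mul, mapOfPart_idPow, Matrix.one_mul, pow_zero, one_smul]

theorem compPart_idPow {k l : ℕ} (p : Part k l) :
    compPart p (idPow k) = p ∧ loops p (idPow k) = 0 := by
  apply eq_of_smul_mapOfPart
  rw [← mapOfPart_mul, mapOfPart_idPow, Matrix.mul_one, pow_zero, one_smul]

/-! ### The laws of the category operations on linear combinations -/

theorem PLin.induction {k l : ℕ} {C : PLin k l → Prop} (hs : ∀ p, C (single p))
    (ha : ∀ x y, C x → C y → C (x + y)) (hm : ∀ (c : ℂ) x, C x → C (c • x)) (x : PLin k l) :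
    C x := by
  induction x using Finsupp.induction_linear with
  | zero => simpa using hm 0 _ (hs ⊤)
  | add f g hf hg => exact ha f g hf hg
  | single a b =>
    have := hm b _ (hs a)
    rwa [single, Finsupp.smul_single, smul_eq_mul, mul_one] at this

theorem tensor_single {k l k' l' : ℕ} (p : Part k l) (q : Part k' l') :
    tensor (single p) (single q) = single (tensorPart p q) := by
  simp [tensor, single]

theorem comp_single (N : ℕ) {k l m : ℕ} (q : Part l m) (p : Part k l) :
    comp N (single q) (single p) = ((N : ℂ) ^ loops q p) • single (compPart q p) := by
  simp [comp, single]

theorem involution_single {k l : ℕ} (p : Part k l) :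
    involution (single p) = single (starPart p) := by
  simp [involution, single]

theorem involution_add {k l : ℕ} (x y : PLin k l) :
    involution (x + y) = involution x + involution y := by
  classical
  exact Finsupp.sum_add_index' (by simp) (by simp [add_smul])

theorem involution_smul {k l : ℕ} (c : ℂ) (x : PLin k l) :
    involution (c • x) = star c • involution x := by
  rw [involution, Finsupp.sum_smul_index' (by simp), involution, Finsupp.smul_sum]
  simp [smul_smul]

theorem comp_assoc (N : ℕ) {k l m n : ℕ} (r : PLin m n) (q : PLin l m) (p : PLin k l) :
    comp N r (comp N q p) = comp N (comp N r q) p := by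
  induction r using PLin.induction with
  | ha x y hx hy => simp only [map_add, LinearMap.add_apply, hx, hy]
  | hm c x hx => simp only [map_smul, LinearMap.smul_apply, hx]
  | hs r =>
  induction q using PLin.induction with
  | ha x y hx hy => simp only [map_add, LinearMap.add_apply, hx, hy]
  | hm c x hx => simp only [map_smul, LinearMap.smul_apply, hx]
  | hs q =>
  induction p using PLin.induction with
  | ha x y hx hy => simp only [map_add, hx, hy]
  | hm c x hx => simp only [map_smul, hx]
  | hs p =>
  simp only [comp_single, map_smul, LinearMap.smul_apply, smul_smul, ← pow_add,
    (compPart_assoc r q p).1, (compPart_assoc r q p).2]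

theorem comp_tensor (N : ℕ) {k l m k' l' m' : ℕ} (q : PLin l m) (p : PLin k l) (q' : PLin l' m')
    (p' : PLin k' l') :
    comp N (tensor q q') (tensor p p') = tensor (comp N q p) (comp N q' p') := by
  induction q using PLin.induction with
  | ha x y hx hy => simp only [map_add, LinearMap.add_apply, hx, hy]
  | hm c x hx => simp only [map_smul, LinearMap.smul_apply, hx]
  | hs q =>
  induction p using PLin.induction with
  | ha x y hx hy => simp only [map_add, LinearMap.add_apply, hx, hy]
  | hm c x hx => simp only [map_smul, LinearMap.smul_apply, hx]
  | hs p =>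
  induction q' using PLin.induction with
  | ha x y hx hy => simp only [map_add, LinearMap.add_apply, hx, hy]
  | hm c x hx => simp only [map_smul, LinearMap.smul_apply, hx]
  | hs q' =>
  induction p' using PLin.induction with
  | ha x y hx hy => simp only [map_add, hx, hy]
  | hm c x hx => simp only [map_smul, hx]
  | hs p' =>
  simp only [comp_single, tensor_single, map_smul, LinearMap.smul_apply, smul_smul, ← pow_add,
    (compPart_tensorPart q p q' p').1, (compPart_tensorPart q p q' p').2, add_comm]

theorem involution_comp (N : ℕ) {k l m : ℕ} (q : PLin l m) (p : PLin k l) :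
    involution (comp N q p) = comp N (involution p) (involution q) := by
  induction q using PLin.induction with
  | ha x y hx hy => simp only [map_add, LinearMap.add_apply, involution_add, hx, hy]
  | hm c x hx => simp only [map_smul, LinearMap.smul_apply, involution_smul, hx]
  | hs q =>
  induction p using PLin.induction with
  | ha x y hx hy => simp only [map_add, LinearMap.add_apply, involution_add, hx, hy]
  | hm c x hx => simp only [map_smul, LinearMap.smul_apply, involution_smul, hx]
  | hs p =>
  simp only [comp_single, involution_single, involution_smul, (starPart_compPart q p).1,
    (starPart_compPart q p).2, star_pow, star_natCast]

theorem involution_tensor {k l k' l' : ℕ} (p : PLin k l) (q : PLin k' l') :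
    involution (tensor p q) = tensor (involution p) (involution q) := by
  induction p using PLin.induction with
  | ha x y hx hy => simp only [map_add, LinearMap.add_apply, involution_add, hx, hy]
  | hm c x hx => simp only [map_smul, LinearMap.smul_apply, involution_smul, hx]
  | hs p =>
  induction q using PLin.induction with
  | ha x y hx hy => simp only [map_add, involution_add, hx, hy]
  | hm c x hx => simp only [map_smul, involution_smul, hx]
  | hs q => simp only [tensor_single, involution_single, starPart_tensorPart]

theorem tensor_assoc {k l k' l' : ℕ} (p : PLin k l) (q : PLin k' l') (r : PLin 1 1) :
    tensor (k := k + k') (l := l + l') (tensor p q) r =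
      tensor (k' := k' + 1) (l' := l' + 1) p (tensor q r) := by
  induction p using PLin.induction with
  | ha x y hx hy => simp only [map_add, LinearMap.add_apply, hx, hy]
  | hm c x hx => simp only [map_smul, LinearMap.smul_apply, hx]
  | hs p =>
  induction q using PLin.induction with
  | ha x y hx hy => simp only [map_add, LinearMap.add_apply, hx, hy]
  | hm c x hx => simp only [map_smul, LinearMap.smul_apply, hx]
  | hs q =>
  induction r using PLin.induction with
  | ha x y hx hy => simp only [map_add, hx, hy]
  | hm c x hx => simp only [map_smul, hx]
  | hs r =>
    rw [tensor_single, tensor_single, tensor_single, tensor_single]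
    exact congrArg single (tensorPart_assoc p q r)

theorem tensor_emptyPart {k l : ℕ} (p : PLin k l) : tensor p (single emptyPart) = p := by
  induction p using PLin.induction with
  | ha x y hx hy =>
    rw [map_add, LinearMap.add_apply, hx, hy]
  | hm c x hx =>
    rw [map_smul, LinearMap.smul_apply, hx]
  | hs p =>
    rw [tensor_single]
    exact congrArg single (tensorPart_emptyPart p)

theorem tensorPow_single_idPart (n : ℕ) : tensorPow (single idPart) n = single (idPow n) := by
  induction n with
  | zero => rfl
  | succ n ih =>
    rw [tensorPow, ih, tensor_single]
    rfl

theorem idPow_comp (N : ℕ) {k l : ℕ} (p : PLin k l) : comp N (single (idPow l)) p = p := by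
  induction p using PLin.induction with
  | ha x y hx hy => rw [map_add, hx, hy]
  | hm c x hx => rw [map_smul, hx]
  | hs p => rw [comp_single, (idPow_compPart p).1, (idPow_compPart p).2, pow_zero, one_smul]

theorem comp_idPow (N : ℕ) {k l : ℕ} (p : PLin k l) : comp N p (single (idPow k)) = p := by
  induction p using PLin.induction with
  | ha x y hx hy => rw [map_add, LinearMap.add_apply, hx, hy]
  | hm c x hx => rw [map_smul, LinearMap.smul_apply, hx]
  | hs p => rw [comp_single, (compPart_idPow p).1, (compPart_idPow p).2, pow_zero, one_smul]

theorem tensorPow_add (p : PLin 1 1) (k k' : ℕ) :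
    tensorPow p (k + k') = tensor (tensorPow p k) (tensorPow p k') := by
  induction k' with
  | zero => exact (tensor_emptyPart (tensorPow p k)).symm
  | succ n ih =>
    change tensor (tensorPow p (k + n)) p = tensor (tensorPow p k) (tensor (tensorPow p n) p)
    rw [ih, tensor_assoc]

theorem tensorPow_comp_tensorPow (N : ℕ) (p q : PLin 1 1) (n : ℕ) :
    comp N (tensorPow p n) (tensorPow q n) = tensorPow (comp N p q) n := by
  induction n with
  | zero => exact idPow_comp N (k := 0) (l := 0) (single emptyPart)
  | succ n ih =>
    change comp N (tensor (tensorPow p n) p) (tensor (tensorPow q n) q) = _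
    rw [comp_tensor, ih]
    rfl

theorem involution_tensorPow (p : PLin 1 1) (n : ℕ) :
    involution (tensorPow p n) = tensorPow (involution p) n := by
  induction n with
  | zero =>
    change involution (single emptyPart) = single emptyPart
    rw [involution_single]
    congr 1
    apply mapOfPart_two_injective
    ext i j
    rw [mapOfPart_starPart, mapOfPart_emptyPart, mapOfPart_emptyPart]
  | succ n ih =>
    change involution (tensor (tensorPow p n) p) = _
    rw [involution_tensor, ih]
    rfl

/-! ### Linear combinations as linear maps -/

theorem mapT_single (N : ℕ) {k l : ℕ} (p : Part k l) : mapT N (single p) = mapOfPart N p := by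
  simp [mapT, single]

theorem mapT_comp (N : ℕ) {k l m : ℕ} (q : PLin l m) (p : PLin k l) :
    mapT N (comp N q p) = mapT N q * mapT N p := by
  induction q using PLin.induction with
  | ha x y hx hy => simp only [map_add, LinearMap.add_apply, hx, hy, Matrix.add_mul]
  | hm c x hx => simp only [map_smul, LinearMap.smul_apply, hx, Matrix.smul_mul]
  | hs q =>
  induction p using PLin.induction with
  | ha x y hx hy => simp only [map_add, hx, hy, Matrix.mul_add]
  | hm c x hx => simp only [map_smul, hx, Matrix.mul_smul]
  | hs p => rw [comp_single, map_smul, mapT_single, mapT_single, mapT_single, mapOfPart_mul]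

theorem mapT_tensor (N : ℕ) {k l k' l' : ℕ} (p : PLin k l) (q : PLin k' l')
    (j : Fin (l + l') → Fin N) (i : Fin (k + k') → Fin N) :
    mapT N (tensor p q) j i =
      mapT N p (j ∘ Fin.castAdd l') (i ∘ Fin.castAdd k') *
        mapT N q (j ∘ Fin.natAdd l) (i ∘ Fin.natAdd k) := by
  induction p using PLin.induction with
  | ha x y hx hy => simp only [map_add, LinearMap.add_apply, Matrix.add_apply, hx, hy, add_mul]
  | hm c x hx =>
    simp only [map_smul, LinearMap.smul_apply, Matrix.smul_apply, hx, smul_eq_mul, mul_assoc]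
  | hs p =>
  induction q using PLin.induction with
  | ha x y hx hy => simp only [map_add, Matrix.add_apply, hx, hy, mul_add]
  | hm c x hx => simp only [map_smul, Matrix.smul_apply, hx, smul_eq_mul, mul_left_comm]
  | hs q => rw [tensor_single, mapT_single, mapT_single, mapT_single, mapOfPart_tensorPart]

theorem mapT_involution (N : ℕ) {k l : ℕ} (p : PLin k l) :
    mapT N (involution p) = (mapT N p).conjTranspose := by
  induction p using PLin.induction with
  | ha x y hx hy => rw [involution_add, map_add, map_add, Matrix.conjTranspose_add, hx, hy]
  | hm c x hx => rw [involution_smul, map_smul, map_smul, Matrix.conjTranspose_smul, hx]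
  | hs p =>
    classical
    rw [involution_single, mapT_single, mapT_single]
    ext i j
    rw [mapOfPart_starPart, Matrix.conjTranspose_apply, mapOfPart_apply]
    split_ifs <;> simp

theorem mapT_idPow (N n : ℕ) : mapT N (single (idPow n)) = 1 := by
  rw [mapT_single, mapOfPart_idPow]

theorem idPow_one : idPow 1 = idPart := by
  apply mapOfPart_two_injective
  ext j i
  rw [mapOfPart_idPow, mapOfPart_idPart, Matrix.one_apply]

theorem mapT_pairPart (N : ℕ) (j : Fin 2 → Fin N) (i : Fin 0 → Fin N) :
    mapT N (single pairPart) j i = if j 0 = j 1 then 1 else 0 := by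
  classical
  rw [mapT_single, mapOfPart_apply]
  congr 1
  refine propext ⟨fun h => @h (Sum.inr 0) (Sum.inr 1) trivial, fun h => ?_⟩
  rintro (x | x) (y | y) _
  · exact x.elim0
  · exact x.elim0
  · exact y.elim0
  · change j x = j y
    fin_cases x <;> fin_cases y <;> simp [h]

/-! ### Generated categories -/

/-- The empty partition is not among the axioms; it is recovered from the composition of the pair
with its reflection. -/
theorem LinCat.idPow_mem {N : ℕ} (hN : 1 ≤ N) (K : LinCat N) (n : ℕ) :
    single (idPow n) ∈ K.hom n n := by
  induction n with
  | zero =>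
    have h := K.comp_mem (K.involution_mem K.pair_mem) K.pair_mem
    rw [involution_single, comp_single] at h
    have h2 := (K.hom 0 0).smul_mem ((N : ℂ) ^ loops (starPart pairPart) pairPart)⁻¹ h
    -- The composition is a power of `N` times a partition without points; dividing by this power
    -- needs `N ≠ 0`.
    rw [inv_smul_smul₀ (pow_ne_zero _ (by exact_mod_cast (by omega : N ≠ 0)))] at h2
    convert h2 using 2
    apply mapOfPart_two_injective
    ext i j
    change mapOfPart 2 emptyPart i j = _
    rw [mapOfPart_emptyPart, Subsingleton.elim i fun _ => 0, Subsingleton.elim j fun _ => 0,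
      mapOfPart_const]
  | succ n ih =>
    have := K.tensor_mem ih K.id_mem
    rwa [tensor_single] at this

theorem generated_contains (N : ℕ) (S : Gens) : (generated N S).Contains S := by
  intro x hx
  simp only [generated, Submodule.mem_iInf]
  exact fun K hK => hK x hx

theorem generated_le {N : ℕ} {S : Gens} {K : LinCat N} (h : K.Contains S) (k l : ℕ) :
    (generated N S).hom k l ≤ K.hom k l :=
  iInf₂_le K h

theorem mem_generated_gen (N : ℕ) {k l : ℕ} (p : PLin k l) : p ∈ (generated N (gen p)).hom k l :=
  generated_contains N (gen p) ⟨(k, l), p⟩ rfl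

theorem contains_gen_iff {N : ℕ} {K : LinCat N} {k l : ℕ} {p : PLin k l} :
    K.Contains (gen p) ↔ p ∈ K.hom k l :=
  ⟨fun h => h ⟨(k, l), p⟩ rfl, fun h => by rintro _ rfl; exact h⟩

/-! ### The partition `τ` and the functor `𝒯` -/

theorem idPart_comp (N : ℕ) {k : ℕ} (p : PLin k 1) : comp N (single idPart) p = p := by
  rw [← idPow_one, idPow_comp]

theorem comp_idPart (N : ℕ) {l : ℕ} (p : PLin 1 l) : comp N p (single idPart) = p := by
  rw [← idPow_one, comp_idPow]

theorem mapOfPart_discPart (M : ℕ) (j i : Fin 1 → Fin M) : mapOfPart M discPart j i = 1 := by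
  classical
  rw [mapOfPart_apply, if_pos]
  intro x y hxy
  have : x = y := hxy
  rw [this]

theorem discPart_comp_discPart (N : ℕ) :
    comp N (single discPart) (single discPart) = (N : ℂ) • single discPart := by
  have h : compPart discPart discPart = discPart ∧ loops discPart discPart = 1 := by
    apply eq_of_smul_mapOfPart
    rw [← mapOfPart_mul]
    ext j i
    simp [Matrix.mul_apply, mapOfPart_discPart]
  rw [comp_single, h.1, h.2, pow_one]

theorem tau_comp_tau {N : ℕ} (hN : 1 ≤ N) : comp N (tau N) (tau N) = single idPart := by
  have hN' : (N : ℂ) ≠ 0 := by exact_mod_cast (by omega : N ≠ 0)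
  simp only [tau, map_sub, LinearMap.sub_apply, map_smul, LinearMap.smul_apply,
    discPart_comp_discPart, idPart_comp, comp_idPart, smul_smul]
  -- The coefficient of `d` in `τ²` is `-2/N - 2/N + (2/N)² N = 0`.
  rw [div_mul_cancel₀ _ hN']
  module

theorem involution_tau (N : ℕ) : involution (tau N) = tau N := by
  have h1 : starPart idPart = idPart := by
    apply mapOfPart_two_injective
    ext j i
    rw [mapOfPart_starPart, mapOfPart_idPart, mapOfPart_idPart]
    simp only [eq_comm]
  have h2 : starPart discPart = discPart := by
    apply mapOfPart_two_injective
    ext j i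
    rw [mapOfPart_starPart, mapOfPart_discPart, mapOfPart_discPart]
  rw [tau, sub_eq_add_neg, ← neg_smul, involution_add, involution_smul, involution_single,
    involution_single, h1, h2]
  simp

theorem tensorPow_tau_comp_self {N : ℕ} (hN : 1 ≤ N) (n : ℕ) :
    comp N (tensorPow (tau N) n) (tensorPow (tau N) n) = single (idPow n) := by
  rw [tensorPow_comp_tensorPow, tau_comp_tau hN, tensorPow_single_idPart]

theorem scriptT_apply (N : ℕ) {k l : ℕ} (p : PLin k l) :
    scriptT N k l p = comp N (tensorPow (tau N) l) (comp N p (tensorPow (tau N) k)) := rfl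

theorem scriptT_zero (N : ℕ) {l : ℕ} (p : PLin 0 l) :
    scriptT N 0 l p = comp N (tensorPow (tau N) l) p := by
  rw [scriptT_apply]
  congr 1
  exact comp_idPow N p

/-- The two inner copies of `τ^{⊗ l}` cancel because `τ² = |`. -/
theorem scriptT_comp {N : ℕ} (hN : 1 ≤ N) {k l m : ℕ} (q : PLin l m) (p : PLin k l) :
    scriptT N k m (comp N q p) = comp N (scriptT N l m q) (scriptT N k l p) := by
  simp only [scriptT_apply]
  rw [← comp_assoc N (tensorPow (tau N) m), ← comp_assoc N q, ← comp_assoc N q,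
    comp_assoc N (tensorPow (tau N) l) (tensorPow (tau N) l), tensorPow_tau_comp_self hN,
    idPow_comp]

theorem scriptT_tensor (N : ℕ) {k l k' l' : ℕ} (p : PLin k l) (q : PLin k' l') :
    scriptT N (k + k') (l + l') (tensor p q) = tensor (scriptT N k l p) (scriptT N k' l' q) := by
  simp only [scriptT_apply]
  rw [tensorPow_add, tensorPow_add, comp_tensor, comp_tensor]

theorem scriptT_involution (N : ℕ) {k l : ℕ} (p : PLin k l) :
    scriptT N l k (involution p) = involution (scriptT N k l p) := by
  simp only [scriptT_apply]
  rw [involution_comp, involution_comp, involution_tensorPow, involution_tensorPow, involution_tau,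
    comp_assoc]

theorem scriptT_scriptT {N : ℕ} (hN : 1 ≤ N) {k l : ℕ} (p : PLin k l) :
    scriptT N k l (scriptT N k l p) = p := by
  simp only [scriptT_apply]
  rw [← comp_assoc N _ _ (tensorPow (tau N) k), comp_assoc, tensorPow_tau_comp_self hN, idPow_comp,
    ← comp_assoc, tensorPow_tau_comp_self hN, comp_idPow]

theorem scriptT_idPow {N : ℕ} (hN : 1 ≤ N) (n : ℕ) :
    scriptT N n n (single (idPow n)) = single (idPow n) := by
  rw [scriptT_apply, idPow_comp, tensorPow_tau_comp_self hN]

/-! ### Expansion of `𝒯` on one-block partitions -/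

/-- The tensor product of a family of partitions with one upper and one lower point. -/
def tensorFam : (n : ℕ) → (Fin n → Part 1 1) → Part n n
  | 0, _ => emptyPart
  | n + 1, f => tensorPart (tensorFam n (Fin.init f)) (f (Fin.last n))

theorem mapOfPart_tensorFam (M n : ℕ) (f : Fin n → Part 1 1) (j i : Fin n → Fin M) :
    mapOfPart M (tensorFam n f) j i =
      ∏ a, mapOfPart M (f a) (fun _ => j a) (fun _ => i a) := by
  induction n with
  | zero => exact mapOfPart_emptyPart M j i
  | succ n ih =>
    erw [tensorFam, mapOfPart_tensorPart, ih, Fin.prod_univ_castSucc]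
    congr 2
    · exact funext fun x => congrArg j (Fin.ext (by simp [Fin.last]))
    · exact funext fun x => congrArg i (Fin.ext (by simp [Fin.last]))

/-- `τ` as a sum over `Bool` of coefficients times partitions. -/
def tauCoeff (N : ℕ) (b : Bool) : ℂ := if b then -(2 / (N : ℂ)) else 1

/-- The two partitions that occur in `τ`. -/
def tauPart (b : Bool) : Part 1 1 := if b then discPart else idPart

theorem tau_eq (N : ℕ) : tau N = ∑ b, tauCoeff N b • single (tauPart b) := by
  simp [tau, tauCoeff, tauPart]
  module

theorem tensorPow_tau (N n : ℕ) :
    tensorPow (tau N) n = ∑ ε : Fin n → Bool,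
      (∏ a, tauCoeff N (ε a)) • single (tensorFam n fun a => tauPart (ε a)) := by
  induction n with
  | zero => simp [tensorPow, tensorFam]
  | succ n ih =>
    rw [tensorPow, ih, ← (Fin.snocEquiv fun _ => Bool).sum_comp, Fintype.sum_prod_type, tau_eq,
      map_sum]
    refine Finset.sum_congr rfl fun b _ => ?_
    rw [map_smul, map_sum, LinearMap.sum_apply, Finset.smul_sum]
    refine Finset.sum_congr rfl fun x _ => ?_
    rw [map_smul, LinearMap.smul_apply, tensor_single, smul_smul, Fin.prod_univ_castSucc]
    simp [Fin.snocEquiv, tensorFam, Fin.init_def, mul_comm]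

/-- The points at which `ε` is true. -/
def trueSet {n : ℕ} (ε : Fin n → Bool) : Finset (Fin n) := Finset.univ.filter fun a => ε a = true

theorem blockWithSingletons_le_ker_iff {γ : Type*} {n : ℕ} (I : Finset (Fin n)) (i : Fin 0 → γ)
    (j : Fin n → γ) :
    blockWithSingletons I ≤ Setoid.ker (Sum.elim i j) ↔
      ∀ a ∉ I, ∀ b ∉ I, j a = j b := by
  constructor
  · intro h a ha b hb
    refine @h (Sum.inr a) (Sum.inr b) (Or.inr ⟨?_, ?_⟩)
    · rintro c hc ⟨⟩; exact ha hc
    · rintro c hc ⟨⟩; exact hb hc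
  · rintro h (x | x) (y | y) (hxy | ⟨hx, hy⟩)
    · exact x.elim0
    · exact x.elim0
    · exact x.elim0
    · exact x.elim0
    · exact y.elim0
    · exact y.elim0
    · rw [hxy]
    · exact h x (fun hc => hx x hc rfl) y (fun hc => hy y hc rfl)

/-- A true leg cuts its point off the block. The middle block loses contact with the outer points
only when every leg is cut, and this is the only case with a closed component. -/
theorem tensorFam_comp_top {n : ℕ} (hn : 1 ≤ n) (ε : Fin n → Bool) :
    compPart (tensorFam n fun a => tauPart (ε a)) (⊤ : Part 0 n) =
        blockWithSingletons (trueSet ε) ∧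
      loops (tensorFam n fun a => tauPart (ε a)) (⊤ : Part 0 n) =
        if ∀ a, ε a = true then 1 else 0 := by
  classical
  apply eq_of_smul_mapOfPart
  rw [← mapOfPart_mul]
  ext j i
  have : NeZero n := ⟨by omega⟩
  have htop : ∀ s : Fin n → Fin 2, mapOfPart 2 (⊤ : Part 0 n) s i =
      if s = (fun _ => s 0) then 1 else 0 := by
    intro s
    rw [mapOfPart_apply]
    congr 1
    refine propext ⟨fun h => funext fun a => @h (Sum.inr a) (Sum.inr 0) trivial, fun h => ?_⟩
    rintro (x | x) (y | y) _
    · exact x.elim0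
    · exact x.elim0
    · exact y.elim0
    · change s x = s y
      rw [h]
  have hfam : ∀ s : Fin n → Fin 2, mapOfPart 2 (tensorFam n fun a => tauPart (ε a)) j s =
      if ∀ a, ε a = false → j a = s a then 1 else 0 := by
    intro s
    rw [mapOfPart_tensorFam]
    refine (Finset.prod_congr rfl fun a _ => ?_).trans
      ((Fintype.prod_boole (p := fun a => ε a = false → j a = s a)).trans (by congr))
    cases h : ε a
    · simp [tauPart, mapOfPart_idPart, funext_iff]
    · simp [tauPart, mapOfPart_discPart]
  -- The block forces a constant middle labelling, so the sum over labellings becomes a sum over a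
  -- single label `c`.
  have hsum : (mapOfPart 2 (tensorFam n fun a => tauPart (ε a)) * mapOfPart 2 (⊤ : Part 0 n)) j i =
      ∑ c : Fin 2, if ∀ a, ε a = false → j a = c then (1 : ℂ) else 0 := by
    rw [Matrix.mul_apply]
    simp only [htop, hfam, mul_ite, mul_one, mul_zero]
    rw [← Finset.sum_filter]
    symm
    refine Finset.sum_bij (fun c _ => fun _ => c) ?_ ?_ ?_ ?_
    · simp
    · intro a _ b _ h
      exact congrFun h 0
    · intro s hs
      exact ⟨s 0, Finset.mem_univ _, (Finset.mem_filter.1 hs).2.symm⟩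
    · intro c _
      rfl
  rw [hsum, Matrix.smul_apply, mapOfPart_apply]
  simp only [blockWithSingletons_le_ker_iff, trueSet, Finset.mem_filter, Finset.mem_univ, true_and,
    Bool.not_eq_true]
  by_cases hε : ∀ a, ε a = true
  · simp [hε]
  · rw [if_neg hε, pow_zero, one_smul]
    obtain ⟨a0, ha0⟩ := not_forall.1 hε
    rw [Bool.not_eq_true] at ha0
    -- An uncut leg `a0` forces the middle label to be `j a0`.
    rw [Finset.sum_eq_single (j a0)]
    · congr 1
      exact propext ⟨fun h a ha b hb => (h a ha).trans (h b hb).symm, fun h a ha => h a ha a0 ha0⟩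
    · intro c _ hc
      rw [if_neg]
      exact fun h => hc (h a0 ha0).symm
    · simp

theorem scriptT_top (N : ℕ) {n : ℕ} (hn : 1 ≤ n) :
    scriptT N 0 n (single ⊤) = ∑ ε : Fin n → Bool,
      ((∏ a, tauCoeff N (ε a)) * if ∀ a, ε a = true then (N : ℂ) else 1) •
        single (blockWithSingletons (trueSet ε)) := by
  rw [scriptT_zero, tensorPow_tau, map_sum, LinearMap.sum_apply]
  refine Finset.sum_congr rfl fun ε _ => ?_
  rw [map_smul, LinearMap.smul_apply, comp_single, (tensorFam_comp_top hn ε).1,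
    (tensorFam_comp_top hn ε).2, smul_smul]
  split_ifs <;> simp

theorem sum_fun_bool_succ {R : Type*} [AddCommMonoid R] {n : ℕ} (f : (Fin (n + 1) → Bool) → R) :
    ∑ ε, f ε = (∑ ε, f (Fin.cons true ε)) + ∑ ε, f (Fin.cons false ε) := by
  rw [← (Fin.consEquiv fun _ => Bool).sum_comp, Fintype.sum_prod_type, Fintype.sum_bool]
  rfl

theorem sum_fun_bool_zero {R : Type*} [AddCommMonoid R] (f : (Fin 0 → Bool) → R) :
    ∑ ε, f ε = f Fin.elim0 := by
  rw [Fintype.sum_unique]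
  congr 1

/-- A remaining block with at most one point is itself a singleton. This merges the terms with one
uncut leg into the term with none. -/
theorem blockWithSingletons_eq_of_card {n : ℕ} {I : Finset (Fin n)} (h : Iᶜ.card ≤ 1) :
    blockWithSingletons I = blockWithSingletons Finset.univ := by
  classical
  apply mapOfPart_two_injective
  ext j i
  rw [mapOfPart_apply, mapOfPart_apply]
  congr 1
  rw [blockWithSingletons_le_ker_iff, blockWithSingletons_le_ker_iff]
  simp only [Finset.mem_univ, not_true_eq_false, IsEmpty.forall_iff, implies_true, iff_true,
    eq_iff_iff]
  intro a ha b hb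
  rw [Finset.card_le_one.1 h a (Finset.mem_compl.2 ha) b (Finset.mem_compl.2 hb)]

theorem blockWithSingletons_empty (n : ℕ) : blockWithSingletons (∅ : Finset (Fin n)) = ⊤ := by
  ext x y
  exact ⟨fun _ => trivial, fun _ => Or.inr ⟨by simp, by simp⟩⟩

theorem scriptT_pairPart {N : ℕ} (hN : 1 ≤ N) :
    scriptT N 0 2 (single pairPart) = single pairPart := by
  have hN' : (N : ℂ) ≠ 0 := by exact_mod_cast (by omega : N ≠ 0)
  rw [pairPart, scriptT_top N (by norm_num)]
  simp only [sum_fun_bool_succ, sum_fun_bool_zero]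
  have h1 : trueSet (Fin.cons true (Fin.cons true Fin.elim0) : Fin 2 → Bool) = Finset.univ := by
    decide
  have h2 : trueSet (Fin.cons false (Fin.cons false Fin.elim0) : Fin 2 → Bool) = ∅ := by decide
  rw [blockWithSingletons_eq_of_card (I := trueSet (Fin.cons true (Fin.cons false _))) (by decide),
    blockWithSingletons_eq_of_card (I := trueSet (Fin.cons false (Fin.cons true _))) (by decide),
    h1, h2, blockWithSingletons_empty]
  simp [Fin.forall_fin_succ, Fin.prod_univ_succ, tauCoeff]
  -- The partition into two singletons has coefficient `-2/N - 2/N + (4/N²) N = 0`, with the factor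
  -- `N` coming from the closed component.
  match_scalars <;> field_simp <;> norm_num

theorem scriptT_fourPart {N : ℕ} (hN : 1 ≤ N) :
    scriptT N 0 4 (single fourPart) = single fourPart
      - (2 / (N : ℂ)) • (single (blockWithSingletons {3}) + single (blockWithSingletons {2})
        + single (blockWithSingletons {1}) + single (blockWithSingletons {0}))
      + (4 / (N : ℂ) ^ 2) • (single (blockWithSingletons {2, 3})
        + single (blockWithSingletons {1, 3}) + single (blockWithSingletons {0, 3})
        + single (blockWithSingletons {1, 2}) + single (blockWithSingletons {0, 2})
        + single (blockWithSingletons {0, 1}))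
      - (16 / (N : ℂ) ^ 3) • single (blockWithSingletons {0, 1, 2, 3}) := by
  have hN' : (N : ℂ) ≠ 0 := by exact_mod_cast (by omega : N ≠ 0)
  rw [fourPart, scriptT_top N (by norm_num)]
  simp only [sum_fun_bool_succ, sum_fun_bool_zero]
  have hs : ∀ a b c d : Bool, ∀ I : Finset (Fin 4),
      trueSet (Fin.cons a (Fin.cons b (Fin.cons c (Fin.cons d Fin.elim0))) : Fin 4 → Bool) = I →
      blockWithSingletons (trueSet (Fin.cons a (Fin.cons b (Fin.cons c (Fin.cons d Fin.elim0))) :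
        Fin 4 → Bool)) = blockWithSingletons I := fun _ _ _ _ _ h => by rw [h]
  have h3 : ∀ a b c d : Bool,
      (trueSet (Fin.cons a (Fin.cons b (Fin.cons c (Fin.cons d Fin.elim0))) : Fin 4 → Bool))ᶜ.card
        ≤ 1 →
      blockWithSingletons (trueSet (Fin.cons a (Fin.cons b (Fin.cons c (Fin.cons d Fin.elim0))) :
        Fin 4 → Bool)) = blockWithSingletons {0, 1, 2, 3} := fun _ _ _ _ h => by
    rw [blockWithSingletons_eq_of_card h]
    congr 1
  -- The five sets with at least three cut legs all give the partition into four singletons.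
  rw [h3 true true true true (by decide), h3 true true true false (by decide),
    h3 true true false true (by decide), h3 true false true true (by decide),
    h3 false true true true (by decide), hs false false false false ∅ (by decide),
    hs false false false true {3} (by decide), hs false false true false {2} (by decide),
    hs false true false false {1} (by decide), hs true false false false {0} (by decide),
    hs false false true true {2, 3} (by decide), hs false true false true {1, 3} (by decide),
    hs true false false true {0, 3} (by decide), hs false true true false {1, 2} (by decide),
    hs true false true false {0, 2} (by decide), hs true true false false {0, 1} (by decide),
    blockWithSingletons_empty]
  simp only [Fin.forall_fin_succ, Fin.prod_univ_succ, tauCoeff, Fin.cons_zero, Fin.cons_succ]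
  simp
  -- The four singletons collect `4 (-8/N³)` from three cut legs and `(16/N⁴) N` from four, in total
  -- `-16/N³`.
  match_scalars <;> field_simp <;> norm_num

/-! ### Transport of generated categories along `𝒯` -/

/-- The linear category of all `p` with `𝒯 p` in `K`. -/
def LinCat.comapT {N : ℕ} (hN : 1 ≤ N) (K : LinCat N) : LinCat N where
  hom k l := (K.hom k l).comap (scriptT N k l)
  id_mem := by
    rw [Submodule.mem_comap, ← idPow_one, scriptT_idPow hN]
    exact K.idPow_mem hN 1
  pair_mem := by
    rw [Submodule.mem_comap, scriptT_pairPart hN]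
    exact K.pair_mem
  tensor_mem := fun hp hq => by
    rw [Submodule.mem_comap, scriptT_tensor]
    exact K.tensor_mem hp hq
  comp_mem := fun hq hp => by
    rw [Submodule.mem_comap, scriptT_comp hN]
    exact K.comp_mem hq hp
  involution_mem := fun hp => by
    rw [Submodule.mem_comap, scriptT_involution]
    exact K.involution_mem hp

/-- The preimage under `𝒯` of the category generated by `𝒯 p` is a linear category containing `p`;
minimality of the category generated by `p` does the rest. As `𝒯` is an involution, the reverse
inclusion is another instance of this lemma. -/
theorem scriptT_mem_generated {N : ℕ} (hN : 1 ≤ N) {k l k' l' : ℕ} {p : PLin k l} {x : PLin k' l'}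
    (hx : x ∈ (generated N (gen p)).hom k' l') :
    scriptT N k' l' x ∈ (generated N (gen (scriptT N k l p))).hom k' l' :=
  generated_le (K := (generated N (gen (scriptT N k l p))).comapT hN)
    (contains_gen_iff.2 (mem_generated_gen N (scriptT N k l p))) k' l' hx

theorem scriptT_mem_of_mem_generated {N : ℕ} (hN : 1 ≤ N) {k l k' l' : ℕ} {p : PLin k l}
    {x : PLin k' l'} (hx : x ∈ (generated N (gen (scriptT N k l p))).hom k' l') :
    scriptT N k' l' x ∈ (generated N (gen p)).hom k' l' := by
  have := scriptT_mem_generated hN hx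
  rwa [scriptT_scriptT hN] at this

theorem isMonoidalStarIso_scriptT {N : ℕ} (hN : 1 ≤ N) {k l : ℕ} (p : PLin k l) :
    IsMonoidalStarIso (scriptT N) (generated N (gen p)) (generated N (gen (scriptT N k l p))) where
  bijOn k' l' := by
    refine ⟨fun x hx => scriptT_mem_generated hN hx, fun x _ y _ h => ?_, fun x hx =>
      ⟨_, scriptT_mem_of_mem_generated hN hx, scriptT_scriptT hN x⟩⟩
    rw [← scriptT_scriptT hN x, h, scriptT_scriptT hN]
  map_id n := by rw [tensorPow_single_idPart, scriptT_idPow hN]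
  map_tensor _ _ _ _ p _ q _ := scriptT_tensor N p q
  map_comp _ _ _ q _ p _ := scriptT_comp hN q p
  map_involution _ _ p _ := scriptT_involution N p

/-! ### Even partitions -/

/-- The sign `(-1)^s` of a labelling by `0` and `1`. -/
def labelSign {n : ℕ} (j : Fin n → Fin 2) : ℂ := ∏ a, (-1) ^ (j a : ℕ)

/-- All blocks have even size, stated through the map `T_p` for two labels. -/
def IsEven {k l : ℕ} (p : Part k l) : Prop :=
  ∀ j i, labelSign j * mapOfPart 2 p j i = mapOfPart 2 p j i * labelSign i

theorem span_single_induction {k l : ℕ} {S : Set (Part k l)} {V : Type*} [AddCommGroup V]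
    [Module ℂ V] (f : PLin k l →ₗ[ℂ] V) (W : Submodule ℂ V) (h : ∀ p ∈ S, f (single p) ∈ W) :
    ∀ x ∈ Submodule.span ℂ (single '' S), f x ∈ W := by
  intro x hx
  have : Submodule.span ℂ (single '' S) ≤ W.comap f := by
    rw [Submodule.span_le]
    rintro _ ⟨p, hp, rfl⟩
    exact h p hp
  exact this hx

/-- The linear category spanned by the even partitions. -/
def evenCat (N : ℕ) : LinCat N where
  hom k l := Submodule.span ℂ (single '' {p : Part k l | IsEven p})
  id_mem := Submodule.subset_span ⟨_, fun j i => by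
    rw [mapOfPart_idPart]
    split_ifs with h
    · rw [h, mul_comm]
    · simp, rfl⟩
  pair_mem := Submodule.subset_span ⟨_, fun j i => by
    rw [← mapT_single, mapT_pairPart]
    split_ifs with h
    · simp [labelSign, h, ← mul_pow]
    · simp, rfl⟩
  tensor_mem := by
    intro k l k' l' p q hp hq
    refine span_single_induction (tensor.flip q) _ (fun p hp => ?_) p hp
    refine span_single_induction (tensor (single p)) _ (fun q hq => ?_) q hq
    rw [tensor_single]
    refine Submodule.subset_span ⟨_, fun j i => ?_, rfl⟩
    have h1 : ∀ {m n : ℕ} (s : Fin (m + n) → Fin 2), labelSign s =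
        labelSign (s ∘ Fin.castAdd n) * labelSign (s ∘ Fin.natAdd m) := fun s =>
      Fin.prod_univ_add _
    rw [mapOfPart_tensorPart, h1, h1 i, mul_mul_mul_comm, hp, hq, mul_mul_mul_comm]
  comp_mem := by
    intro k l m q p hq hp
    refine span_single_induction ((comp N).flip p) _ (fun q hq => ?_) q hq
    refine span_single_induction (comp N (single q)) _ (fun p hp => ?_) p hp
    rw [comp_single]
    refine Submodule.smul_mem _ _ (Submodule.subset_span ⟨_, fun j i => ?_, rfl⟩)
    have h1 := congrFun (congrFun (mapOfPart_mul 2 q p) j) i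
    rw [Matrix.smul_apply, smul_eq_mul] at h1
    -- Evenness is tested with two labels whatever `N` is, so the factor to cancel is a power of 2.
    refine mul_left_cancel₀ (pow_ne_zero (loops q p) (by norm_num : ((2 : ℕ) : ℂ) ≠ 0)) ?_
    rw [mul_left_comm, ← mul_assoc _ _ (labelSign i), ← h1, Matrix.mul_apply, Finset.mul_sum, Finset.sum_mul]
    refine Finset.sum_congr rfl fun s _ => ?_
    rw [← mul_assoc, hq, mul_assoc, hp, mul_assoc]
  involution_mem := by
    intro k l p hp
    induction hp using Submodule.span_induction with
    | mem x hx =>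
      obtain ⟨p, hp, rfl⟩ := hx
      rw [involution_single]
      refine Submodule.subset_span ⟨_, fun j i => ?_, rfl⟩
      rw [mapOfPart_starPart, mul_comm, ← hp, mul_comm]
    | zero => simp [involution]
    | add x y _ _ hx hy => rw [involution_add]; exact add_mem hx hy
    | smul c x _ hx => rw [involution_smul]; exact Submodule.smul_mem _ _ hx

/-! ### Coefficients of `𝒯 b_4` and failure of easiness -/

theorem apply_eq_zero_of_mem_span {k l : ℕ} {S : Set (Part k l)} {x : PLin k l}
    (hx : x ∈ Submodule.span ℂ (single '' S)) {p : Part k l} (hp : p ∉ S) : x p = 0 := by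
  refine (Submodule.mem_bot ℂ).1 (span_single_induction (Finsupp.lapply p) ⊥ (fun q hq => ?_) x hx)
  have : q ≠ p := fun h => hp (h ▸ hq)
  simp [single, this]

/-- The points `a` and `b` are joined for `I` but not for `J`. Exhibiting such a pair keeps the
coefficient computations decidable. -/
theorem blockWithSingletons_ne {n : ℕ} {I J : Finset (Fin n)} (a b : Fin n) (hab : a ≠ b)
    (ha : a ∉ I) (hb : b ∉ I) (h : a ∈ J ∨ b ∈ J) :
    blockWithSingletons J ≠ blockWithSingletons I := by
  intro e
  have h1 : blockWithSingletons I (Sum.inr a) (Sum.inr b) := by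
    refine Or.inr ⟨?_, ?_⟩
    · rintro c hc ⟨⟩; exact ha hc
    · rintro c hc ⟨⟩; exact hb hc
  rw [← e] at h1
  rcases h1 with h1 | ⟨h1, h2⟩
  · exact hab (Sum.inr_injective h1)
  · rcases h with h | h
    · exact h1 a h rfl
    · exact h2 b h rfl

theorem scriptT_fourPart_apply_fourPart {N : ℕ} (hN : 1 ≤ N) :
    scriptT N 0 4 (single fourPart) fourPart = 1 := by
  have h : ∀ (I : Finset (Fin 4)) (a b : Fin 4), a ≠ b → a ∈ I ∨ b ∈ I →
      single (blockWithSingletons I) fourPart = 0 := by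
    intro I a b hab hI
    classical
    rw [single, Finsupp.single_apply, if_neg]
    rw [fourPart, ← blockWithSingletons_empty 4]
    exact blockWithSingletons_ne a b hab (by simp) (by simp) hI
  rw [scriptT_fourPart hN]
  simp only [Finsupp.add_apply, Finsupp.sub_apply, Finsupp.smul_apply]
  rw [h {3} 3 0 (by decide) (by decide), h {2} 2 0 (by decide) (by decide),
    h {1} 1 0 (by decide) (by decide), h {0} 0 1 (by decide) (by decide),
    h {2, 3} 2 0 (by decide) (by decide), h {1, 3} 1 0 (by decide) (by decide),
    h {0, 3} 0 1 (by decide) (by decide), h {1, 2} 1 0 (by decide) (by decide),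
    h {0, 2} 0 1 (by decide) (by decide), h {0, 1} 0 1 (by decide) (by decide),
    h {0, 1, 2, 3} 0 1 (by decide) (by decide)]
  simp [single]

theorem scriptT_fourPart_apply_singleton {N : ℕ} (hN : 1 ≤ N) :
    scriptT N 0 4 (single fourPart) (blockWithSingletons {0}) = -(2 / (N : ℂ)) := by
  have h : ∀ (I : Finset (Fin 4)) (a b : Fin 4), a ≠ b → a ∉ ({0} : Finset (Fin 4)) →
      b ∉ ({0} : Finset (Fin 4)) → a ∈ I ∨ b ∈ I →
      single (blockWithSingletons I) (blockWithSingletons {0}) = 0 := by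
    intro I a b hab ha hb hI
    classical
    rw [single, Finsupp.single_apply, if_neg]
    exact blockWithSingletons_ne a b hab ha hb hI
  have h0 : single fourPart (blockWithSingletons {0}) = 0 := by
    classical
    rw [single, Finsupp.single_apply, if_neg]
    rw [fourPart, ← blockWithSingletons_empty 4]
    exact (blockWithSingletons_ne 0 1 (by decide) (by simp) (by simp) (by simp)).symm
  rw [scriptT_fourPart hN]
  simp only [Finsupp.add_apply, Finsupp.sub_apply, Finsupp.smul_apply]
  rw [h0, h {3} 3 1 (by decide) (by decide) (by decide) (by decide),
    h {2} 2 1 (by decide) (by decide) (by decide) (by decide),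
    h {1} 1 2 (by decide) (by decide) (by decide) (by decide),
    h {2, 3} 2 1 (by decide) (by decide) (by decide) (by decide),
    h {1, 3} 1 2 (by decide) (by decide) (by decide) (by decide),
    h {0, 3} 3 1 (by decide) (by decide) (by decide) (by decide),
    h {1, 2} 1 2 (by decide) (by decide) (by decide) (by decide),
    h {0, 2} 2 1 (by decide) (by decide) (by decide) (by decide),
    h {0, 1} 1 2 (by decide) (by decide) (by decide) (by decide),
    h {0, 1, 2, 3} 1 2 (by decide) (by decide) (by decide) (by decide)]
  simp [single]

theorem isEven_fourPart : IsEven fourPart := by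
  classical
  intro j i
  rw [mapOfPart_apply]
  split_ifs with h
  · have hj : ∀ a, j a = j 0 := fun a => @h (Sum.inr a) (Sum.inr 0) trivial
    simp only [labelSign, hj]
    rcases Nat.even_or_odd (j 0 : ℕ) with h | h <;> norm_num [h.neg_one_pow]
  · simp

theorem not_isEven_blockWithSingletons : ¬ IsEven (blockWithSingletons ({0} : Finset (Fin 4))) := by
  classical
  intro h
  have h1 := h ![1, 0, 0, 0] Fin.elim0
  rw [mapOfPart_apply, if_pos] at h1
  · simp [labelSign, Fin.prod_univ_succ] at h1
    norm_num at h1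
  · rw [blockWithSingletons_le_ker_iff]
    decide

/-- All elements of `⟨b_4⟩` are supported on even partitions, but the partition with a singleton and
a block of three points has the nonzero coefficient `-2/N` in `𝒯 b_4`. -/
theorem scriptT_fourPart_notMem {N : ℕ} (hN : 1 ≤ N) :
    scriptT N 0 4 (single fourPart) ∉ (generated N (gen (single fourPart))).hom 0 4 := by
  intro h
  have hN' : (N : ℂ) ≠ 0 := by exact_mod_cast (by omega : N ≠ 0)
  have h1 := generated_le (K := evenCat N)
    (contains_gen_iff.2 (Submodule.subset_span ⟨_, isEven_fourPart, rfl⟩)) 0 4 h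
  have h2 := apply_eq_zero_of_mem_span h1 not_isEven_blockWithSingletons
  rw [scriptT_fourPart_apply_singleton hN] at h2
  simp [hN'] at h2

/-- An easy category contains each partition that occurs in one of its elements. So `b_4` would lie
in `⟨𝒯 b_4⟩`, and applying `𝒯` contradicts `scriptT_fourPart_notMem`. -/
theorem not_isEasy_generated_scriptT_fourPart {N : ℕ} (hN : 1 ≤ N) :
    ¬ (generated N (gen (scriptT N 0 4 (single fourPart)))).IsEasy := by
  rintro ⟨C, hC⟩
  have h1 := mem_generated_gen N (scriptT N 0 4 (single fourPart))
  have h2 : fourPart ∈ C 0 4 := by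
    by_contra h
    rw [hC] at h1
    have := apply_eq_zero_of_mem_span h1 h
    rw [scriptT_fourPart_apply_fourPart hN] at this
    exact one_ne_zero this
  have h3 : single fourPart ∈ (generated N (gen (scriptT N 0 4 (single fourPart)))).hom 0 4 := by
    rw [hC]
    exact Submodule.subset_span ⟨_, h2, rfl⟩
  exact scriptT_fourPart_notMem hN (scriptT_mem_of_mem_generated hN h3)

/-! ### Tensor powers of matrices and intertwiner spaces -/

section Algebra

variable {N : ℕ} {A : Type} [Ring A]

theorem tensorMatrix_add (u : Matrix (Fin N) (Fin N) A) (k k' : ℕ)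
    (s t : Fin (k + k') → Fin N) :
    tensorMatrix u (k + k') s t =
      tensorMatrix u k (s ∘ Fin.castAdd k') (t ∘ Fin.castAdd k') *
        tensorMatrix u k' (s ∘ Fin.natAdd k) (t ∘ Fin.natAdd k) := by
  simp only [tensorMatrix, Matrix.of_apply]
  rw [List.ofFn_add, List.prod_append]
  rfl

theorem tensorMatrix_zero (u : Matrix (Fin N) (Fin N) A) : tensorMatrix u 0 = 1 := by
  ext s t
  rw [Subsingleton.elim s t, Matrix.one_apply_eq]
  simp [tensorMatrix]

theorem tensorMatrix_cons (u : Matrix (Fin N) (Fin N) A) (k : ℕ) (a b : Fin N)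
    (s t : Fin k → Fin N) :
    tensorMatrix u (k + 1) (Fin.cons a s) (Fin.cons b t) = u a b * tensorMatrix u k s t := by
  simp [tensorMatrix, List.ofFn_succ]

theorem sum_fun_succ {R : Type*} [AddCommMonoid R] {k : ℕ} (f : (Fin (k + 1) → Fin N) → R) :
    ∑ s, f s = ∑ a, ∑ s, f (Fin.cons a s) := by
  rw [← (Fin.consEquiv fun _ => Fin N).sum_comp, Fintype.sum_prod_type]
  rfl

theorem forall_fun_succ {k : ℕ} {P : (Fin (k + 1) → Fin N) → Prop}
    (h : ∀ a s, P (Fin.cons a s)) (s : Fin (k + 1) → Fin N) : P s := by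
  rw [← Fin.cons_self_tail s]
  exact h _ _

theorem cons_eq_cons_iff {k : ℕ} (a b : Fin N) (s t : Fin k → Fin N) :
    (Fin.cons a s : Fin (k + 1) → Fin N) = Fin.cons b t ↔ a = b ∧ s = t := Fin.cons_inj

theorem tensorMatrix_one (k : ℕ) : tensorMatrix (1 : Matrix (Fin N) (Fin N) A) k = 1 := by
  induction k with
  | zero => exact tensorMatrix_zero _
  | succ k ih =>
    ext s t
    induction s using forall_fun_succ with
    | h a s =>
    induction t using forall_fun_succ with
    | h b t =>
    rw [tensorMatrix_cons, ih]
    simp only [Matrix.one_apply, cons_eq_cons_iff]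
    split_ifs <;> simp_all

theorem tensorMatrix_commute {x : A} {u : Matrix (Fin N) (Fin N) A}
    (h : ∀ i j, Commute x (u i j)) (k : ℕ) (s t : Fin k → Fin N) :
    Commute x (tensorMatrix u k s t) := by
  refine Commute.list_prod_right _ _ fun y hy => ?_
  obtain ⟨a, rfl⟩ := List.mem_ofFn.1 hy
  exact h _ _

/-- Over a noncommutative algebra the tensor power is multiplicative only when the entries of `b`
can be moved past those of `a`. The uses are scalar matrices and the two legs of a tensor product.
-/
theorem tensorMatrix_mul {a b : Matrix (Fin N) (Fin N) A}
    (h : ∀ i j i' j', Commute (a i j) (b i' j')) (k : ℕ) :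
    tensorMatrix (a * b) k = tensorMatrix a k * tensorMatrix b k := by
  induction k with
  | zero => rw [tensorMatrix_zero, tensorMatrix_zero, tensorMatrix_zero, Matrix.one_mul]
  | succ k ih =>
    ext s t
    induction s using forall_fun_succ with
    | h i s =>
    induction t using forall_fun_succ with
    | h j t =>
    rw [tensorMatrix_cons, ih, Matrix.mul_apply, Matrix.mul_apply, Matrix.mul_apply, sum_fun_succ,
      Finset.sum_mul_sum]
    refine Finset.sum_congr rfl fun c _ => Finset.sum_congr rfl fun r _ => ?_
    rw [tensorMatrix_cons, tensorMatrix_cons]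
    have := tensorMatrix_commute (x := b c j) (u := a) (fun i' j' => (h i' j' c j).symm) k s r
    rw [mul_assoc, mul_assoc, ← mul_assoc (b c j), this.eq, mul_assoc]

variable [Algebra ℂ A]

theorem scalarMatrix_mul {l m n : Type} [Fintype m] (S : Matrix l m ℂ) (T : Matrix m n ℂ) :
    scalarMatrix A (S * T) = scalarMatrix A S * scalarMatrix A T :=
  Matrix.map_mul

theorem scalarMatrix_one {m : Type} [DecidableEq m] :
    scalarMatrix A (1 : Matrix m m ℂ) = 1 := by
  simp [scalarMatrix]

theorem scalarMatrix_apply {m n : Type} (T : Matrix m n ℂ) (i : m) (j : n) :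
    scalarMatrix A T i j = algebraMap ℂ A (T i j) := rfl

theorem tensorMatrix_map {B : Type} [Ring B] [Algebra ℂ B] (φ : A →ₐ[ℂ] B)
    (u : Matrix (Fin N) (Fin N) A) (k : ℕ) :
    tensorMatrix (u.map φ) k = (tensorMatrix u k).map φ := by
  ext s t
  simp only [tensorMatrix, Matrix.of_apply, Matrix.map_apply, map_list_prod, List.map_ofFn]
  rfl

theorem scalarMatrix_map {B : Type} [Ring B] [Algebra ℂ B] (φ : A →ₐ[ℂ] B) {m n : Type}
    (T : Matrix m n ℂ) : (scalarMatrix A T).map φ = scalarMatrix B T := by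
  ext s t
  simp [scalarMatrix]

theorem tensorMatrix_scalarMatrix (T : Matrix (Fin N) (Fin N) ℂ) (k : ℕ) :
    tensorMatrix (scalarMatrix A T) k = scalarMatrix A (tensorMatrix T k) :=
  tensorMatrix_map (Algebra.ofId ℂ A) T k

theorem mem_Mor {u : Matrix (Fin N) (Fin N) A} {k l : ℕ}
    {T : Matrix (Fin l → Fin N) (Fin k → Fin N) ℂ} :
    T ∈ Mor u k l ↔
      scalarMatrix A T * tensorMatrix u k = tensorMatrix u l * scalarMatrix A T := Iff.rfl

theorem mem_Mor_map {B : Type} [Ring B] [Algebra ℂ B] (φ : A →ₐ[ℂ] B)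
    {u : Matrix (Fin N) (Fin N) A} {k l : ℕ} {T : Matrix (Fin l → Fin N) (Fin k → Fin N) ℂ}
    (h : T ∈ Mor u k l) : T ∈ Mor (u.map φ) k l := by
  rw [mem_Mor, tensorMatrix_map, tensorMatrix_map, ← scalarMatrix_map φ, ← Matrix.map_mul,
    ← Matrix.map_mul, mem_Mor.1 h]

theorem mem_Mor_mul {a b : Matrix (Fin N) (Fin N) A}
    (h : ∀ i j i' j', Commute (a i j) (b i' j')) {k l : ℕ}
    {T : Matrix (Fin l → Fin N) (Fin k → Fin N) ℂ} (ha : T ∈ Mor a k l) (hb : T ∈ Mor b k l) :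
    T ∈ Mor (a * b) k l := by
  rw [mem_Mor, tensorMatrix_mul h, tensorMatrix_mul h, ← Matrix.mul_assoc, mem_Mor.1 ha,
    Matrix.mul_assoc, mem_Mor.1 hb, Matrix.mul_assoc]

theorem mul_mem_Mor {u : Matrix (Fin N) (Fin N) A} {k l m : ℕ}
    {T : Matrix (Fin l → Fin N) (Fin k → Fin N) ℂ} {S : Matrix (Fin m → Fin N) (Fin l → Fin N) ℂ}
    (hS : S ∈ Mor u l m) (hT : T ∈ Mor u k l) : S * T ∈ Mor u k m := by
  rw [mem_Mor, scalarMatrix_mul, Matrix.mul_assoc, mem_Mor.1 hT, ← Matrix.mul_assoc, mem_Mor.1 hS,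
    Matrix.mul_assoc]

theorem tensor_mem_Mor {u : Matrix (Fin N) (Fin N) A} {k l k' l' : ℕ} {p : PLin k l}
    {q : PLin k' l'} (hp : mapT N p ∈ Mor u k l) (hq : mapT N q ∈ Mor u k' l') :
    mapT N (tensor p q) ∈ Mor u (k + k') (l + l') := by
  rw [mem_Mor] at *
  ext s t
  have h1 := congrFun (congrFun hp (s ∘ Fin.castAdd l')) (t ∘ Fin.castAdd k')
  have h2 := congrFun (congrFun hq (s ∘ Fin.natAdd l)) (t ∘ Fin.natAdd k)
  rw [Matrix.mul_apply, Matrix.mul_apply] at h1 h2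
  rw [Matrix.mul_apply, Matrix.mul_apply, sum_prod_append, sum_prod_append]
  simp only [scalarMatrix_apply, mapT_tensor, tensorMatrix_add, append_comp_castAdd,
    append_comp_natAdd, map_mul] at h1 h2 ⊢
  calc _ = (∑ x, algebraMap ℂ A (mapT N p (s ∘ Fin.castAdd l') x) *
          tensorMatrix u k x (t ∘ Fin.castAdd k')) *
        (∑ x, algebraMap ℂ A (mapT N q (s ∘ Fin.natAdd l) x) *
          tensorMatrix u k' x (t ∘ Fin.natAdd k)) := by
        rw [Finset.sum_mul_sum]
        refine Finset.sum_congr rfl fun a _ => Finset.sum_congr rfl fun b _ => ?_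
        rw [mul_assoc, mul_assoc, ← mul_assoc (algebraMap ℂ A (mapT N q _ _)),
          (Algebra.commutes _ (tensorMatrix u k a (t ∘ Fin.castAdd k'))), mul_assoc]
    _ = _ := by
        rw [h1, h2, Finset.sum_mul_sum]
        refine Finset.sum_congr rfl fun a _ => Finset.sum_congr rfl fun b _ => ?_
        rw [mul_assoc, mul_assoc, ← mul_assoc (algebraMap ℂ A (mapT N p _ _)),
          (Algebra.commutes _ (tensorMatrix u l' _ b)), mul_assoc]

end Algebra

section Star

variable {N : ℕ} {A : Type} [Ring A] [StarRing A]

/-- The involution reverses words, so the sum over the last factors is innermost and collapses by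
induction; the first factor then closes up by the hypothesis. -/
theorem tensorMatrix_mul_conjTranspose {u : Matrix (Fin N) (Fin N) A}
    (hu : u * u.conjTranspose = 1) (k : ℕ) :
    tensorMatrix u k * (tensorMatrix u k).conjTranspose = 1 := by
  induction k with
  | zero => simp [tensorMatrix_zero]
  | succ k ih =>
    ext s s'
    induction s using forall_fun_succ with
    | h a s =>
    induction s' using forall_fun_succ with
    | h a' s' =>
    have h1 := congrFun (congrFun ih s) s'
    have h2 := congrFun (congrFun hu a) a'
    rw [Matrix.mul_apply] at h1 h2
    rw [Matrix.mul_apply, sum_fun_succ]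
    simp only [Matrix.conjTranspose_apply, tensorMatrix_cons, star_mul] at h1 h2 ⊢
    have h3 : ∀ c : Fin N, ∑ x, u a c * tensorMatrix u k s x *
        (star (tensorMatrix u k s' x) * star (u a' c)) =
        u a c * (1 : Matrix (Fin k → Fin N) (Fin k → Fin N) A) s s' * star (u a' c) := by
      intro c
      rw [← h1, Finset.mul_sum, Finset.sum_mul]
      exact Finset.sum_congr rfl fun x _ => by simp only [mul_assoc]
    simp only [h3, Matrix.one_apply, cons_eq_cons_iff] at h2 ⊢
    by_cases hs : s = s'
    · simp only [hs, if_true, mul_one, and_true, h2]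
    · simp [hs]

/-- Here the first factor is innermost, so its sum is evaluated before the induction hypothesis is
used. -/
theorem conjTranspose_tensorMatrix_mul {u : Matrix (Fin N) (Fin N) A}
    (hu : u.conjTranspose * u = 1) (k : ℕ) :
    (tensorMatrix u k).conjTranspose * tensorMatrix u k = 1 := by
  induction k with
  | zero => simp [tensorMatrix_zero]
  | succ k ih =>
    ext s s'
    induction s using forall_fun_succ with
    | h a s =>
    induction s' using forall_fun_succ with
    | h a' s' =>
    have h1 := congrFun (congrFun ih s) s'
    have h2 := congrFun (congrFun hu a) a'
    rw [Matrix.mul_apply] at h1 h2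
    rw [Matrix.mul_apply, sum_fun_succ, Finset.sum_comm]
    simp only [Matrix.conjTranspose_apply, tensorMatrix_cons, star_mul] at h1 h2 ⊢
    have h3 : ∀ x : Fin k → Fin N, ∑ c, star (tensorMatrix u k x s) * star (u c a) *
        (u c a' * tensorMatrix u k x s') =
        star (tensorMatrix u k x s) * (1 : Matrix (Fin N) (Fin N) A) a a' *
          tensorMatrix u k x s' := by
      intro c
      rw [← h2, Finset.mul_sum, Finset.sum_mul]
      exact Finset.sum_congr rfl fun x _ => by simp only [mul_assoc]
    simp only [h3, Matrix.one_apply, cons_eq_cons_iff] at h1 ⊢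
    by_cases hs : a = a'
    · simp only [hs, if_true, mul_one, true_and, h1]
    · simp [hs]

variable [Algebra ℂ A]

theorem Relations.conjTranspose_eq {S : Gens} {u : Matrix (Fin N) (Fin N) A}
    (h : Relations S u) : u.conjTranspose = u.transpose := by
  ext i j
  exact h.selfAdjoint j i

theorem relations_map {B : Type} [Ring B] [Algebra ℂ B] [StarRing B] (φ : A →⋆ₐ[ℂ] B) {S : Gens}
    {u : Matrix (Fin N) (Fin N) A} (h : Relations S u) : Relations S (u.map φ) where
  selfAdjoint i j := by rw [Matrix.map_apply, ← map_star, h.selfAdjoint]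
  mul_transpose := by
    rw [← Matrix.transpose_map, ← Matrix.map_mul, h.mul_transpose]
    exact Matrix.map_one _ (map_zero φ) (map_one φ)
  transpose_mul := by
    rw [← Matrix.transpose_map, ← Matrix.map_mul, h.transpose_mul]
    exact Matrix.map_one _ (map_zero φ) (map_one φ)
  intertwines x hx := mem_Mor_map (φ : A →ₐ[ℂ] B) (h.intertwines x hx)

variable [StarModule ℂ A]

theorem scalarMatrix_conjTranspose {m n : Type} (T : Matrix m n ℂ) :
    (scalarMatrix A T).conjTranspose = scalarMatrix A T.conjTranspose := by
  ext i j
  rw [Matrix.conjTranspose_apply, scalarMatrix_apply, scalarMatrix_apply, Matrix.conjTranspose_apply,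
    algebraMap_star_comm]

/-- Unitarity turns `T U = V T` into `V* T = T U*`; the adjoint of this identity is the claim. -/
theorem conjTranspose_mem_Mor {u : Matrix (Fin N) (Fin N) A} (h1 : u * u.conjTranspose = 1)
    (h2 : u.conjTranspose * u = 1) {k l : ℕ} {T : Matrix (Fin l → Fin N) (Fin k → Fin N) ℂ}
    (hT : T ∈ Mor u k l) : T.conjTranspose ∈ Mor u l k := by
  rw [mem_Mor] at *
  have h3 : (tensorMatrix u l).conjTranspose * scalarMatrix A T =
      scalarMatrix A T * (tensorMatrix u k).conjTranspose := by
    calc _ = (tensorMatrix u l).conjTranspose * (scalarMatrix A T * tensorMatrix u k) *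
          (tensorMatrix u k).conjTranspose := by
          rw [Matrix.mul_assoc, Matrix.mul_assoc, tensorMatrix_mul_conjTranspose h1,
            Matrix.mul_one]
      _ = _ := by
          rw [hT, ← Matrix.mul_assoc, conjTranspose_tensorMatrix_mul h2, Matrix.one_mul]
  have h4 := congrArg Matrix.conjTranspose h3
  rwa [Matrix.conjTranspose_mul, Matrix.conjTranspose_mul, Matrix.conjTranspose_conjTranspose,
    Matrix.conjTranspose_conjTranspose, scalarMatrix_conjTranspose] at h4

/-- The linear category of all linear combinations of partitions whose maps intertwine the tensor
powers of an orthogonal matrix. -/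
def morCat {S : Gens} {u : Matrix (Fin N) (Fin N) A} (h : Relations S u) : LinCat N where
  hom k l :=
    { carrier := {p | mapT N p ∈ Mor u k l}
      add_mem' := fun {p q} hp hq => by
        rw [Set.mem_ofPred_eq, mem_Mor] at *
        have : scalarMatrix A (mapT N (p + q)) =
            scalarMatrix A (mapT N p) + scalarMatrix A (mapT N q) := by
          ext; simp [scalarMatrix_apply]
        rw [this, Matrix.add_mul, Matrix.mul_add, hp, hq]
      zero_mem' := by
        have : scalarMatrix A (mapT N (0 : PLin k l)) = 0 := by
          ext; simp [scalarMatrix_apply]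
        rw [Set.mem_ofPred_eq, mem_Mor, this, Matrix.zero_mul, Matrix.mul_zero]
      smul_mem' := fun c p hp => by
        rw [Set.mem_ofPred_eq, mem_Mor] at *
        have : scalarMatrix A (mapT N (c • p)) = c • scalarMatrix A (mapT N p) := by
          ext; simp [scalarMatrix_apply, Algebra.smul_def]
        rw [this, Matrix.smul_mul, Matrix.mul_smul, hp] }
  id_mem := by
    change _ = _
    rw [← idPow_one, mapT_idPow, scalarMatrix_one, Matrix.one_mul, Matrix.mul_one]
  pair_mem := by
    change _ = _
    ext s t
    rw [tensorMatrix_zero, Matrix.mul_one, Matrix.mul_apply, sum_fun_succ]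
    simp only [sum_fun_succ, scalarMatrix_apply, mapT_pairPart]
    have h1 : ∀ (a b : Fin N) (x : Fin 0 → Fin N), tensorMatrix u 2 s (Fin.cons a (Fin.cons b x)) =
        u (s 0) a * u (s 1) b := by
      intro a b x
      simp [tensorMatrix, List.ofFn_succ]
    simp only [h1]
    have h2 := congrFun (congrFun h.mul_transpose (s 0)) (s 1)
    rw [Matrix.mul_apply, Matrix.one_apply] at h2
    simp only [Matrix.transpose_apply] at h2
    simp [← h2, apply_ite (algebraMap ℂ A)]
  tensor_mem := fun hp hq => tensor_mem_Mor hp hq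
  comp_mem := fun {k l m q p} hq hp => by
    change mapT N (comp N q p) ∈ Mor u k m
    rw [mapT_comp]
    exact mul_mem_Mor hq hp
  involution_mem := fun {k l p} hp => by
    change mapT N (involution p) ∈ Mor u l k
    rw [mapT_involution]
    have := h.conjTranspose_eq
    exact conjTranspose_mem_Mor (this ▸ h.mul_transpose) (this ▸ h.transpose_mul) hp

theorem mapT_mem_Mor_of_mem_generated {S : Gens} {u : Matrix (Fin N) (Fin N) A}
    (h : Relations S u) {k l : ℕ} {p : PLin k l} (hp : p ∈ (generated N S).hom k l) :
    mapT N p ∈ Mor u k l :=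
  generated_le (K := morCat h) h.intertwines k l hp

end Star

/-! ### Countably generated reducing subspaces -/

/-- The closed span of a sequence in a Hilbert space is the range of an isometry that is defined on
`ℓ²(κ)` for some `κ ⊆ ℕ`. -/
theorem exists_isometry_of_sequence {K : Type} [NormedAddCommGroup K] [InnerProductSpace ℂ K]
    [CompleteSpace K] (f : ℕ → K) :
    ∃ (κ : Set ℕ) (j : SepHilbert κ →ₗᵢ[ℂ] K),
      LinearMap.range j.toLinearMap = (Submodule.span ℂ (Set.range f)).topologicalClosure := by
  have ho := InnerProductSpace.gramSchmidtNormed_orthonormal' (𝕜 := ℂ) f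
  -- Gram–Schmidt returns zero at vectors depending on earlier ones. Discarding these indices leaves
  -- an orthonormal family, which may be finite.
  set κ : Set ℕ := {n | InnerProductSpace.gramSchmidtNormed ℂ f n ≠ 0} with hκ
  have hV := ho.orthogonalFamily
  refine ⟨κ, hV.linearIsometry, ?_⟩
  rw [hV.range_linearIsometry, ← InnerProductSpace.span_gramSchmidt ℂ f,
    ← InnerProductSpace.span_gramSchmidtNormed_range f]
  congr 1
  refine le_antisymm ?_ ?_
  · refine iSup_le fun i => ?_
    rintro _ ⟨c, rfl⟩
    exact Submodule.smul_mem _ c (Submodule.subset_span ⟨i, rfl⟩)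
  · rw [Submodule.span_le]
    rintro _ ⟨n, rfl⟩
    by_cases hn : InnerProductSpace.gramSchmidtNormed ℂ f n = 0
    · rw [hn]; exact zero_mem _
    · refine Submodule.mem_iSup_of_mem (⟨n, hn⟩ : κ) ⟨1, ?_⟩
      simp

section Compression

variable {N : ℕ} {S : Gens} {H K : Type} [NormedAddCommGroup H] [InnerProductSpace ℂ H]
  [CompleteSpace H] [NormedAddCommGroup K] [InnerProductSpace ℂ K] [CompleteSpace K]

/-- The compression of a matrix of operators along an isometry. -/
def compression (j : H →ₗᵢ[ℂ] K) (w : Matrix (Fin N) (Fin N) (Op K)) :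
    Matrix (Fin N) (Fin N) (Op H) :=
  w.map fun a => (j.toContinuousLinearMap.adjoint.comp a).comp j.toContinuousLinearMap

/-- On an invariant subspace the compression is the restriction. This is what makes it compatible
with products, and hence with the relations. -/
theorem compression_apply {j : H →ₗᵢ[ℂ] K} {w : Matrix (Fin N) (Fin N) (Op K)}
    (h : ∀ a b x, w a b (j x) ∈ LinearMap.range j.toLinearMap) (a b : Fin N) (x : H) :
    j (compression j w a b x) = w a b (j x) := by
  obtain ⟨y, hy⟩ := h a b x
  have hy' : j y = w a b (j x) := hy
  have h1 : compression j w a b x = y := by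
    change j.toContinuousLinearMap.adjoint (w a b (j x)) = y
    rw [← hy']
    refine ext_inner_left ℂ fun z => ?_
    rw [ContinuousLinearMap.adjoint_inner_right]
    exact j.inner_map_map z y
  rw [h1, hy']

theorem tensorMatrix_compression_apply {j : H →ₗᵢ[ℂ] K} {w : Matrix (Fin N) (Fin N) (Op K)}
    (h : ∀ a b x, w a b (j x) ∈ LinearMap.range j.toLinearMap) (k : ℕ) (s t : Fin k → Fin N)
    (x : H) :
    j (tensorMatrix (compression j w) k s t x) = tensorMatrix w k s t (j x) := by
  induction k generalizing x with
  | zero =>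
    rw [tensorMatrix_zero, tensorMatrix_zero, Subsingleton.elim s t, Matrix.one_apply_eq,
      Matrix.one_apply_eq]
    rfl
  | succ k ih =>
    induction s using forall_fun_succ with
    | h a s =>
    induction t using forall_fun_succ with
    | h b t =>
    rw [tensorMatrix_cons, tensorMatrix_cons]
    exact (compression_apply h a b _).trans (congrArg (w a b) (ih s t x))

theorem relations_compression {j : H →ₗᵢ[ℂ] K} {w : Matrix (Fin N) (Fin N) (Op K)}
    (h : ∀ a b x, w a b (j x) ∈ LinearMap.range j.toLinearMap) (hw : Relations S w) :
    Relations S (compression j w) where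
  selfAdjoint a b := by
    refine ContinuousLinearMap.ext fun x => ext_inner_left ℂ fun y => ?_
    rw [ContinuousLinearMap.star_eq_adjoint, ContinuousLinearMap.adjoint_inner_right,
      ← j.inner_map_map, ← j.inner_map_map, compression_apply h, compression_apply h]
    have := hw.selfAdjoint a b
    rw [ContinuousLinearMap.star_eq_adjoint] at this
    rw [← ContinuousLinearMap.adjoint_inner_right, this]
  mul_transpose := by
    ext a b x
    apply j.injective
    have h1 := congrArg (fun A => A (j x)) (congrFun (congrFun hw.mul_transpose a) b)
    simp only [Matrix.mul_apply, Matrix.transpose_apply, Matrix.one_apply, _root_.sum_apply,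
      mul_apply_eq_comp, map_sum, compression_apply h] at h1 ⊢
    rw [h1]
    split_ifs <;> simp
  transpose_mul := by
    ext a b x
    apply j.injective
    have h1 := congrArg (fun A => A (j x)) (congrFun (congrFun hw.transpose_mul a) b)
    simp only [Matrix.mul_apply, Matrix.transpose_apply, Matrix.one_apply, _root_.sum_apply,
      mul_apply_eq_comp, map_sum, compression_apply h] at h1 ⊢
    rw [h1]
    split_ifs <;> simp
  intertwines p hp := by
    rw [mem_Mor]
    ext a b x
    apply j.injective
    have h1 := congrArg (fun A => A (j x))
      (congrFun (congrFun (mem_Mor.1 (hw.intertwines p hp)) a) b)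
    simp only [Matrix.mul_apply, scalarMatrix_apply, _root_.sum_apply,
      mul_apply_eq_comp, map_sum, Algebra.algebraMap_eq_smul_one,
      _root_.smul_apply, one_apply_eq_self, map_smul,
      tensorMatrix_compression_apply h] at h1 ⊢
    exact h1

end Compression

/-- The word in the entries of a matrix. -/
def wordProd {N : ℕ} {A : Type} [Ring A] (w : Matrix (Fin N) (Fin N) A)
    (l : List (Fin N × Fin N)) : A :=
  (l.map fun ij => w ij.1 ij.2).prod

/-- The vectors obtained from `x` by words in the operators are countably many, and prepending a
letter shows that their closed span is invariant. So every vector lies in a subspace carrying one of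
the representations `Rep N S`. -/
theorem exists_rep {N : ℕ} {S : Gens} {K : Type} [NormedAddCommGroup K] [InnerProductSpace ℂ K]
    [CompleteSpace K] {w : Matrix (Fin N) (Fin N) (Op K)} (hw : Relations S w) {x : K}
    (hx : x ≠ 0) :
    ∃ (r : Rep N S) (j : SepHilbert r.index →ₗᵢ[ℂ] K),
      (∃ y, j y = x) ∧ ∀ a b y, j (r.v a b y) = w a b (j y) := by
  obtain ⟨e, he⟩ := exists_surjective_nat (List (Fin N × Fin N))
  obtain ⟨κ, j, hj⟩ := exists_isometry_of_sequence fun n => wordProd w (e n) x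
  have hx' : x ∈ LinearMap.range j.toLinearMap := by
    rw [hj]
    refine Submodule.le_topologicalClosure _ (Submodule.subset_span ?_)
    obtain ⟨n, hn⟩ := he []
    exact ⟨n, by simp [hn, wordProd]⟩
  have hinv : ∀ a b y, w a b (j y) ∈ LinearMap.range j.toLinearMap := by
    intro a b y
    have h1 : Submodule.span ℂ (Set.range fun n => wordProd w (e n) x) ≤
        (Submodule.span ℂ (Set.range fun n => wordProd w (e n) x)).comap
          (w a b).toLinearMap := by
      rw [Submodule.span_le]
      rintro _ ⟨n, rfl⟩
      obtain ⟨m, hm⟩ := he ((a, b) :: e n)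
      refine Submodule.subset_span ⟨m, ?_⟩
      simp [hm, wordProd]
    have h2 : j y ∈ (Submodule.span ℂ (Set.range fun n => wordProd w (e n) x)).topologicalClosure :=
      hj ▸ ⟨y, rfl⟩
    rw [hj]
    exact map_mem_closure (w a b).continuous h2 fun z hz => h1 hz
  -- `Rep` admits only nonzero spaces; this is where `x ≠ 0` enters.
  have hκ : κ.Nonempty := by
    by_contra h
    obtain ⟨y, hy⟩ := hx'
    have : y = 0 := by
      ext n
      exact absurd ⟨n.1, n.2⟩ h
    rw [this, map_zero] at hy
    exact hx hy.symm
  exact ⟨⟨κ, hκ, compression j w, relations_compression hinv hw⟩, j, hx',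
    compression_apply hinv⟩

/-! ### The universal property -/

/-- Evaluation at one representation. -/
def evalRep {N : ℕ} {S : Gens} (r : Rep N S) : RepProduct N S →⋆ₐ[ℂ] Op (SepHilbert r.index) where
  toFun x := x r
  map_one' := rfl
  map_mul' _ _ := rfl
  map_zero' := rfl
  map_add' _ _ := rfl
  commutes' _ := rfl
  map_star' _ := rfl

/-- Operator norms can be tested at one vector at a time, and each vector lies in a separable
invariant subspace. So the product over separable representations already has the universal norm. -/
theorem norm_lift_le {N : ℕ} {S : Gens} {K : Type} [NormedAddCommGroup K] [InnerProductSpace ℂ K]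
    [CompleteSpace K] {w : Matrix (Fin N) (Fin N) (Op K)} (hw : Relations S w)
    (f : FreeAlgebra ℂ (Fin N × Fin N)) :
    ‖FreeAlgebra.lift ℂ (fun ij : Fin N × Fin N => w ij.1 ij.2) f‖ ≤
      ‖FreeAlgebra.lift ℂ (fun ij : Fin N × Fin N => universalGen N S ij.1 ij.2) f‖ := by
  refine ContinuousLinearMap.opNorm_le_bound _ (norm_nonneg _) fun x => ?_
  by_cases hx : x = 0
  · simp [hx]
  obtain ⟨r, j, ⟨y, rfl⟩, hj⟩ := exists_rep hw hx
  set a := FreeAlgebra.lift ℂ (fun ij : Fin N × Fin N => universalGen N S ij.1 ij.2)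
  have key : ∀ y, FreeAlgebra.lift ℂ (fun ij : Fin N × Fin N => w ij.1 ij.2) f (j y) =
      j (evalRep r (a f) y) := by
    induction f using FreeAlgebra.induction with
    | grade0 c =>
      intro y
      simp [Algebra.algebraMap_eq_smul_one]
    | grade1 ij =>
      intro y
      rw [FreeAlgebra.lift_ι_apply, FreeAlgebra.lift_ι_apply]
      exact (hj _ _ _).symm
    | mul f g hf hg =>
      intro y
      simp only [map_mul, mul_apply_eq_comp, hf, hg]
    | add f g hf hg =>
      intro y
      simp only [map_add, _root_.add_apply, hf, hg]
  rw [key, j.norm_map, j.norm_map]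
  exact (ContinuousLinearMap.le_opNorm _ _).trans
    (mul_le_mul_of_nonneg_right (lp.norm_apply_le_norm ENNReal.top_ne_zero _ _) (norm_nonneg _))

/-- The algebra is defined as a closure in the ambient product, whereas generation refers to the
closure inside the algebra; the two agree through the subspace topology. -/
theorem generates_quantumGroup (N : ℕ) (S : Gens) :
    (StarAlgebra.adjoin ℂ
      (Set.range fun ij : Fin N × Fin N => (quantumGroup N S).u ij.1 ij.2)).topologicalClosure
        = ⊤ := by
  rw [eq_top_iff]
  intro x _
  change x ∈ closure _
  refine (closure_subtype (x := (x : universalAlgebra N S))).2 ?_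
  have h := x.2
  change x.1 ∈ closure _ at h
  refine closure_mono ?_ h
  intro y hy
  have hr : (Set.range fun ij : Fin N × Fin N => universalGen N S ij.1 ij.2) =
      (universalAlgebra N S).subtype '' (Set.range fun ij : Fin N × Fin N =>
        ((quantumGroup N S).u ij.1 ij.2 : universalAlgebra N S)) :=
    Set.range_comp (universalAlgebra N S).subtype fun ij : Fin N × Fin N =>
      ((quantumGroup N S).u ij.1 ij.2 : universalAlgebra N S)
  have hy' : y ∈ StarAlgebra.adjoin ℂ
      (Set.range fun ij : Fin N × Fin N => universalGen N S ij.1 ij.2) := hy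
  rw [hr, ← StarAlgHom.map_adjoin] at hy'
  obtain ⟨z, hz, rfl⟩ := hy'
  exact ⟨z, hz, rfl⟩

theorem continuous_starAlgHom {A B : Type} [CStarAlgebra A] [CStarAlgebra B] (φ : A →⋆ₐ[ℂ] B) :
    Continuous φ :=
  AddMonoidHomClass.continuous_of_bound φ 1 fun x => by
    rw [one_mul]
    exact NonUnitalStarAlgHom.norm_apply_le φ x

theorem hom_ext_of_generates {N : ℕ} {G : MatrixPair N}
    (hG : (StarAlgebra.adjoin ℂ
      (Set.range fun ij : Fin N × Fin N => G.u ij.1 ij.2)).topologicalClosure = ⊤)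
    {B : Type} [CStarAlgebra B] {φ ψ : G.alg →⋆ₐ[ℂ] B} (h : ∀ i j, φ (G.u i j) = ψ (G.u i j)) :
    φ = ψ := by
  have h1 : StarAlgebra.adjoin ℂ (Set.range fun ij : Fin N × Fin N => G.u ij.1 ij.2) ≤
      StarAlgHom.equalizer φ ψ := by
    refine StarAlgHom.adjoin_le_equalizer φ ψ ?_
    rintro _ ⟨ij, rfl⟩
    exact h _ _
  have h2 : IsClosed (StarAlgHom.equalizer φ ψ : Set G.alg) :=
    isClosed_eq (continuous_starAlgHom φ) (continuous_starAlgHom ψ)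
  have h3 := StarSubalgebra.topologicalClosure_minimal h1 h2
  rw [hG] at h3
  exact StarAlgHom.ext fun x => h3 (StarSubalgebra.mem_top)

/-- The coordinate of the universal C*-algebra at one representation. -/
def evalRepQ {N : ℕ} {S : Gens} (r : Rep N S) :
    (quantumGroup N S).alg →⋆ₐ[ℂ] Op (SepHilbert r.index) where
  toFun x := (x : universalAlgebra N S).1 r
  map_one' := rfl
  map_mul' _ _ := rfl
  map_zero' := rfl
  map_add' _ _ := rfl
  commutes' _ := rfl
  map_star' _ := rfl

theorem evalRepQ_ext {N : ℕ} {S : Gens} {x y : (quantumGroup N S).alg}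
    (h : ∀ r, evalRepQ r x = evalRepQ r y) : x = y :=
  Subtype.ext (lp.ext (funext h))

theorem map_u_evalRepQ {N : ℕ} {S : Gens} (r : Rep N S) :
    (quantumGroup N S).u.map (evalRepQ r) = r.v := rfl

theorem relations_quantumGroup (N : ℕ) (S : Gens) : Relations S (quantumGroup N S).u where
  selfAdjoint i j := evalRepQ_ext fun r => by
    rw [map_star]
    exact r.relations.selfAdjoint i j
  mul_transpose := by
    ext i j : 2
    refine evalRepQ_ext fun r => ?_
    have h := congrFun (congrFun r.relations.mul_transpose i) j
    rw [← map_u_evalRepQ, ← Matrix.transpose_map, ← Matrix.map_mul] at h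
    refine h.trans ?_
    rw [← Matrix.map_one (evalRepQ r) (map_zero _) (map_one _)]
    rfl
  transpose_mul := by
    ext i j : 2
    refine evalRepQ_ext fun r => ?_
    have h := congrFun (congrFun r.relations.transpose_mul i) j
    rw [← map_u_evalRepQ, ← Matrix.transpose_map, ← Matrix.map_mul] at h
    refine h.trans ?_
    rw [← Matrix.map_one (evalRepQ r) (map_zero _) (map_one _)]
    rfl
  intertwines p hp := by
    rw [mem_Mor]
    ext s t : 2
    refine evalRepQ_ext fun r => ?_
    have h := r.relations.intertwines p hp
    have h2 := congrFun (congrFun (mem_Mor.1 h) s) t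
    have e : r.v = (quantumGroup N S).u.map (evalRepQ r : (quantumGroup N S).alg →ₐ[ℂ] Op (SepHilbert r.index)) := rfl
    rw [e, tensorMatrix_map, tensorMatrix_map,
      ← scalarMatrix_map (evalRepQ r : (quantumGroup N S).alg →ₐ[ℂ] Op (SepHilbert r.index)), ← Matrix.map_mul, ← Matrix.map_mul] at h2
    exact h2

/-- A norm estimate for noncommutative polynomials in self-adjoint generators yields a
`*`-homomorphism. -/
theorem exists_starAlgHom_of_norm_le {A B X : Type} [CStarAlgebra A] [CStarAlgebra B] (a : X → A)
    (b : X → B) (ha : ∀ x, star (a x) = a x) (hb : ∀ x, star (b x) = b x)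
    (h : ∀ f : FreeAlgebra ℂ X, ‖FreeAlgebra.lift ℂ b f‖ ≤ ‖FreeAlgebra.lift ℂ a f‖) :
    ∃ φ : (StarAlgebra.adjoin ℂ (Set.range a)).topologicalClosure →⋆ₐ[ℂ] B,
      ∀ x (hx : a x ∈ (StarAlgebra.adjoin ℂ (Set.range a)).topologicalClosure),
        φ ⟨a x, hx⟩ = b x := by
  -- The homomorphism is built from its graph `D`, the C*-subalgebra of `A × B` generated by the
  -- pairs of generators.
  set g : X → A × B := fun x => (a x, b x)
  set D := (StarAlgebra.adjoin ℂ (Set.range g)).topologicalClosure with hD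
  have hg : ∀ x, star (g x) = g x := fun x => Prod.ext (ha x) (hb x)
  have hnorm : ∀ x ∈ D, ‖x.2‖ ≤ ‖x.1‖ := by
    have hcl : IsClosed {x : A × B | ‖x.2‖ ≤ ‖x.1‖} :=
      isClosed_le (continuous_snd.norm) (continuous_fst.norm)
    intro x hx
    refine closure_minimal (fun y hy => ?_) hcl hx
    -- As the generators are self-adjoint, the `*`-algebra they generate consists of noncommutative
    -- polynomials in them, to which the hypothesis applies.
    have hstar : star (Set.range g) = Set.range g := by
      ext z
      rw [Set.mem_star]
      constructor
      · rintro ⟨x, hx⟩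
        exact ⟨x, by rw [← hg, hx, star_star]⟩
      · rintro ⟨x, rfl⟩
        exact ⟨x, (hg x).symm⟩
    have hy' : y ∈ (StarAlgebra.adjoin ℂ (Set.range g)).toSubalgebra := hy
    rw [StarAlgebra.adjoin_toSubalgebra, hstar, Set.union_self,
      Algebra.adjoin_range_eq_range_freeAlgebra_lift] at hy'
    obtain ⟨f, rfl⟩ := hy'
    have h1 : (FreeAlgebra.lift ℂ g f).1 = FreeAlgebra.lift ℂ a f := by
      have : (AlgHom.fst ℂ A B).comp (FreeAlgebra.lift ℂ g) = FreeAlgebra.lift ℂ a := by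
        ext; simp [g]
      rw [← this]; rfl
    have h2 : (FreeAlgebra.lift ℂ g f).2 = FreeAlgebra.lift ℂ b f := by
      have : (AlgHom.snd ℂ A B).comp (FreeAlgebra.lift ℂ g) = FreeAlgebra.lift ℂ b := by
        ext; simp [g]
      rw [← this]; rfl
    change ‖(FreeAlgebra.lift ℂ g f).2‖ ≤ ‖(FreeAlgebra.lift ℂ g f).1‖
    rw [h1, h2]
    exact h f
  have huniq : ∀ {x : A} {y y' : B}, (x, y) ∈ D → (x, y') ∈ D → y = y' := by
    intro x y y' h h'
    have := hnorm _ (sub_mem h h')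
    simpa [sub_eq_zero] using this
  have hex : ∀ x ∈ (StarAlgebra.adjoin ℂ (Set.range a)).topologicalClosure, ∃ y, (x, y) ∈ D := by
    -- The product carries the maximum norm, so `‖y‖ ≤ ‖x‖` on `D` makes the first projection
    -- isometric. Its image is then complete, hence closed, and contains the whole closure of the
    -- domain.
    have hiso : Isometry fun d : D => d.1.1 := by
      refine Isometry.of_dist_eq fun d d' => ?_
      have h1 := hnorm _ (sub_mem d.2 d'.2)
      change dist d.1.1 d'.1.1 = max (dist d.1.1 d'.1.1) (dist d.1.2 d'.1.2)
      rw [dist_eq_norm, dist_eq_norm]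
      exact (max_eq_left h1).symm
    have : CompleteSpace D := (StarSubalgebra.isClosed_topologicalClosure _).completeSpace_coe
    have hcl := hiso.isClosedEmbedding.isClosed_range
    intro x hx
    have hx' : x ∈ Set.range fun d : D => d.1.1 := by
      refine closure_minimal (fun y hy => ?_) hcl hx
      have hy' : y ∈ StarAlgebra.adjoin ℂ (Set.range a) := hy
      have hr : Set.range a = StarAlgHom.fst ℂ A B '' Set.range g :=
        Set.range_comp (StarAlgHom.fst ℂ A B) g
      rw [hr, ← StarAlgHom.map_adjoin] at hy'
      obtain ⟨z, hz, rfl⟩ := hy'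
      exact ⟨⟨z, StarSubalgebra.le_topologicalClosure _ hz⟩, rfl⟩
    obtain ⟨d, rfl⟩ := hx'
    exact ⟨d.1.2, d.2⟩
  have hspec : ∀ x : (StarAlgebra.adjoin ℂ (Set.range a)).topologicalClosure,
      (x.1, (hex x.1 x.2).choose) ∈ D :=
    fun x => (hex x.1 x.2).choose_spec
  let φ : (StarAlgebra.adjoin ℂ (Set.range a)).topologicalClosure →⋆ₐ[ℂ] B :=
    { toFun := fun x => (hex x.1 x.2).choose
      map_one' := huniq (hspec _) (one_mem D)
      map_mul' := fun x y => huniq (hspec _) (mul_mem (hspec x) (hspec y))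
      map_zero' := huniq (hspec _) (zero_mem D)
      map_add' := fun x y => huniq (hspec _) (add_mem (hspec x) (hspec y))
      commutes' := fun c => huniq (hspec _) (algebraMap_mem D c)
      map_star' := fun x => huniq (hspec _) (star_mem (hspec x)) }
  refine ⟨φ, fun x hx => huniq (hspec ⟨a x, hx⟩) ?_⟩
  exact StarSubalgebra.le_topologicalClosure _ (StarAlgebra.subset_adjoin ℂ _ ⟨x, rfl⟩)

/-- A faithful representation is isometric, so the norm estimate for operators on a Hilbert space
passes to `B`. -/
theorem exists_lift {N : ℕ} {S : Gens} {B K : Type} [CStarAlgebra B] [NormedAddCommGroup K]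
    [InnerProductSpace ℂ K] [CompleteSpace K] (ρ : B →⋆ₐ[ℂ] Op K) (hρ : Function.Injective ρ)
    {w : Matrix (Fin N) (Fin N) B} (hw : Relations S w) :
    ∃ φ : (quantumGroup N S).alg →⋆ₐ[ℂ] B, ∀ i j, φ ((quantumGroup N S).u i j) = w i j := by
  obtain ⟨φ, hφ⟩ := exists_starAlgHom_of_norm_le
    (fun ij : Fin N × Fin N => universalGen N S ij.1 ij.2) (fun ij => w ij.1 ij.2)
    (fun ij => congrArg Subtype.val ((relations_quantumGroup N S).selfAdjoint ij.1 ij.2))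
    (fun ij => hw.selfAdjoint _ _) (fun f => by
      have : (ρ : B →ₐ[ℂ] Op K).comp (FreeAlgebra.lift ℂ fun ij : Fin N × Fin N => w ij.1 ij.2) =
          FreeAlgebra.lift ℂ (fun ij : Fin N × Fin N => (w.map ρ) ij.1 ij.2) := by
        ext; simp
      have h2 : ρ (FreeAlgebra.lift ℂ (fun ij : Fin N × Fin N => w ij.1 ij.2) f) =
          FreeAlgebra.lift ℂ (fun ij : Fin N × Fin N => (w.map ρ) ij.1 ij.2) f := by
        rw [← this]; rfl
      rw [← NonUnitalStarAlgHom.norm_map ρ hρ, h2]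
      exact norm_lift_le (relations_map ρ hw) f)
  exact ⟨φ, fun i j => hφ (i, j) _⟩

/-! ### Surjectivity of `*`-homomorphisms with dense range -/

/-- The functional calculus of the truncation to `[-M, M]` cuts `x` down in norm. It does not change
the image, whose spectrum already lies in that interval. -/
theorem exists_preimage_selfAdjoint {A B : Type} [CStarAlgebra A] [CStarAlgebra B]
    (φ : A →⋆ₐ[ℂ] B) {x : A} (hx : IsSelfAdjoint x) : ∃ y, φ y = φ x ∧ ‖y‖ ≤ ‖φ x‖ := by
  set M := ‖φ x‖
  have hM : (0 : ℝ) ≤ M := norm_nonneg _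
  have hcont : Continuous fun t : ℝ => max (-M) (min M t) := by fun_prop
  refine ⟨cfc (fun t : ℝ => max (-M) (min M t)) x, ?_, ?_⟩
  · have hφx : IsSelfAdjoint (φ x) := hx.map φ
    rw [StarAlgHomClass.map_cfc φ _ x hcont.continuousOn (continuous_starAlgHom φ) hx hφx]
    conv_rhs => rw [← cfc_id ℝ (φ x)]
    refine cfc_congr fun t ht => ?_
    have h1 : ‖t‖ ≤ M := by
      rcases subsingleton_or_nontrivial B with h | h
      · simp [Subsingleton.elim (φ x) 0] at ht
      · exact spectrum.norm_le_norm_of_mem ht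
    rw [Real.norm_eq_abs, abs_le] at h1
    change max (-M) (min M t) = t
    rw [min_eq_right h1.2, max_eq_right h1.1]
  · refine norm_cfc_le hM fun t _ => ?_
    rw [Real.norm_eq_abs, abs_le]
    exact ⟨le_max_left _ _, max_le (by linarith) (min_le_left _ _)⟩

theorem starAlgHom_real_smul {A B : Type} [CStarAlgebra A] [CStarAlgebra B] (φ : A →⋆ₐ[ℂ] B)
    (r : ℝ) (x : A) : φ (r • x) = r • φ x := by
  rw [← Complex.coe_smul, map_smul, Complex.coe_smul]

theorem exists_preimage_norm_le {A B : Type} [CStarAlgebra A] [CStarAlgebra B]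
    (φ : A →⋆ₐ[ℂ] B) (x : A) : ∃ y, φ y = φ x ∧ ‖y‖ ≤ 2 * ‖φ x‖ := by
  obtain ⟨a, ha, ha'⟩ := exists_preimage_selfAdjoint φ (x := (realPart x : A)) (realPart x).2
  obtain ⟨b, hb, hb'⟩ := exists_preimage_selfAdjoint φ (x := (imaginaryPart x : A))
    (imaginaryPart x).2
  have h1 : ‖φ (realPart x : A)‖ ≤ ‖φ x‖ := by
    rw [realPart_apply_coe, starAlgHom_real_smul, map_add, map_star, norm_smul]
    have := norm_add_le (φ x) (star (φ x))
    rw [norm_star] at this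
    norm_num
    linarith
  have h2 : ‖φ (imaginaryPart x : A)‖ ≤ ‖φ x‖ := by
    rw [imaginaryPart_apply_coe, map_smul, starAlgHom_real_smul, map_sub, map_star,
      norm_smul, norm_smul]
    have := norm_sub_le (φ x) (star (φ x))
    rw [norm_star] at this
    norm_num
    linarith
  refine ⟨a + Complex.I • b, ?_, ?_⟩
  · rw [map_add, map_smul, ha, hb, ← map_smul, ← map_add, realPart_add_I_smul_imaginaryPart]
  · refine (norm_add_le _ _).trans ?_
    rw [norm_smul, Complex.norm_I]
    linarith

/-- A `*`-homomorphism has closed range: every element of the range has a preimage of norm at most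
twice its own, and completeness of `A` extends such control to the closure. -/
theorem surjective_of_dense {A B : Type} [CStarAlgebra A] [CStarAlgebra B] (φ : A →⋆ₐ[ℂ] B)
    (h : φ.range.topologicalClosure = ⊤) : Function.Surjective φ := by
  set f : NormedAddGroupHom A B :=
    { toFun := φ
      map_add' := map_add φ
      bound' := ⟨1, fun x => by rw [one_mul]; exact NonUnitalStarAlgHom.norm_apply_le φ x⟩ }
  have h1 : f.SurjectiveOnWith φ.toAlgHom.toLinearMap.range.toAddSubgroup 2 := by
    rintro _ ⟨x, rfl⟩
    exact exists_preimage_norm_le φ x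
  have h2 := controlled_closure_of_complete (by norm_num) one_pos h1
  intro y
  obtain ⟨x, hx, _⟩ := h2 y (by
    have : y ∈ φ.range.topologicalClosure := by rw [h]; exact StarSubalgebra.mem_top
    exact this)
  exact ⟨x, hx⟩

theorem surjective_of_generates {N : ℕ} {G : MatrixPair N}
    (hG : (StarAlgebra.adjoin ℂ
      (Set.range fun ij : Fin N × Fin N => G.u ij.1 ij.2)).topologicalClosure = ⊤)
    {A : Type} [CStarAlgebra A] (φ : A →⋆ₐ[ℂ] G.alg) (h : ∀ i j, ∃ x, φ x = G.u i j) :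
    Function.Surjective φ := by
  apply surjective_of_dense
  rw [eq_top_iff, ← hG]
  refine StarSubalgebra.topologicalClosure_mono (StarAlgebra.adjoin_le ?_)
  rintro _ ⟨ij, rfl⟩
  exact h _ _

/-! ### Representations on completions -/

theorem completion_ext {V : Type} [SeminormedAddCommGroup V] [InnerProductSpace ℂ V]
    {a b : Op (UniformSpace.Completion V)}
    (h : ∀ x : V, a (x : UniformSpace.Completion V) = b (x : UniformSpace.Completion V)) :
    a = b :=
  ContinuousLinearMap.ext fun x =>
    UniformSpace.Completion.ext' a.continuous b.continuous h x

theorem tensorMatrix_apply_coe {N : ℕ} {V : Type} [SeminormedAddCommGroup V]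
    [InnerProductSpace ℂ V] {U : Matrix (Fin N) (Fin N) (Module.End ℂ V)}
    {w : Matrix (Fin N) (Fin N) (Op (UniformSpace.Completion V))}
    (h : ∀ i j (x : V), w i j (x : UniformSpace.Completion V) = (U i j x : V)) (k : ℕ)
    (s t : Fin k → Fin N) (x : V) :
    tensorMatrix w k s t (x : UniformSpace.Completion V) = (tensorMatrix U k s t x : V) := by
  induction k with
  | zero =>
    rw [tensorMatrix_zero, tensorMatrix_zero, Subsingleton.elim s t, Matrix.one_apply_eq,
      Matrix.one_apply_eq]
    rfl
  | succ k ih =>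
    induction s using forall_fun_succ with
    | h a s =>
    induction t using forall_fun_succ with
    | h b t =>
    rw [tensorMatrix_cons, tensorMatrix_cons]
    exact (congrArg (w a b) (ih s t)).trans (h _ _ _)

/-- Symmetric linear maps on a pre-Hilbert space that satisfy the relations, up to vectors of norm
zero, extend to the completion. -/
theorem exists_completion {N : ℕ} {S : Gens} {V : Type} [SeminormedAddCommGroup V]
    [InnerProductSpace ℂ V] (U : Matrix (Fin N) (Fin N) (Module.End ℂ V))
    (hsym : ∀ i j x y, inner ℂ (U i j x) y = inner ℂ x (U i j y))
    (h1 : ∀ i j x, ((U * U.transpose) i j x : UniformSpace.Completion V) =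
      ((1 : Matrix (Fin N) (Fin N) (Module.End ℂ V)) i j x : V))
    (h2 : ∀ i j x, ((U.transpose * U) i j x : UniformSpace.Completion V) =
      ((1 : Matrix (Fin N) (Fin N) (Module.End ℂ V)) i j x : V))
    (h3 : ∀ p ∈ S, ∀ s t x,
      ((scalarMatrix (Module.End ℂ V) (mapT N p.2) * tensorMatrix U p.1.1) s t x :
        UniformSpace.Completion V) =
      ((tensorMatrix U p.1.2 * scalarMatrix (Module.End ℂ V) (mapT N p.2)) s t x : V)) :
    ∃ w : Matrix (Fin N) (Fin N) (Op (UniformSpace.Completion V)), Relations S w ∧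
      ∀ i j (x : V), w i j (x : UniformSpace.Completion V) = (U i j x : V) := by
  -- By symmetry, the column relation `∑ₘ U_mj² = 1` gives `∑ₘ ‖U_mj x‖² = ‖x‖²`. Hence each `U_ij`
  -- is a contraction.
  have hbound : ∀ i j x, ‖U i j x‖ ≤ 1 * ‖x‖ := by
    intro i j x
    rw [one_mul, ← sq_le_sq₀ (norm_nonneg _) (norm_nonneg _)]
    have e : ∑ m, ((‖U m j x‖ ^ 2 : ℝ) : ℂ) = ((‖x‖ ^ 2 : ℝ) : ℂ) := by
      have h4 : inner ℂ x ((U.transpose * U) j j x) = inner ℂ x x := by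
        have := h2 j j x
        rw [Matrix.one_apply_eq] at this
        rw [← UniformSpace.Completion.inner_coe, this, UniformSpace.Completion.inner_coe]
        rfl
      rw [Matrix.mul_apply, LinearMap.sum_apply, inner_sum, inner_self_eq_norm_sq_to_K] at h4
      push_cast
      refine Eq.trans (Finset.sum_congr rfl fun m _ => ?_) h4
      rw [Matrix.transpose_apply, Module.End.mul_apply, ← hsym, inner_self_eq_norm_sq_to_K]
      rfl
    have e' : ∑ m, ‖U m j x‖ ^ 2 = ‖x‖ ^ 2 := by exact_mod_cast e
    rw [← e']
    exact Finset.single_le_sum (f := fun m => ‖U m j x‖ ^ 2) (fun _ _ => sq_nonneg _)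
      (Finset.mem_univ i)
  set w : Matrix (Fin N) (Fin N) (Op (UniformSpace.Completion V)) :=
    Matrix.of fun i j => ((U i j).mkContinuous 1 (hbound i j)).completion with hw
  have hwU : ∀ i j (x : V), w i j (x : UniformSpace.Completion V) = (U i j x : V) := by
    intro i j x
    exact ContinuousLinearMap.completion_apply_coe _ x
  have hten := tensorMatrix_apply_coe hwU
  have hsum : ∀ {ι : Type} (s : Finset ι) (f : ι → V),
      ((∑ i ∈ s, f i : V) : UniformSpace.Completion V) =
        ∑ i ∈ s, (f i : UniformSpace.Completion V) := fun s f =>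
    map_sum (UniformSpace.Completion.toComplL (𝕜 := ℂ) (E := V)) f s
  refine ⟨w, ⟨fun i j => ?_, ?_, ?_, fun p hp => ?_⟩, hwU⟩
  · refine completion_ext fun x => ?_
    refine ext_inner_left ℂ fun y => ?_
    rw [ContinuousLinearMap.star_eq_adjoint, ContinuousLinearMap.adjoint_inner_right]
    induction y using UniformSpace.Completion.induction_on with
    | hp => exact isClosed_eq (by fun_prop) (by fun_prop)
    | ih y =>
      rw [hwU, hwU, UniformSpace.Completion.inner_coe, UniformSpace.Completion.inner_coe, hsym]
  · refine Matrix.ext fun i j => ?_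
    refine completion_ext fun x => ?_
    have := h1 i j x
    rw [Matrix.mul_apply, LinearMap.sum_apply, hsum] at this
    rw [Matrix.mul_apply, _root_.sum_apply]
    refine Eq.trans (Finset.sum_congr rfl fun m _ => ?_) (this.trans ?_)
    · exact (congrArg (w i m) (hwU _ _ _)).trans (hwU _ _ _)
    · rw [Matrix.one_apply, Matrix.one_apply]
      split_ifs
      · rfl
      · exact UniformSpace.Completion.coe_zero
  · refine Matrix.ext fun i j => ?_
    refine completion_ext fun x => ?_
    have := h2 i j x
    rw [Matrix.mul_apply, LinearMap.sum_apply, hsum] at this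
    rw [Matrix.mul_apply, _root_.sum_apply]
    refine Eq.trans (Finset.sum_congr rfl fun m _ => ?_) (this.trans ?_)
    · exact (congrArg (w m i) (hwU _ _ _)).trans (hwU _ _ _)
    · rw [Matrix.one_apply, Matrix.one_apply]
      split_ifs
      · rfl
      · exact UniformSpace.Completion.coe_zero
  · rw [mem_Mor]
    refine Matrix.ext fun s t => ?_
    refine completion_ext fun x => ?_
    have := h3 p hp s t x
    rw [Matrix.mul_apply, Matrix.mul_apply, LinearMap.sum_apply, LinearMap.sum_apply, hsum,
      hsum] at this
    rw [Matrix.mul_apply, Matrix.mul_apply, _root_.sum_apply, _root_.sum_apply]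
    refine Eq.trans (Finset.sum_congr rfl fun m _ => ?_)
      (this.trans (Finset.sum_congr rfl fun m _ => ?_))
    · rw [scalarMatrix_apply, scalarMatrix_apply, Algebra.algebraMap_eq_smul_one,
        Algebra.algebraMap_eq_smul_one, smul_mul_assoc, one_mul, smul_mul_assoc, one_mul,
        _root_.smul_apply, LinearMap.smul_apply, hten, UniformSpace.Completion.coe_smul]
    · rw [scalarMatrix_apply, scalarMatrix_apply, Algebra.algebraMap_eq_smul_one,
        Algebra.algebraMap_eq_smul_one, mul_smul_comm, mul_one, mul_smul_comm, mul_one,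
        LinearMap.smul_apply, _root_.smul_apply, hten, UniformSpace.Completion.coe_smul]

/-! ### Direct sums of Hilbert spaces -/

section DirectSum

variable {I : Type} (E : I → Type) [∀ i, NormedAddCommGroup (E i)]
  [∀ i, InnerProductSpace ℂ (E i)]

/-- The vector `‖a‖ • x` serves as a square-summable dominating family for the diagonal action. -/
theorem norm_diag_le (a : lp (fun i => Op (E i)) ∞) (x : lp E 2) (i : I) :
    ‖a i (x i)‖ ≤ ‖((‖a‖ : ℂ) • x : lp E 2) i‖ := by
  rw [lp.coeFn_smul, Pi.smul_apply, norm_smul, Complex.norm_real, norm_norm]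
  exact (ContinuousLinearMap.le_opNorm _ _).trans
    (mul_le_mul_of_nonneg_right (lp.norm_apply_le_norm ENNReal.top_ne_zero _ _) (norm_nonneg _))

/-- A bounded family of operators acts on the Hilbert direct sum. -/
def diagOp (a : lp (fun i => Op (E i)) ∞) : Op (lp E 2) :=
  LinearMap.mkContinuous
    { toFun := fun x => ⟨fun i => a i (x i),
        Memℓp.mono' (lp.memℓp ((‖a‖ : ℂ) • x)) (norm_diag_le E a x)⟩
      map_add' := fun x y => lp.ext (funext fun i => map_add (a i) (x i) (y i))
      map_smul' := fun c x => lp.ext (funext fun i => map_smul (a i) c (x i)) }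
    ‖a‖ fun x => by
      refine (lp.norm_mono two_ne_zero (norm_diag_le E a x)).trans ?_
      rw [norm_smul, Complex.norm_real, norm_norm]

theorem diagOp_apply (a : lp (fun i => Op (E i)) ∞) (x : lp E 2) (i : I) :
    diagOp E a x i = a i (x i) := rfl

theorem diagOp_injective : Function.Injective (diagOp E) := by
  classical
  intro a b h
  refine lp.ext (funext fun i => ContinuousLinearMap.ext fun x => ?_)
  have h1 := congrArg (fun T => T (lp.single 2 i x) i) h
  simpa [diagOp_apply] using h1

variable [∀ i, CompleteSpace (E i)] [∀ i, Nontrivial (E i)]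

/-- The diagonal action as a `*`-homomorphism. -/
def diagHom : lp (fun i => Op (E i)) ∞ →⋆ₐ[ℂ] Op (lp E 2) where
  toFun := diagOp E
  map_one' := ContinuousLinearMap.ext fun x => lp.ext rfl
  map_mul' a b := ContinuousLinearMap.ext fun x => lp.ext rfl
  map_zero' := ContinuousLinearMap.ext fun x => lp.ext rfl
  map_add' a b := ContinuousLinearMap.ext fun x => lp.ext rfl
  commutes' c := ContinuousLinearMap.ext fun x => lp.ext rfl
  map_star' a := by
    refine ContinuousLinearMap.ext fun x => ext_inner_left ℂ fun y => ?_
    rw [ContinuousLinearMap.star_eq_adjoint, ContinuousLinearMap.adjoint_inner_right,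
      lp.inner_eq_tsum, lp.inner_eq_tsum]
    refine tsum_congr fun i => ?_
    rw [diagOp_apply, diagOp_apply, lp.star_apply, ContinuousLinearMap.star_eq_adjoint,
      ContinuousLinearMap.adjoint_inner_right]

end DirectSum

/-- The direct sum of all representations of the relations on separable Hilbert spaces. -/
abbrev RepSum (N : ℕ) (S : Gens) : Type := lp (fun r : Rep N S => SepHilbert r.index) 2

/-- The faithful representation of the universal C*-algebra on the direct sum of all
representations. -/
def faithfulRep (N : ℕ) (S : Gens) : (quantumGroup N S).alg →⋆ₐ[ℂ] Op (RepSum N S) :=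
  (diagHom fun r : Rep N S => SepHilbert r.index).comp (universalAlgebra N S).subtype

theorem faithfulRep_injective (N : ℕ) (S : Gens) : Function.Injective (faithfulRep N S) :=
  fun _ _ h => Subtype.ext (diagOp_injective _ h)

/-! ### Compact matrix quantum groups -/

theorem isUnit_of_relations {N : ℕ} {S : Gens} {A : Type} [Ring A] [Algebra ℂ A] [StarRing A]
    {u : Matrix (Fin N) (Fin N) A} (h : Relations S u) : IsUnit u ∧ IsUnit u.transpose :=
  ⟨⟨⟨u, u.transpose, h.mul_transpose, h.transpose_mul⟩, rfl⟩,
    ⟨⟨u.transpose, u, h.transpose_mul, h.mul_transpose⟩, rfl⟩⟩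

/-- The matrix with entries `∑ₖ u_ik ⊗ u_kj`. -/
def tensorSquare {N : ℕ} {H : Type} [NormedAddCommGroup H] [InnerProductSpace ℂ H]
    (u : Matrix (Fin N) (Fin N) (Op H)) : Matrix (Fin N) (Fin N) (Module.End ℂ (H ⊗[ℂ] H)) :=
  Matrix.of fun i j => ∑ k, TensorProduct.map (u i k).toLinearMap (u k j).toLinearMap

/-- The matrix `∑ₖ u_ik ⊗ u_kj` is the product of the copies of `u` in the first and the second leg.
Their entries commute, so all relations pass to the product; this is checked on the algebraic tensor
product and then extended by `exists_completion`. -/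
theorem exists_comultiplication {N : ℕ} {S : Gens} {H : Type} [NormedAddCommGroup H]
    [InnerProductSpace ℂ H] [CompleteSpace H] {u : Matrix (Fin N) (Fin N) (Op H)}
    (hu : Relations S u) :
    ∃ w : Matrix (Fin N) (Fin N) (Op (HTensor H)), Relations S w ∧
      ∀ i j (x y : H), w i j ((x ⊗ₜ[ℂ] y : H ⊗[ℂ] H) : HTensor H) =
        ∑ k, ((u i k x ⊗ₜ[ℂ] u k j y : H ⊗[ℂ] H) : HTensor H) := by
  set α : Op H →ₐ[ℂ] Module.End ℂ H :=
    { ContinuousLinearMap.toLinearMapRingHom with commutes' := fun _ => rfl }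
  set φ : Op H →ₐ[ℂ] Module.End ℂ (H ⊗[ℂ] H) := (Module.End.rTensorAlgHom ℂ H H).comp α
  set ψ : Op H →ₐ[ℂ] Module.End ℂ (H ⊗[ℂ] H) := (Module.End.lTensorAlgHom ℂ H H).comp α
  have hcomm : ∀ i j i' j', Commute (u.map φ i j) (u.map ψ i' j') := by
    intro i j i' j'
    refine TensorProduct.ext' fun x y => ?_
    rfl
  have hprod : u.map φ * u.map ψ = tensorSquare u := by
    refine Matrix.ext fun i j => ?_
    rw [Matrix.mul_apply]
    simp only [tensorSquare, Matrix.of_apply]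
    refine Finset.sum_congr rfl fun k _ => TensorProduct.ext' fun x y => ?_
    rfl
  have hφ1 : ∀ (χ : Op H →ₐ[ℂ] Module.End ℂ (H ⊗[ℂ] H)),
      (u.map χ) * (u.map χ).transpose = 1 := fun χ => by
    rw [← Matrix.transpose_map, ← Matrix.map_mul, hu.mul_transpose]
    exact Matrix.map_one _ (map_zero χ) (map_one χ)
  have hφ2 : ∀ (χ : Op H →ₐ[ℂ] Module.End ℂ (H ⊗[ℂ] H)),
      (u.map χ).transpose * (u.map χ) = 1 := fun χ => by
    rw [← Matrix.transpose_map, ← Matrix.map_mul, hu.transpose_mul]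
    exact Matrix.map_one _ (map_zero χ) (map_one χ)
  -- Transposition reverses products of matrices over a noncommutative ring only because entries of
  -- the two factors commute.
  have htr : (u.map φ * u.map ψ).transpose = (u.map ψ).transpose * (u.map φ).transpose := by
    refine Matrix.ext fun i j => ?_
    rw [Matrix.transpose_apply, Matrix.mul_apply, Matrix.mul_apply]
    exact Finset.sum_congr rfl fun k _ => (hcomm _ _ _ _).eq
  have hself : ∀ i j (x y : H), inner ℂ (u i j x) y = inner ℂ x (u i j y) := by
    intro i j x y
    have := hu.selfAdjoint i j
    rw [ContinuousLinearMap.star_eq_adjoint] at this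
    rw [← ContinuousLinearMap.adjoint_inner_right, this]
  have hsym : ∀ i j x y, inner ℂ (tensorSquare u i j x) y = inner ℂ x (tensorSquare u i j y) := by
    intro i j x y
    simp only [tensorSquare, Matrix.of_apply, LinearMap.sum_apply, sum_inner, inner_sum]
    refine Finset.sum_congr rfl fun k _ => ?_
    induction x with
    | zero => simp
    | add x x' hx hx' => rw [map_add, inner_add_left, inner_add_left, hx, hx']
    | tmul a b =>
      induction y with
      | zero => simp
      | add y y' hy hy' => rw [map_add, inner_add_right, inner_add_right, hy, hy']
      | tmul c d =>
        rw [TensorProduct.map_tmul, TensorProduct.map_tmul, TensorProduct.inner_tmul,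
          TensorProduct.inner_tmul]
        exact congrArg₂ (· * ·) (hself _ _ _ _) (hself _ _ _ _)
  have h1 : tensorSquare u * (tensorSquare u).transpose = 1 := by
    rw [← hprod, htr, Matrix.mul_assoc, ← Matrix.mul_assoc (u.map ψ), hφ1, Matrix.one_mul, hφ1]
  have h2 : (tensorSquare u).transpose * tensorSquare u = 1 := by
    rw [← hprod, htr, Matrix.mul_assoc, ← Matrix.mul_assoc (u.map φ).transpose, hφ2,
      Matrix.one_mul, hφ2]
  have h3 : ∀ p ∈ S, mapT N p.2 ∈ Mor (tensorSquare u) p.1.1 p.1.2 := by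
    intro p hp
    rw [← hprod]
    exact mem_Mor_mul hcomm (mem_Mor_map φ (hu.intertwines p hp))
      (mem_Mor_map ψ (hu.intertwines p hp))
  obtain ⟨w, hw, hwU⟩ := exists_completion (S := S) (tensorSquare u) hsym
    (fun i j x => by rw [h1]) (fun i j x => by rw [h2])
    (fun p hp s t x => by rw [mem_Mor.1 (h3 p hp)])
  refine ⟨w, hw, fun i j x y => ?_⟩
  rw [hwU, tensorSquare, Matrix.of_apply, LinearMap.sum_apply]
  exact map_sum (UniformSpace.Completion.toComplL (𝕜 := ℂ) (E := H ⊗[ℂ] H)) _ _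

theorem isCMQG_quantumGroup (N : ℕ) (S : Gens) : (quantumGroup N S).IsCMQG where
  generates := generates_quantumGroup N S
  isUnit_u := (isUnit_of_relations (relations_quantumGroup N S)).1
  isUnit_transpose := (isUnit_of_relations (relations_quantumGroup N S)).2
  comultiplication := by
    obtain ⟨w, hw, hw'⟩ := exists_comultiplication
      (relations_map (faithfulRep N S) (relations_quantumGroup N S))
    obtain ⟨Δ, hΔ⟩ := exists_lift (StarAlgHom.id ℂ (Op (HTensor (RepSum N S))))
      Function.injective_id hw
    refine ⟨RepSum N S, inferInstance, inferInstance, inferInstance, faithfulRep N S, Δ,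
      faithfulRep_injective N S, fun i j x y => ?_⟩
    rw [hΔ, hw']
    rfl

/-! ### Hilbert–Schmidt projections -/

section HilbertSchmidt

open scoped ComplexOrder Kronecker

variable {m n m' n' : Type} [Fintype m] [Fintype n] [Fintype m'] [Fintype n']

theorem exists_hsProj (W : Submodule ℂ (Matrix m n ℂ)) :
    ∃ P : Matrix m n ℂ →ₗ[ℂ] Matrix m n ℂ,
      ∀ X, P X ∈ W ∧ ∀ Y ∈ W, (Y.conjTranspose * (X - P X)).trace = 0 := by
  set e : Matrix m n ℂ ≃ₗ[ℂ] EuclideanSpace ℂ (n × m) :=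
    { toFun := fun X => WithLp.toLp 2 fun p => X p.2 p.1
      invFun := fun x => Matrix.of fun i j => x (j, i)
      map_add' := fun _ _ => rfl
      map_smul' := fun _ _ => rfl
      left_inv := fun _ => rfl
      right_inv := fun _ => rfl } with he
  have hinner : ∀ Y X, (Y.conjTranspose * X).trace = inner ℂ (e Y) (e X) := by
    intro Y X
    rw [PiLp.inner_apply, Fintype.sum_prod_type, Matrix.trace]
    refine Finset.sum_congr rfl fun i _ => ?_
    rw [Matrix.diag_apply, Matrix.mul_apply]
    refine Finset.sum_congr rfl fun j _ => ?_
    rw [Matrix.conjTranspose_apply, RCLike.inner_apply, mul_comm]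
    rfl
  set W' := W.map e.toLinearMap
  refine ⟨e.symm.toLinearMap ∘ₗ W'.starProjection.toLinearMap ∘ₗ e.toLinearMap, fun X => ?_⟩
  obtain ⟨Z, hZ, hZ'⟩ := W'.starProjection_apply_mem (e X)
  have h1 : (e.symm.toLinearMap ∘ₗ W'.starProjection.toLinearMap ∘ₗ e.toLinearMap) X = Z := by
    change e.symm (W'.starProjection (e X)) = Z
    rw [← hZ']
    exact e.symm_apply_apply Z
  rw [h1]
  refine ⟨hZ, fun Y hY => ?_⟩
  rw [hinner, map_sub]
  have h2 : e Z = W'.starProjection (e X) := hZ'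
  rw [h2]
  exact W'.sub_starProjection_mem_orthogonal (e X) _ ⟨Y, hY, rfl⟩

/-- The orthogonal projection onto a space of matrices with respect to the Hilbert–Schmidt inner
product. -/
def hsProj (W : Submodule ℂ (Matrix m n ℂ)) : Matrix m n ℂ →ₗ[ℂ] Matrix m n ℂ :=
  (exists_hsProj W).choose

theorem hsProj_mem (W : Submodule ℂ (Matrix m n ℂ)) (X : Matrix m n ℂ) : hsProj W X ∈ W :=
  ((exists_hsProj W).choose_spec X).1

theorem trace_mul_sub_hsProj {W : Submodule ℂ (Matrix m n ℂ)} {Y : Matrix m n ℂ} (hY : Y ∈ W)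
    (X : Matrix m n ℂ) : (Y.conjTranspose * (X - hsProj W X)).trace = 0 :=
  ((exists_hsProj W).choose_spec X).2 Y hY

theorem hsProj_eq {W : Submodule ℂ (Matrix m n ℂ)} {X Z : Matrix m n ℂ} (hZ : Z ∈ W)
    (h : ∀ Y ∈ W, (Y.conjTranspose * (X - Z)).trace = 0) : hsProj W X = Z := by
  classical
  have h1 : hsProj W X - Z ∈ W := sub_mem (hsProj_mem W X) hZ
  have h2 := h _ h1
  have h3 := trace_mul_sub_hsProj h1 X
  rw [← sub_eq_zero, ← Matrix.trace_conjTranspose_mul_self_eq_zero_iff]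
  rw [← sub_eq_zero.2 (h2.trans h3.symm), ← Matrix.trace_sub, ← Matrix.mul_sub]
  congr 2
  abel

theorem hsProj_of_mem {W : Submodule ℂ (Matrix m n ℂ)} {X : Matrix m n ℂ} (h : X ∈ W) :
    hsProj W X = X :=
  hsProj_eq h fun Y _ => by rw [sub_self, Matrix.mul_zero, Matrix.trace_zero]

/-- Adjoint pairs of maps that preserve spaces of matrices commute with the projections. -/
theorem hsProj_map {W : Submodule ℂ (Matrix m n ℂ)} {W' : Submodule ℂ (Matrix m' n' ℂ)}
    (f : Matrix m n ℂ →ₗ[ℂ] Matrix m' n' ℂ) (g : Matrix m' n' ℂ → Matrix m n ℂ)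
    (hfg : ∀ Y X, (Y.conjTranspose * f X).trace = ((g Y).conjTranspose * X).trace)
    (hf : ∀ X ∈ W, f X ∈ W') (hg : ∀ Y ∈ W', g Y ∈ W) (X : Matrix m n ℂ) :
    hsProj W' (f X) = f (hsProj W X) :=
  hsProj_eq (hf _ (hsProj_mem W X)) fun Y hY => by
    rw [← map_sub, hfg]
    exact trace_mul_sub_hsProj (hg Y hY) X

theorem hsProj_mul_left {W : Submodule ℂ (Matrix m n ℂ)} {W' : Submodule ℂ (Matrix m' n ℂ)}
    (T : Matrix m' m ℂ) (hf : ∀ X ∈ W, T * X ∈ W') (hg : ∀ Y ∈ W', T.conjTranspose * Y ∈ W)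
    (X : Matrix m n ℂ) : hsProj W' (T * X) = T * hsProj W X :=
  hsProj_map
    { toFun := fun X => T * X
      map_add' := Matrix.mul_add T
      map_smul' := fun c X => Matrix.mul_smul T c X } (fun Y => T.conjTranspose * Y)
    (fun Y X => by
      rw [Matrix.conjTranspose_mul, Matrix.conjTranspose_conjTranspose, Matrix.mul_assoc]
      rfl) hf hg X

theorem hsProj_mul_right {W : Submodule ℂ (Matrix m n ℂ)} {W' : Submodule ℂ (Matrix m n' ℂ)}
    (T : Matrix n n' ℂ) (hf : ∀ X ∈ W, X * T ∈ W') (hg : ∀ Y ∈ W', Y * T.conjTranspose ∈ W)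
    (X : Matrix m n ℂ) : hsProj W' (X * T) = hsProj W X * T :=
  hsProj_map
    { toFun := fun X => X * T
      map_add' := fun X Y => Matrix.add_mul X Y T
      map_smul' := fun c X => Matrix.smul_mul c X T } (fun Y => Y * T.conjTranspose)
    (fun Y X => by
      rw [Matrix.conjTranspose_mul, Matrix.conjTranspose_conjTranspose, Matrix.mul_assoc,
        Matrix.trace_mul_comm T, Matrix.mul_assoc]
      rfl) hf hg X

theorem hsProj_conjTranspose {W : Submodule ℂ (Matrix m n ℂ)} {W' : Submodule ℂ (Matrix n m ℂ)}
    (hf : ∀ X ∈ W, X.conjTranspose ∈ W') (hg : ∀ Y ∈ W', Y.conjTranspose ∈ W)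
    (X : Matrix m n ℂ) : hsProj W' X.conjTranspose = (hsProj W X).conjTranspose :=
  hsProj_eq (hf _ (hsProj_mem W X)) fun Y hY => by
    rw [← Matrix.conjTranspose_sub, ← Matrix.conjTranspose_mul, Matrix.trace_conjTranspose,
      Matrix.trace_mul_comm]
    have := trace_mul_sub_hsProj (hg Y hY) X
    rw [Matrix.conjTranspose_conjTranspose] at this
    rw [this, star_zero]

/-- The matrix of a Hilbert–Schmidt projection, rearranged as in Choi's theorem. -/
def choiMatrix [DecidableEq n] (W : Submodule ℂ (Matrix n n ℂ)) : Matrix (n × n) (n × n) ℂ :=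
  Matrix.of fun x y => hsProj W (Matrix.single x.1 y.1 1) x.2 y.2

variable [DecidableEq n] {W : Submodule ℂ (Matrix n n ℂ)}

theorem choiMatrix_isHermitian (hstar : ∀ X ∈ W, X.conjTranspose ∈ W) :
    (choiMatrix W).IsHermitian := by
  refine Matrix.ext fun x y => ?_
  have h := hsProj_conjTranspose hstar hstar (Matrix.single y.1 x.1 1)
  rw [Matrix.conjTranspose_single, star_one] at h
  rw [Matrix.conjTranspose_apply, choiMatrix, Matrix.of_apply, Matrix.of_apply, h,
    Matrix.conjTranspose_apply]

/-- The Gram matrix of the columns of a Hilbert–Schmidt projection. -/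
def columnGram (W : Submodule ℂ (Matrix n n ℂ)) : Matrix n n ℂ :=
  Matrix.of fun y b => ∑ c, hsProj W (Matrix.single c b 1) c y

theorem trace_single_conjTranspose_mul (c y : n) (X : Matrix n n ℂ) :
    ((Matrix.single c y (1 : ℂ)).conjTranspose * X).trace = X c y := by
  rw [Matrix.conjTranspose_single, star_one, Matrix.trace_single_mul]
  simp

/-- Pairing with a matrix unit reads off an entry, and self-adjointness of the projection moves it
onto the unit. -/
theorem hsProj_apply_eq (X : Matrix n n ℂ) (c y : n) :
    hsProj W X c y =
      ((hsProj W (Matrix.single c y 1)).conjTranspose * hsProj W X).trace := by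
  have h := trace_mul_sub_hsProj (hsProj_mem W X) (Matrix.single c y 1)
  rw [Matrix.mul_sub, Matrix.trace_sub, sub_eq_zero] at h
  have h' := congrArg star h
  rw [← Matrix.trace_conjTranspose, ← Matrix.trace_conjTranspose, Matrix.conjTranspose_mul,
    Matrix.conjTranspose_mul, Matrix.conjTranspose_conjTranspose] at h'
  rw [← h', trace_single_conjTranspose_mul]

/-- By `hsProj_apply_eq` each summand is an inner product of projected matrix units, so the whole is
of the form `B* B`. -/
theorem columnGram_posSemidef : (columnGram W).PosSemidef := by
  set B : Matrix (n × n × n) n ℂ :=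
    Matrix.of fun z b => hsProj W (Matrix.single z.1 b 1) z.2.2 z.2.1
  have h : columnGram W = B.conjTranspose * B := by
    refine Matrix.ext fun y b => ?_
    rw [columnGram, Matrix.of_apply, Matrix.mul_apply, Fintype.sum_prod_type]
    refine Finset.sum_congr rfl fun c _ => ?_
    rw [hsProj_apply_eq, Fintype.sum_prod_type, Matrix.trace]
    refine Finset.sum_congr rfl fun i _ => ?_
    rw [Matrix.diag_apply, Matrix.mul_apply]
    rfl
  rw [h]
  exact Matrix.posSemidef_conjTranspose_mul_self B

/-- The projection is a right module map over the algebra, so `P(E_{b'c}) P(E_{cb}) = P(E_{b'c} Z)`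
with `Z = P(E_{cb})`. Expanding `E_{b'c} Z` in matrix units and summing over `c` produces the column
Gram matrix. -/
theorem choiMatrix_mul_self (hmul : ∀ X ∈ W, ∀ Y ∈ W, X * Y ∈ W)
    (hstar : ∀ X ∈ W, X.conjTranspose ∈ W) :
    choiMatrix W * choiMatrix W = choiMatrix W * (columnGram W ⊗ₖ (1 : Matrix n n ℂ)) := by
  refine Matrix.ext fun x z => ?_
  obtain ⟨b', a'⟩ := x
  obtain ⟨b, a⟩ := z
  have h1 : ∀ c, hsProj W (Matrix.single b' c 1) * hsProj W (Matrix.single c b 1) =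
      ∑ y, hsProj W (Matrix.single c b 1) c y • hsProj W (Matrix.single b' y 1) := by
    intro c
    set Z := hsProj W (Matrix.single c b 1) with hZ
    have hZW : Z ∈ W := hsProj_mem W _
    rw [← hsProj_mul_right Z (fun X hX => hmul X hX Z hZW)
      (fun X hX => hmul X hX _ (hstar Z hZW))]
    rw [show Matrix.single b' c (1 : ℂ) * Z = ∑ y, Z c y • Matrix.single b' y (1 : ℂ) from ?_,
      map_sum]
    · simp only [map_smul]
    · refine Matrix.ext fun i j => ?_
      rw [Matrix.sum_apply, Matrix.mul_apply]
      simp [Matrix.single_apply, ite_and]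
  rw [Matrix.mul_apply, Fintype.sum_prod_type, Matrix.mul_apply, Fintype.sum_prod_type]
  have h2 : ∀ c, ∑ d, choiMatrix W (b', a') (c, d) * choiMatrix W (c, d) (b, a) =
      ∑ y, hsProj W (Matrix.single c b 1) c y * choiMatrix W (b', a') (y, a) := by
    intro c
    have := congrFun (congrFun (h1 c) a') a
    rw [Matrix.mul_apply, Matrix.sum_apply] at this
    exact this
  simp only [h2]
  rw [Finset.sum_comm]
  refine Finset.sum_congr rfl fun y _ => ?_
  simp only [Matrix.kroneckerMap_apply, Matrix.one_apply, mul_ite, mul_one, mul_zero,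
    Finset.sum_ite_eq', Finset.mem_univ, if_true]
  rw [columnGram, Matrix.of_apply, mul_comm, Finset.sum_mul]

/-- The Hilbert–Schmidt projection onto a `*`-algebra of matrices is completely positive. -/
theorem choiMatrix_posSemidef (hmul : ∀ X ∈ W, ∀ Y ∈ W, X * Y ∈ W)
    (hstar : ∀ X ∈ W, X.conjTranspose ∈ W) : (choiMatrix W).PosSemidef := by
  have hP := choiMatrix_isHermitian hstar
  set P := choiMatrix W
  set G := columnGram W ⊗ₖ (1 : Matrix n n ℂ) with hG
  have hGpos : G.PosSemidef := columnGram_posSemidef.kronecker Matrix.PosSemidef.one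
  have h1 : P * P = G * P := by
    have := congrArg Matrix.conjTranspose (choiMatrix_mul_self hmul hstar)
    rwa [Matrix.conjTranspose_mul, Matrix.conjTranspose_mul, hP.eq, hGpos.isHermitian.eq] at this
  rw [hP.posSemidef_iff_eigenvalues_nonneg]
  intro i
  set v : n × n → ℂ := (hP.eigenvectorBasis i).ofLp
  have hv : P.mulVec v = (hP.eigenvalues i : ℂ) • v := hP.mulVec_eigenvectorBasis i
  by_contra hneg
  have hlt : hP.eigenvalues i < 0 := not_le.1 hneg
  have hne : (hP.eigenvalues i : ℂ) ≠ 0 := by exact_mod_cast hlt.ne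
  have h2 := congrArg (fun M => M.mulVec v) h1
  simp only [← Matrix.mulVec_mulVec, hv, Matrix.mulVec_smul] at h2
  -- With `λ` the eigenvalue of `v`, `P² = G P` reads `λ² v = λ G v`. So a negative eigenvalue of
  -- `P` would be an eigenvalue of the positive matrix `G`.
  have h3 : G.mulVec v = (hP.eigenvalues i : ℂ) • v := (smul_right_injective _ hne h2).symm
  have h4 := hGpos.dotProduct_mulVec_nonneg v
  rw [h3, dotProduct_smul] at h4
  have h5 : 0 < dotProduct (star v) v := by
    rw [Matrix.dotProduct_star_self_pos_iff]
    intro h0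
    have := hP.eigenvectorBasis.toBasis.ne_zero i
    apply this
    rw [OrthonormalBasis.coe_toBasis]
    exact (WithLp.ofLp_injective 2) h0
  have h6 : (hP.eigenvalues i : ℂ) * dotProduct (star v) v < 0 :=
    mul_neg_of_neg_of_pos (by exact_mod_cast hlt) h5
  exact h6.not_ge h4

end HilbertSchmidt

section

open scoped ComplexOrder

/-! ### Tensor categories of matrices -/

/-- `1 ⊗ X`, with one tensor factor added on the left. -/
def consOne {N k l : ℕ} (X : Matrix (Fin l → Fin N) (Fin k → Fin N) ℂ) :
    Matrix (Fin (l + 1) → Fin N) (Fin (k + 1) → Fin N) ℂ :=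
  Matrix.of fun j i => if j 0 = i 0 then X (Fin.tail j) (Fin.tail i) else 0

/-- `X ⊗ 1`, with `m` tensor factors added on the right. -/
def appendOne {N k l : ℕ} (X : Matrix (Fin l → Fin N) (Fin k → Fin N) ℂ) (m : ℕ) :
    Matrix (Fin (l + m) → Fin N) (Fin (k + m) → Fin N) ℂ :=
  Matrix.of fun j i => if j ∘ Fin.natAdd l = i ∘ Fin.natAdd k then
    X (j ∘ Fin.castAdd m) (i ∘ Fin.castAdd m) else 0

/-- The pair partition placed in front of `k` identity strings. -/
def pairOne (N k : ℕ) : Matrix (Fin (k + 2) → Fin N) (Fin k → Fin N) ℂ :=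
  Matrix.of fun j i => if Fin.tail (Fin.tail j) = i ∧ j 0 = Fin.tail j 0 then 1 else 0

/-- Families of spaces of matrices that are closed under products, adjoints and tensoring with
identities, and contain the pairs. -/
structure TensorSystem (N : ℕ) where
  hom : (k l : ℕ) → Submodule ℂ (Matrix (Fin l → Fin N) (Fin k → Fin N) ℂ)
  one_mem : ∀ k, 1 ∈ hom k k
  mul_mem : ∀ {k l m Y X}, Y ∈ hom l m → X ∈ hom k l → Y * X ∈ hom k m
  star_mem : ∀ {k l X}, X ∈ hom k l → X.conjTranspose ∈ hom l k
  consOne_mem : ∀ {k l X}, X ∈ hom k l → consOne X ∈ hom (k + 1) (l + 1)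
  appendOne_mem : ∀ {k l X} (m : ℕ), X ∈ hom k l → appendOne X m ∈ hom (k + m) (l + m)
  pairOne_mem : ∀ k, pairOne N k ∈ hom k (k + 2)

/-- Bending the first upper point down. -/
def bendDown {N k l : ℕ} : Matrix (Fin l → Fin N) (Fin (k + 1) → Fin N) ℂ →ₗ[ℂ]
    Matrix (Fin (l + 1) → Fin N) (Fin k → Fin N) ℂ where
  toFun X := Matrix.of fun j i => X (Fin.tail j) (Fin.cons (j 0) i)
  map_add' _ _ := rfl
  map_smul' _ _ := rfl

/-- Bending the first lower point up. -/
def bendUp {N k l : ℕ} (Y : Matrix (Fin (l + 1) → Fin N) (Fin k → Fin N) ℂ) :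
    Matrix (Fin l → Fin N) (Fin (k + 1) → Fin N) ℂ :=
  Matrix.of fun j i => Y (Fin.cons (i 0) j) (Fin.tail i)

theorem bendDown_eq {N k l : ℕ} (X : Matrix (Fin l → Fin N) (Fin (k + 1) → Fin N) ℂ) :
    bendDown X = consOne X * pairOne N k := by
  refine Matrix.ext fun j i => ?_
  rw [Matrix.mul_apply, sum_fun_succ]
  simp only [sum_fun_succ, consOne, pairOne, Matrix.of_apply, Fin.tail_cons, Fin.cons_zero]
  simp only [ite_and, mul_ite, mul_one, mul_zero, Finset.sum_ite_eq, Finset.sum_ite_eq',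
    Finset.mem_univ, if_true]
  rfl

theorem bendUp_eq {N k l : ℕ} (Y : Matrix (Fin (l + 1) → Fin N) (Fin k → Fin N) ℂ) :
    bendUp Y = (pairOne N l).conjTranspose * consOne Y := by
  refine Matrix.ext fun j i => ?_
  rw [Matrix.mul_apply, sum_fun_succ]
  simp only [sum_fun_succ, consOne, pairOne, Matrix.of_apply, Fin.tail_cons, Fin.cons_zero,
    Matrix.conjTranspose_apply]
  simp only [ite_and, apply_ite star, star_one, star_zero, ite_mul, zero_mul, one_mul]
  simp only [Finset.sum_ite_eq, Finset.sum_ite_eq', Finset.mem_univ, if_true]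
  rfl

theorem trace_bendUp {N k l : ℕ} (Y : Matrix (Fin (l + 1) → Fin N) (Fin k → Fin N) ℂ)
    (X : Matrix (Fin l → Fin N) (Fin (k + 1) → Fin N) ℂ) :
    (Y.conjTranspose * bendDown X).trace = ((bendUp Y).conjTranspose * X).trace := by
  simp only [Matrix.trace, Matrix.diag_apply, Matrix.mul_apply, Matrix.conjTranspose_apply]
  refine Eq.trans (Finset.sum_congr rfl fun i _ => sum_fun_succ
    fun y => star (Y y i) * bendDown X y i) ?_
  rw [Finset.sum_comm]
  exact (sum_fun_succ fun x => ∑ j, star (bendUp Y j x) * X j x).symm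

namespace TensorSystem

variable {N : ℕ} (C : TensorSystem N)

/-- Frobenius reciprocity for the projections: the two bendings are adjoint for the trace, and both
preserve the tensor system because they are given by composition with the pair. -/
theorem hsProj_bendDown {k l : ℕ} (X : Matrix (Fin l → Fin N) (Fin (k + 1) → Fin N) ℂ) :
    hsProj (C.hom k (l + 1)) (bendDown X) = bendDown (hsProj (C.hom (k + 1) l) X) :=
  hsProj_map bendDown bendUp trace_bendUp
    (fun X hX => by
      rw [bendDown_eq]
      exact C.mul_mem (C.consOne_mem hX) (C.pairOne_mem _))
    (fun Y hY => by
      rw [bendUp_eq]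
      exact C.mul_mem (C.star_mem (C.pairOne_mem _)) (C.consOne_mem hY)) X

theorem hsProj_mul {k l l' : ℕ} {T : Matrix (Fin l' → Fin N) (Fin l → Fin N) ℂ}
    (hT : T ∈ C.hom l l') (X : Matrix (Fin l → Fin N) (Fin k → Fin N) ℂ) :
    hsProj (C.hom k l') (T * X) = T * hsProj (C.hom k l) X :=
  hsProj_mul_left T (fun _ h => C.mul_mem hT h) (fun _ h => C.mul_mem (C.star_mem hT) h) X

theorem hsProj_star {k l : ℕ} (X : Matrix (Fin l → Fin N) (Fin k → Fin N) ℂ) :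
    hsProj (C.hom l k) X.conjTranspose = (hsProj (C.hom k l) X).conjTranspose :=
  hsProj_conjTranspose (fun _ h => C.star_mem h) (fun _ h => C.star_mem h) X

/-! ### The Gram matrix of the coefficients of tensor powers -/

/-- Index set of the coefficients of all tensor powers. -/
abbrev Coeff (N : ℕ) : Type := Σ k : ℕ, (Fin k → Fin N) × (Fin k → Fin N)

/-- The Gram matrix of the coefficients. -/
def gram : Matrix (Coeff N) (Coeff N) ℂ :=
  Matrix.of fun x y => hsProj (C.hom x.1 y.1) (Matrix.single y.2.2 x.2.2 1) y.2.1 x.2.1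

theorem gram_isHermitian : C.gram.IsHermitian := by
  refine Matrix.ext fun x y => ?_
  have h := C.hsProj_star (Matrix.single y.2.2 x.2.2 1)
  rw [Matrix.conjTranspose_single, star_one] at h
  rw [Matrix.conjTranspose_apply, gram, Matrix.of_apply, Matrix.of_apply, h,
    Matrix.conjTranspose_apply, star_star]

/-- Points of tensor powers with fewer than `n` factors. -/
abbrev Points (N n : ℕ) : Type := Σ k : Fin n, Fin k → Fin N

/-- The spaces `C(k, l)` with `k, l < n`, assembled to an algebra of matrices. -/
def blocks (n : ℕ) : Submodule ℂ (Matrix (Points N n) (Points N n) ℂ) where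
  carrier := {X | ∀ k l : Fin n, (Matrix.of fun j i => X ⟨l, j⟩ ⟨k, i⟩) ∈ C.hom k l}
  add_mem' hX hY k l := (C.hom k l).add_mem (hX k l) (hY k l)
  zero_mem' k l := (C.hom k l).zero_mem
  smul_mem' c _ hX k l := (C.hom k l).smul_mem c (hX k l)

theorem blocks_mul {n : ℕ} : ∀ X ∈ C.blocks n, ∀ Y ∈ C.blocks n,
    X * Y ∈ C.blocks n := by
  intro X hX Y hY k l
  have : (Matrix.of fun j i => (X * Y) ⟨l, j⟩ ⟨k, i⟩ :
      Matrix (Fin l → Fin N) (Fin k → Fin N) ℂ) = ∑ m : Fin n,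
      (Matrix.of fun j i => X ⟨l, j⟩ ⟨m, i⟩ : Matrix (Fin l → Fin N) (Fin m → Fin N) ℂ) *
        Matrix.of fun j i => Y ⟨m, j⟩ ⟨k, i⟩ := by
    refine Matrix.ext fun j i => ?_
    rw [Matrix.of_apply, Matrix.mul_apply, Fintype.sum_sigma, Matrix.sum_apply]
    rfl
  rw [this]
  exact sum_mem fun m _ => C.mul_mem (hX m l) (hY k m)

theorem blocks_star {n : ℕ} : ∀ X ∈ C.blocks n, X.conjTranspose ∈ C.blocks n :=
  fun _ hX k l => C.star_mem (hX l k)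

/-- The inclusion of a block. -/
def inclBlock {n : ℕ} (k l : Fin n) :
    Matrix (Fin l → Fin N) (Fin k → Fin N) ℂ →ₗ[ℂ] Matrix (Points N n) (Points N n) ℂ where
  toFun X := Matrix.of fun y x =>
    if h : y.1 = l ∧ x.1 = k then X (h.1 ▸ y.2) (h.2 ▸ x.2) else 0
  map_add' X Y := by
    refine Matrix.ext fun y x => ?_
    simp only [Matrix.of_apply, Matrix.add_apply]
    split_ifs <;> simp
  map_smul' c X := by
    refine Matrix.ext fun y x => ?_
    simp only [Matrix.of_apply, Matrix.smul_apply, RingHom.id_apply]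
    split_ifs <;> simp

theorem inclBlock_apply {n : ℕ} (k l : Fin n) (X : Matrix (Fin l → Fin N) (Fin k → Fin N) ℂ)
    (j : Fin l → Fin N) (i : Fin k → Fin N) : inclBlock k l X ⟨l, j⟩ ⟨k, i⟩ = X j i :=
  dif_pos ⟨rfl, rfl⟩

theorem inclBlock_single {n : ℕ} (k l : Fin n) (j : Fin l → Fin N) (i : Fin k → Fin N) :
    inclBlock k l (Matrix.single j i 1) = Matrix.single ⟨l, j⟩ ⟨k, i⟩ 1 := by
  refine Matrix.ext fun y x => ?_
  obtain ⟨l', j'⟩ := y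
  obtain ⟨k', i'⟩ := x
  by_cases h : l' = l ∧ k' = k
  · obtain ⟨rfl, rfl⟩ := h
    rw [inclBlock_apply]
    simp [Matrix.single_apply]
  · have : inclBlock k l (Matrix.single j i (1 : ℂ)) ⟨l', j'⟩ ⟨k', i'⟩ = 0 := dif_neg h
    rw [this, Matrix.single_apply, if_neg]
    rintro ⟨h1, h2⟩
    exact h ⟨(congrArg Sigma.fst h1).symm, (congrArg Sigma.fst h2).symm⟩

/-- Including a block is adjoint to cutting it out, and both operations respect the assembled
algebra. So its single projection encodes those onto all `C(k, l)`. -/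
theorem hsProj_blocks {n : ℕ} (k l : Fin n) (X : Matrix (Fin l → Fin N) (Fin k → Fin N) ℂ) :
    hsProj (C.blocks n) (inclBlock k l X) = inclBlock k l (hsProj (C.hom k l) X) := by
  refine hsProj_map (inclBlock k l) (fun Y => Matrix.of fun j i => Y ⟨l, j⟩ ⟨k, i⟩) ?_ ?_ ?_ X
  · intro Y X
    simp only [Matrix.trace, Matrix.diag_apply, Matrix.mul_apply, Matrix.conjTranspose_apply,
      Matrix.of_apply]
    rw [Fintype.sum_sigma, Finset.sum_eq_single k]
    · refine Finset.sum_congr rfl fun i _ => ?_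
      rw [Fintype.sum_sigma, Finset.sum_eq_single l]
      · simp only [inclBlock_apply]
      · intro l' _ h
        refine Finset.sum_eq_zero fun j _ => ?_
        have : inclBlock k l X ⟨l', j⟩ ⟨k, i⟩ = 0 := dif_neg fun h' => h h'.1
        rw [this, mul_zero]
      · simp
    · intro k' _ h
      refine Finset.sum_eq_zero fun i _ => Finset.sum_eq_zero fun y _ => ?_
      have : inclBlock k l X y ⟨k', i⟩ = 0 := dif_neg fun h' => h h'.2
      rw [this, mul_zero]
    · simp
  · intro X hX k' l'
    by_cases h : l' = l ∧ k' = k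
    · obtain ⟨rfl, rfl⟩ := h
      convert hX using 1
      refine Matrix.ext fun j i => ?_
      exact inclBlock_apply _ _ _ _ _
    · convert (C.hom k' l').zero_mem using 1
      refine Matrix.ext fun j i => ?_
      exact dif_neg h
  · intro Y hY
    exact hY k l

/-- A finitely supported vector involves finitely many tensor degrees. In these degrees the Gram
matrix is a submatrix of the transposed Choi matrix of the assembled `*`-algebra. -/
theorem gram_posSemidef : C.gram.PosSemidef := by
  refine ⟨C.gram_isHermitian, fun x => ?_⟩
  -- One more than the largest occurring degree, because `Points N n` uses degrees strictly below
  -- `n`.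
  set n := x.support.sup (fun α => α.1) + 1
  have hn : ∀ α ∈ x.support, α.1 < n := fun α hα =>
    Nat.lt_succ_of_le (Finset.le_sup (f := fun α : Coeff N => α.1) hα)
  set e : {α : Coeff N // α.1 < n} → Points N n × Points N n :=
    fun α => (⟨⟨α.1.1, α.2⟩, α.1.2.2⟩, ⟨⟨α.1.1, α.2⟩, α.1.2.1⟩) with he
  have h1 : C.gram.submatrix Subtype.val Subtype.val =
      ((choiMatrix (C.blocks n)).transpose).submatrix e e := by
    refine Matrix.ext fun α β => ?_
    rw [Matrix.submatrix_apply, Matrix.submatrix_apply, Matrix.transpose_apply, choiMatrix,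
      Matrix.of_apply]
    have h2 := C.hsProj_blocks ⟨α.1.1, α.2⟩ ⟨β.1.1, β.2⟩ (Matrix.single β.1.2.2 α.1.2.2 1)
    rw [inclBlock_single] at h2
    simp only [he]
    rw [h2, inclBlock_apply]
    rfl
  have h3 : (C.gram.submatrix (Subtype.val : {α : Coeff N // α.1 < n} → _)
      Subtype.val).PosSemidef := by
    rw [h1]
    exact ((choiMatrix_posSemidef C.blocks_mul C.blocks_star).transpose).submatrix e
  have h4 := h3.2 (x.subtypeDomain fun α => α.1 < n)
  refine h4.trans_eq (Eq.trans (Finsupp.sum_subtypeDomain_index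
    (p := fun α : Coeff N => α.1 < n) (v := x)
    (h := fun α a => (x.subtypeDomain fun α => α.1 < n).sum
      fun j xj => star a * C.gram α j.1 * xj) hn) (Finset.sum_congr rfl fun α _ => ?_))
  exact Finsupp.sum_subtypeDomain_index (p := fun α : Coeff N => α.1 < n) (v := x)
    (h := fun β b => star (x α) * C.gram α β * b) hn

end TensorSystem

end

section

open scoped ComplexOrder

/-! ### Pre-Hilbert spaces of Gram matrices -/

section GramSpace

variable {Q : Type} {G : Matrix Q Q ℂ}

set_option linter.unusedVariables false in
/-- The free vector space on the index set of a positive semidefinite matrix. -/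
@[nolint unusedArguments]
def GramSpace (hG : G.PosSemidef) : Type := Q →₀ ℂ

variable (hG : G.PosSemidef)

instance : AddCommGroup (GramSpace hG) := inferInstanceAs (AddCommGroup (Q →₀ ℂ))
instance : Module ℂ (GramSpace hG) := inferInstanceAs (Module ℂ (Q →₀ ℂ))

/-- The sesquilinear form of a matrix. -/
def gramForm (G : Matrix Q Q ℂ) (x y : Q →₀ ℂ) : ℂ :=
  x.sum fun i a => y.sum fun j b => star a * G i j * b

theorem gramForm_add_left (x y z : Q →₀ ℂ) :
    gramForm G (x + y) z = gramForm G x z + gramForm G y z := by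
  classical
  refine Finsupp.sum_add_index' (fun i => by simp) fun i a b => ?_
  rw [← Finsupp.sum_add]
  exact Finset.sum_congr rfl fun j _ => by rw [star_add]; ring

theorem gramForm_smul_left (c : ℂ) (x y : Q →₀ ℂ) :
    gramForm G (c • x) y = star c * gramForm G x y := by
  refine (Finsupp.sum_smul_index' fun i => by simp).trans ?_
  rw [gramForm, Finsupp.mul_sum]
  refine Finset.sum_congr rfl fun i _ => ?_
  beta_reduce
  rw [Finsupp.mul_sum]
  refine Finset.sum_congr rfl fun j _ => ?_
  beta_reduce
  rw [smul_eq_mul, star_mul']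
  ring

theorem gramForm_single (i j : Q) :
    gramForm G (Finsupp.single i 1) (Finsupp.single j 1) = G i j := by
  rw [gramForm, Finsupp.sum_single_index (by simp), Finsupp.sum_single_index (by simp)]
  simp

/-- The inner product space whose inner product is given by a Gram matrix. -/
abbrev gramCore : PreInnerProductSpace.Core ℂ (GramSpace hG) where
  inner := gramForm G
  conj_inner_symm x y := by
    simp only [gramForm, Finsupp.sum, map_sum]
    rw [Finset.sum_comm]
    refine Finset.sum_congr rfl fun i _ => Finset.sum_congr rfl fun j _ => ?_
    have h : star (G j i) = G i j := hG.isHermitian.apply i j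
    rw [← h, map_mul, map_mul, starRingEnd_apply, starRingEnd_apply, starRingEnd_apply, star_star]
    ring
  re_inner_nonneg x := (RCLike.nonneg_iff.1 (hG.2 x)).1
  add_left := gramForm_add_left
  smul_left x y c := gramForm_smul_left c x y

instance : SeminormedAddCommGroup (GramSpace hG) :=
  InnerProductSpace.Core.toSeminormedAddCommGroup (c := gramCore hG)

instance : InnerProductSpace ℂ (GramSpace hG) := InnerProductSpace.ofCore (gramCore hG)

/-- The basis vectors. -/
def gramBasis (i : Q) : GramSpace hG := Finsupp.single i (1 : ℂ)

theorem inner_gramBasis (i j : Q) : inner ℂ (gramBasis hG i) (gramBasis hG j) = G i j :=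
  gramForm_single i j

theorem GramSpace.induction {P : GramSpace hG → Prop} (hs : ∀ i, P (gramBasis hG i))
    (h0 : P 0) (ha : ∀ x y, P x → P y → P (x + y)) (hm : ∀ (c : ℂ) x, P x → P (c • x))
    (x : GramSpace hG) : P x := by
  refine Finsupp.induction_linear (motive := P) x h0 ha fun i c => ?_
  have h : (Finsupp.single i c : Q →₀ ℂ) = c • Finsupp.single i (1 : ℂ) := by
    rw [Finsupp.smul_single, smul_eq_mul, mul_one]
  rw [h]
  exact hm c _ (hs i)

/-- The linear map induced by a map of the index set. -/
def gramMap (f : Q → Q) : Module.End ℂ (GramSpace hG) := Finsupp.lmapDomain ℂ ℂ f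

theorem gramMap_gramBasis (f : Q → Q) (i : Q) :
    gramMap hG f (gramBasis hG i) = gramBasis hG (f i) := Finsupp.mapDomain_single

theorem gramMap_symm {f : Q → Q} (h : ∀ i j, G (f i) j = G i (f j)) (x y : GramSpace hG) :
    inner ℂ (gramMap hG f x) y = inner ℂ x (gramMap hG f y) := by
  induction x using GramSpace.induction with
  | h0 => rw [map_zero, inner_zero_left, inner_zero_left]
  | ha x x' hx hx' => rw [map_add, inner_add_left, inner_add_left, hx, hx']
  | hm c x hx => rw [map_smul, inner_smul_left, inner_smul_left, hx]
  | hs i =>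
    induction y using GramSpace.induction with
    | h0 => rw [map_zero, inner_zero_right, inner_zero_right]
    | ha x x' hx hx' => rw [map_add, inner_add_right, inner_add_right, hx, hx']
    | hm c x hx => rw [map_smul, inner_smul_right, inner_smul_right, hx]
    | hs j => rw [gramMap_gramBasis, gramMap_gramBasis, inner_gramBasis, inner_gramBasis, h]

/-- The Gram form may be degenerate, so identities hold only modulo vectors of norm zero; the
completion identifies such vectors. -/
theorem coe_eq_coe_of_inner {V : Type} [SeminormedAddCommGroup V] [InnerProductSpace ℂ V] {x y : V}
    (h : ∀ z, inner ℂ z x = inner ℂ z y) : (x : UniformSpace.Completion V) = y := by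
  rw [← sub_eq_zero, ← UniformSpace.Completion.coe_sub, ← norm_eq_zero,
    UniformSpace.Completion.norm_coe, ← sq_eq_zero_iff]
  have h1 : (inner ℂ (x - y) (x - y) : ℂ) = 0 := by rw [inner_sub_right, h, sub_self]
  rw [inner_self_eq_norm_sq_to_K] at h1
  have h2 : ((‖x - y‖ ^ 2 : ℝ) : ℂ) = 0 := by
    rw [← h1]
    push_cast
    rfl
  exact_mod_cast h2

end GramSpace

/-! ### The regular representation -/

section Pairs

variable {N : ℕ} {A : Type} [Ring A] [Algebra ℂ A]

theorem scalarMatrix_pairOne (s : Fin 2 → Fin N) (t : Fin 0 → Fin N) :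
    scalarMatrix A (pairOne N 0) s t = (1 : Matrix (Fin N) (Fin N) A) (s 0) (s 1) := by
  rw [scalarMatrix_apply, pairOne, Matrix.of_apply, Matrix.one_apply]
  have : Fin.tail (Fin.tail s) = t := Subsingleton.elim _ _
  simp only [this, true_and]
  rw [apply_ite (algebraMap ℂ A), map_one, map_zero]
  rfl

theorem scalarMatrix_pairOne_conjTranspose (s : Fin 0 → Fin N) (t : Fin 2 → Fin N) :
    scalarMatrix A (pairOne N 0).conjTranspose s t =
      (1 : Matrix (Fin N) (Fin N) A) (t 0) (t 1) := by
  rw [← scalarMatrix_pairOne t s, scalarMatrix_apply, scalarMatrix_apply,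
    Matrix.conjTranspose_apply, pairOne, Matrix.of_apply]
  split_ifs <;> simp

theorem sum_fun_two {R : Type*} [AddCommMonoid R] (f : (Fin 2 → Fin N) → R) :
    ∑ s, f s = ∑ a, ∑ b, f ![a, b] := by
  rw [sum_fun_succ]
  refine Finset.sum_congr rfl fun a _ => ?_
  rw [sum_fun_succ]
  refine Finset.sum_congr rfl fun b _ => ?_
  rw [Fintype.sum_unique]
  congr 1

theorem tensorMatrix_two {A : Type} [Ring A] (u : Matrix (Fin N) (Fin N) A) (s t : Fin 2 → Fin N) :
    tensorMatrix u 2 s t = u (s 0) (t 0) * u (s 1) (t 1) := by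
  simp [tensorMatrix, List.ofFn_succ]

theorem tensorMatrix_two_mul_pairOne (u : Matrix (Fin N) (Fin N) A) (s : Fin 2 → Fin N)
    (t : Fin 0 → Fin N) :
    (tensorMatrix u 2 * scalarMatrix A (pairOne N 0)) s t = (u * u.transpose) (s 0) (s 1) := by
  rw [Matrix.mul_apply, sum_fun_two, Matrix.mul_apply]
  simp only [scalarMatrix_pairOne, tensorMatrix_two, Matrix.one_apply]
  simp

theorem pairOne_mul_tensorMatrix_two (u : Matrix (Fin N) (Fin N) A) (s : Fin 0 → Fin N)
    (t : Fin 2 → Fin N) :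
    (scalarMatrix A (pairOne N 0).conjTranspose * tensorMatrix u 2) s t =
      (u.transpose * u) (t 0) (t 1) := by
  rw [Matrix.mul_apply, sum_fun_two, Matrix.mul_apply]
  simp only [scalarMatrix_pairOne_conjTranspose, tensorMatrix_two, Matrix.one_apply]
  simp

end Pairs

/-! ### Action of the generators on the coefficients -/

namespace TensorSystem

variable {N : ℕ} (C : TensorSystem N)

/-- Concatenation changes the degree only up to an equality of numbers such as `0 + m = m`; the
casts confine this to one place. -/
theorem coeff_ext {k k' : ℕ} (h : k = k') {i j : Fin k → Fin N} {i' j' : Fin k' → Fin N}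
    (hi : i = i' ∘ Fin.cast h) (hj : j = j' ∘ Fin.cast h) :
    (⟨k, i, j⟩ : Coeff N) = ⟨k', i', j'⟩ := by
  subst h
  rw [hi, hj]
  rfl

/-- Multiplication of coefficients by an entry of a tensor power. -/
def act (k : ℕ) (s t : Fin k → Fin N) (x : Coeff N) : Coeff N :=
  ⟨k + x.1, Fin.append s x.2.1, Fin.append t x.2.2⟩

/-- Multiplication of coefficients by a generator. -/
def push (a b : Fin N) (x : Coeff N) : Coeff N :=
  ⟨x.1 + 1, Fin.cons a x.2.1, Fin.cons b x.2.2⟩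

theorem act_zero (s t : Fin 0 → Fin N) : act 0 s t = id := by
  funext x
  obtain ⟨m, i, j⟩ := x
  refine coeff_ext (Nat.zero_add m) ?_ ?_
  · rw [Subsingleton.elim s Fin.elim0, Fin.elim0_append]
  · rw [Subsingleton.elim t Fin.elim0, Fin.elim0_append]

theorem act_cons (k : ℕ) (a b : Fin N) (s t : Fin k → Fin N) :
    act (k + 1) (Fin.cons a s) (Fin.cons b t) = push a b ∘ act k s t := by
  funext x
  obtain ⟨m, i, j⟩ := x
  refine coeff_ext (Nat.succ_add k m) ?_ ?_
  · exact Fin.append_cons a s i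
  · exact Fin.append_cons b t j

/-- Moving a generator to the other side of the form is bending its string, and bending commutes
with the projections. This makes the generators act by symmetric operators. -/
theorem gram_push (a b : Fin N) (x y : Coeff N) :
    C.gram (push a b x) y = C.gram x (push a b y) := by
  obtain ⟨k, i, j⟩ := x
  obtain ⟨l, i', j'⟩ := y
  have h := C.hsProj_bendDown (Matrix.single j' (Fin.cons b j : Fin (k + 1) → Fin N) 1)
  have h1 : bendDown (Matrix.single j' (Fin.cons b j : Fin (k + 1) → Fin N) (1 : ℂ)) =
      Matrix.single (Fin.cons b j' : Fin (l + 1) → Fin N) j 1 := by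
    refine Matrix.ext fun p q => ?_
    induction p using forall_fun_succ with
    | h c p =>
    change Matrix.single _ _ _ p (Fin.cons c q : Fin (k + 1) → Fin N) = _
    simp only [Matrix.single_apply, cons_eq_cons_iff]
    congr 1
    rw [eq_iff_iff]
    tauto
  rw [h1] at h
  have h2 := congrFun (congrFun h (Fin.cons a i')) i
  exact h2.symm

theorem append_eq_append_iff {k m : ℕ} (a a' : Fin k → Fin N) (b b' : Fin m → Fin N) :
    Fin.append a b = Fin.append a' b' ↔ a = a' ∧ b = b' := by
  rw [← Prod.mk_inj]
  exact (Fin.appendEquiv k m).injective.eq_iff (a := (a, b)) (b := (a', b'))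

/-- Since `T ⊗ 1` belongs to the tensor system, the projections are linear under left multiplication
by it. Comparing entries on a matrix unit gives the intertwining relation for `T` inside the form.
-/
theorem gram_act {k l : ℕ} {T : Matrix (Fin l → Fin N) (Fin k → Fin N) ℂ} (hT : T ∈ C.hom k l)
    (s : Fin l → Fin N) (t : Fin k → Fin N) (x y : Coeff N) :
    ∑ r, T s r * C.gram x (act k r t y) = ∑ r, T r t * C.gram x (act l s r y) := by
  obtain ⟨k₀, i₀, j₀⟩ := x
  obtain ⟨m, i, j⟩ := y
  have h := C.hsProj_mul (C.appendOne_mem m hT) (Matrix.single (Fin.append t j) j₀ 1)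
  have h1 : appendOne T m * Matrix.single (Fin.append t j) j₀ (1 : ℂ) =
      ∑ r, T r t • Matrix.single (Fin.append r j) j₀ (1 : ℂ) := by
    refine Matrix.ext fun p q => ?_
    obtain ⟨⟨a, b⟩, rfl⟩ := (Fin.appendEquiv l m).surjective p
    rw [show (Fin.appendEquiv l m) (a, b) = Fin.append a b from rfl]
    rw [Matrix.sum_apply, Matrix.mul_apply, sum_prod_append]
    simp only [Matrix.smul_apply, Matrix.single_apply, appendOne, Matrix.of_apply,
      append_comp_castAdd, append_comp_natAdd, append_eq_append_iff]
    by_cases hq : j₀ = q <;> by_cases hb : j = b <;>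
      simp [hq, hb, eq_comm, ite_and]
  rw [h1, map_sum] at h
  have h2 := congrFun (congrFun h (Fin.append s i)) i₀
  rw [Matrix.sum_apply, Matrix.mul_apply, sum_prod_append] at h2
  simp only [map_smul, Matrix.smul_apply, smul_eq_mul, appendOne, Matrix.of_apply,
    append_comp_castAdd, append_comp_natAdd] at h2
  refine Eq.trans (Finset.sum_congr rfl fun r _ => ?_) h2.symm
  simp only [ite_mul, zero_mul, Finset.sum_ite_eq, Finset.mem_univ, if_true]
  rfl

/-- The pre-Hilbert space spanned by the coefficients of all tensor powers. -/
abbrev Space : Type := GramSpace C.gram_posSemidef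

/-- The generators, acting by multiplication. -/
def regular : Matrix (Fin N) (Fin N) (Module.End ℂ C.Space) :=
  Matrix.of fun a b => gramMap _ (push a b)

theorem tensorMatrix_regular (k : ℕ) (s t : Fin k → Fin N) (x : Coeff N) :
    tensorMatrix C.regular k s t (gramBasis _ x) = gramBasis _ (act k s t x) := by
  induction k with
  | zero =>
    rw [tensorMatrix_zero, act_zero, Subsingleton.elim s t, Matrix.one_apply_eq]
    rfl
  | succ k ih =>
    induction s using forall_fun_succ with
    | h a s =>
    induction t using forall_fun_succ with
    | h b t =>
    rw [tensorMatrix_cons, act_cons, Module.End.mul_apply, ih]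
    exact gramMap_gramBasis _ _ _

theorem regular_intertwines {k l : ℕ} {T : Matrix (Fin l → Fin N) (Fin k → Fin N) ℂ}
    (hT : T ∈ C.hom k l) (s : Fin l → Fin N) (t : Fin k → Fin N)
    (x : C.Space) :
    ((scalarMatrix (Module.End ℂ C.Space) T * tensorMatrix C.regular k) s t x :
      UniformSpace.Completion C.Space) =
      ((tensorMatrix C.regular l * scalarMatrix (Module.End ℂ C.Space) T) s t x : C.Space) := by
  refine coe_eq_coe_of_inner fun y => ?_
  induction y using GramSpace.induction with
  | h0 => rw [inner_zero_left, inner_zero_left]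
  | ha y y' hy hy' => rw [inner_add_left, inner_add_left, hy, hy']
  | hm c y hy => rw [inner_smul_left, inner_smul_left, hy]
  | hs y =>
  induction x using GramSpace.induction with
  | h0 => rw [map_zero, map_zero]
  | ha x x' hx hx' => rw [map_add, map_add, inner_add_right, inner_add_right, hx, hx']
  | hm c x hx => rw [map_smul, map_smul, inner_smul_right, inner_smul_right, hx]
  | hs x =>
  have h1 : ∀ (c : ℂ) (M : Module.End ℂ C.Space) v,
      (algebraMap ℂ (Module.End ℂ C.Space) c * M) v = c • M v :=
    fun _ _ _ => rfl
  have h2 : ∀ (c : ℂ) (M : Module.End ℂ C.Space) v,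
      (M * algebraMap ℂ (Module.End ℂ C.Space) c) v = c • M v :=
    fun c M v => map_smul M c v
  rw [Matrix.mul_apply, Matrix.mul_apply, LinearMap.sum_apply, LinearMap.sum_apply, inner_sum,
    inner_sum]
  simp only [scalarMatrix_apply, h1, h2, tensorMatrix_regular, inner_smul_right, inner_gramBasis]
  exact C.gram_act hT s t y x

/-- Orthogonality needs no separate argument: `u uᵗ = 1` and `uᵗ u = 1` say that the pair and its
adjoint are intertwiners. -/
theorem exists_regular {S : Gens} (hS : ∀ p ∈ S, mapT N p.2 ∈ C.hom p.1.1 p.1.2) :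
    ∃ w : Matrix (Fin N) (Fin N)
        (Op (UniformSpace.Completion C.Space)),
      Relations S w ∧ ∀ i j (x : C.Space),
        w i j (x : UniformSpace.Completion C.Space) =
          (C.regular i j x : C.Space) := by
  refine exists_completion C.regular (fun i j x y => gramMap_symm _ (C.gram_push i j) x y)
    (fun i j x => ?_) (fun i j x => ?_) (fun p hp => C.regular_intertwines (hS p hp))
  · have h := C.regular_intertwines (C.pairOne_mem 0) ![i, j] Fin.elim0 x
    rw [tensorMatrix_zero, Matrix.mul_one, scalarMatrix_pairOne, tensorMatrix_two_mul_pairOne] at h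
    exact h.symm
  · have h := C.regular_intertwines (C.star_mem (C.pairOne_mem 0)) Fin.elim0 ![i, j] x
    rw [tensorMatrix_zero, Matrix.one_mul, pairOne_mul_tensorMatrix_two,
      scalarMatrix_pairOne_conjTranspose] at h
    exact h

/-- Tannaka–Krein duality: there are no further intertwiners. -/
theorem mem_hom_of_mem_Mor {S : Gens} (hS : ∀ p ∈ S, mapT N p.2 ∈ C.hom p.1.1 p.1.2) {k l : ℕ}
    {T : Matrix (Fin l → Fin N) (Fin k → Fin N) ℂ} (hT : T ∈ Mor (quantumGroup N S).u k l) :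
    T ∈ C.hom k l := by
  obtain ⟨w, hw, hwU⟩ := C.exists_regular hS
  obtain ⟨φ, hφ⟩ := exists_lift (StarAlgHom.id ℂ _) Function.injective_id hw
  have hTw : T ∈ Mor w k l := by
    have := mem_Mor_map (φ : (quantumGroup N S).alg →ₐ[ℂ]
      Op (UniformSpace.Completion C.Space)) hT
    rwa [show (quantumGroup N S).u.map (φ : (quantumGroup N S).alg →ₐ[ℂ]
      Op (UniformSpace.Completion C.Space)) = w from Matrix.ext hφ] at this
  -- The coefficient of degree zero is the vacuum vector: entries of tensor powers send it to the
  -- corresponding basis vectors.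
  have hact : ∀ (m : ℕ) (s t : Fin m → Fin N),
      act m s t (⟨0, Fin.elim0, Fin.elim0⟩ : Coeff N) = ⟨m, s, t⟩ := fun m s t =>
    coeff_ext (Nat.add_zero m) (Fin.append_elim0 s) (Fin.append_elim0 t)
  have hvac : ∀ (m : ℕ) (s t : Fin m → Fin N) (x : Coeff N),
      inner ℂ ((gramBasis _ x : C.Space) : UniformSpace.Completion C.Space)
        (tensorMatrix w m s t ((gramBasis _ ⟨0, Fin.elim0, Fin.elim0⟩ : C.Space) :
          UniformSpace.Completion C.Space)) = C.gram x ⟨m, s, t⟩ := by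
    intro m s t x
    rw [tensorMatrix_apply_coe hwU, tensorMatrix_regular, UniformSpace.Completion.inner_coe,
      inner_gramBasis, hact]
  -- The `(s, t)` entry of the intertwining relation, applied to the vacuum and paired with the
  -- basis vector of the coefficient `(i, t)`.
  have key : ∀ s t i, ∑ r, T s r * hsProj (C.hom k k) (Matrix.single t t 1) r i =
      ∑ r, T r t * hsProj (C.hom k l) (Matrix.single r t 1) s i := by
    intro s t i
    have h := congrArg (fun a => inner ℂ
      ((gramBasis _ ⟨k, i, t⟩ : C.Space) : UniformSpace.Completion C.Space)
      (a ((gramBasis _ ⟨0, Fin.elim0, Fin.elim0⟩ : C.Space) :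
        UniformSpace.Completion C.Space))) (congrFun (congrFun (mem_Mor.1 hTw) s) t)
    have h1 : ∀ (c : ℂ) (M : Op (UniformSpace.Completion C.Space)),
        algebraMap ℂ (Op (UniformSpace.Completion C.Space)) c * M = c • M := fun c M => by
      rw [Algebra.smul_def]
    have h2 : ∀ (c : ℂ) (M : Op (UniformSpace.Completion C.Space)),
        M * algebraMap ℂ (Op (UniformSpace.Completion C.Space)) c = c • M := fun c M => by
      rw [← Algebra.commutes, Algebra.smul_def]
    simp only [Matrix.mul_apply, scalarMatrix_apply, h1, h2, _root_.sum_apply, _root_.smul_apply,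
      inner_sum, inner_smul_right, hvac] at h
    exact h
  have hT' : hsProj (C.hom k l) T = T := by
    refine Matrix.ext fun s i => ?_
    -- Summing over `t` replaces the diagonal matrix units by the identity, which the projection
    -- fixes. The other side of `key` sums to the projection of `T`.
    have h1 : ∑ t, ∑ r, T s r * hsProj (C.hom k k) (Matrix.single t t 1) r i = T s i := by
      rw [Finset.sum_comm]
      simp only [← Finset.mul_sum, ← Matrix.sum_apply, ← map_sum]
      rw [Matrix.sum_single_one, hsProj_of_mem (C.one_mem k)]
      simp [Matrix.one_apply]
    rw [← h1, Finset.sum_congr rfl fun t _ => key s t i]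
    conv_lhs => rw [Matrix.matrix_eq_sum_single T]
    simp only [map_sum, Matrix.sum_apply]
    rw [Finset.sum_comm]
    refine Finset.sum_congr rfl fun t _ => Finset.sum_congr rfl fun r _ => ?_
    rw [← smul_eq_mul, ← Matrix.smul_apply, ← map_smul, Matrix.smul_single, smul_eq_mul, mul_one]
  rw [← hT']
  exact hsProj_mem _ _

end TensorSystem

end

/-! ### Intertwiner spaces of the universal quantum groups -/

/-- Tensoring on the left produces the degree `1 + k` where `k + 1` is wanted. -/
theorem mem_reindex {N : ℕ} (C : (k l : ℕ) → Submodule ℂ (Matrix (Fin l → Fin N) (Fin k → Fin N) ℂ))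
    {k k' l l' : ℕ} (hk : k' = k) (hl : l' = l)
    {X : Matrix (Fin l' → Fin N) (Fin k' → Fin N) ℂ} (hX : X ∈ C k' l') :
    (Matrix.of fun j i => X (j ∘ Fin.cast hl) (i ∘ Fin.cast hk) :
      Matrix (Fin l → Fin N) (Fin k → Fin N) ℂ) ∈ C k l := by
  subst hk hl
  exact hX

theorem mapT_idPart (N : ℕ) : mapT N (single idPart) = 1 := by
  rw [← idPow_one, mapT_idPow]

/-- The tensor system of a linear category of partitions. -/
def LinCat.tensorSystem {N : ℕ} (hN : 1 ≤ N) (K : LinCat N) : TensorSystem N where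
  hom k l := (K.hom k l).map (mapT N)
  one_mem k := ⟨_, K.idPow_mem hN k, mapT_idPow N k⟩
  mul_mem := by
    rintro k l m _ _ ⟨q, hq, rfl⟩ ⟨p, hp, rfl⟩
    exact ⟨_, K.comp_mem hq hp, mapT_comp N q p⟩
  star_mem := by
    rintro k l _ ⟨p, hp, rfl⟩
    exact ⟨_, K.involution_mem hp, mapT_involution N p⟩
  appendOne_mem := by
    rintro k l _ m ⟨p, hp, rfl⟩
    refine ⟨_, K.tensor_mem hp (K.idPow_mem hN m), Matrix.ext fun j i => ?_⟩
    rw [mapT_tensor, mapT_idPow, Matrix.one_apply, appendOne, Matrix.of_apply, mul_ite, mul_one,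
      mul_zero]
  consOne_mem := by
    rintro k l _ ⟨p, hp, rfl⟩
    convert mem_reindex (fun k l => (K.hom k l).map (mapT N)) (Nat.add_comm 1 k) (Nat.add_comm 1 l)
      ⟨_, K.tensor_mem K.id_mem hp, rfl⟩ using 1
    refine Matrix.ext fun j i => ?_
    rw [Matrix.of_apply, mapT_tensor, mapT_idPart, Matrix.one_apply, consOne, Matrix.of_apply,
      ite_mul, one_mul, zero_mul]
    have h : ∀ {n : ℕ} (f : Fin (n + 1) → Fin N),
        (f ∘ Fin.cast (Nat.add_comm 1 n)) ∘ Fin.natAdd 1 = Fin.tail f := by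
      intro n f
      funext x
      refine congrArg f (Fin.ext ?_)
      simp only [Fin.val_cast, Fin.val_natAdd, Fin.val_succ]
      omega
    rw [h, h]
    congr 1
    rw [funext_iff, Fin.forall_fin_one, eq_iff_iff]
    rfl
  pairOne_mem k := by
    convert mem_reindex (fun k l => (K.hom k l).map (mapT N)) (Nat.zero_add k) (Nat.add_comm 2 k)
      ⟨_, K.tensor_mem K.pair_mem (K.idPow_mem hN k), rfl⟩ using 1
    refine Matrix.ext fun j i => ?_
    rw [Matrix.of_apply, mapT_tensor, mapT_idPow, mapT_pairPart, Matrix.one_apply, pairOne,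
      Matrix.of_apply]
    have h : (j ∘ Fin.cast (Nat.add_comm 2 k)) ∘ Fin.natAdd 2 = Fin.tail (Fin.tail j) := by
      funext x
      refine congrArg j (Fin.ext ?_)
      simp only [Fin.val_cast, Fin.val_natAdd, Fin.val_succ]
      omega
    have h' : (i ∘ Fin.cast (Nat.zero_add k)) ∘ Fin.natAdd 0 = i := by
      funext x
      refine congrArg i (Fin.ext ?_)
      simp
    rw [h, h', ite_and, ite_mul, one_mul, zero_mul]
    by_cases h1 : Fin.tail (Fin.tail j) = i
    · simp only [h1, if_true]
      rfl
    · simp [h1]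

/-- One inclusion is Tannaka–Krein duality for the generated category. For the other, the
combinations whose maps intertwine `u` form a linear category containing `S`. -/
theorem Mor_quantumGroup {N : ℕ} (hN : 1 ≤ N) (S : Gens) (k l : ℕ) :
    Mor (quantumGroup N S).u k l = mapT N '' ((generated N S).hom k l : Set (PLin k l)) := by
  refine Set.Subset.antisymm (fun T hT => ?_) ?_
  · exact ((generated N S).tensorSystem hN).mem_hom_of_mem_Mor
      (fun p hp => ⟨p.2, generated_contains N S p hp, rfl⟩) hT
  · rintro _ ⟨p, hp, rfl⟩
    exact mapT_mem_Mor_of_mem_generated (relations_quantumGroup N S) hp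

/-! ### The symmetric group and the free orthogonal quantum group -/

theorem isSubgroup_freeOrthogonal (N : ℕ) (S : Gens) :
    (quantumGroup N S).IsSubgroup (freeOrthogonal N) := by
  have h := relations_quantumGroup N S
  have h0 : Relations ∅ (quantumGroup N S).u :=
    ⟨h.selfAdjoint, h.mul_transpose, h.transpose_mul, fun _ hx => absurd hx (Set.notMem_empty _)⟩
  obtain ⟨φ, hφ⟩ := exists_lift (faithfulRep N S) (faithfulRep_injective N S) h0
  exact ⟨φ, surjective_of_generates (generates_quantumGroup N S) φ fun i j => ⟨_, hφ i j⟩, hφ⟩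

/-- Only equality of labels matters for `T_p`, so permuting the labels changes nothing; hence `S_N`
satisfies every relation that partitions can impose. -/
theorem mapT_perm {N k l : ℕ} (σ : Equiv.Perm (Fin N)) (p : PLin k l) (j : Fin l → Fin N)
    (i : Fin k → Fin N) : mapT N p (σ ∘ j) (σ ∘ i) = mapT N p j i := by
  classical
  induction p using PLin.induction with
  | ha x y hx hy => rw [map_add, Matrix.add_apply, Matrix.add_apply, hx, hy]
  | hm c x hx => rw [map_smul, Matrix.smul_apply, Matrix.smul_apply, hx]
  | hs p =>
    rw [mapT_single, mapOfPart, Matrix.of_apply, Matrix.of_apply, ← Sum.comp_elim]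
    simp only [Function.comp_apply, σ.injective.eq_iff]

theorem tensorMatrix_perm {N : ℕ} (σ : Equiv.Perm (Fin N)) (k : ℕ) (s t : Fin k → Fin N) :
    tensorMatrix (Matrix.of fun i j => if i = σ j then (1 : ℂ) else 0) k s t =
      if s = σ ∘ t then 1 else 0 := by
  induction k with
  | zero => rw [tensorMatrix_zero, Subsingleton.elim s t, Matrix.one_apply_eq,
      if_pos (Subsingleton.elim _ _)]
  | succ k ih =>
    induction s using forall_fun_succ with
    | h a s =>
    induction t using forall_fun_succ with
    | h b t =>
    have : σ ∘ (Fin.cons b t : Fin (k + 1) → Fin N) = Fin.cons (σ b) (σ ∘ t) :=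
      Fin.comp_cons σ b t
    rw [tensorMatrix_cons, ih, this, Matrix.of_apply]
    simp only [cons_eq_cons_iff, ite_and, ite_mul, one_mul, zero_mul]

theorem relations_perm (N : ℕ) (S : Gens) (σ : Equiv.Perm (Fin N)) :
    Relations S (Matrix.of fun i j => if i = σ j then (1 : ℂ) else 0) where
  selfAdjoint i j := by
    rw [Matrix.of_apply]
    split_ifs <;> simp
  mul_transpose := by
    refine Matrix.ext fun i j => ?_
    rw [Matrix.mul_apply, ← σ.symm.sum_comp]
    simp [Matrix.one_apply]
  transpose_mul := by
    refine Matrix.ext fun i j => ?_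
    rw [Matrix.mul_apply]
    simp [Matrix.one_apply, eq_comm]
  intertwines p hp := by
    rw [mem_Mor]
    refine Matrix.ext fun s t => ?_
    rw [Matrix.mul_apply, Matrix.mul_apply]
    simp only [tensorMatrix_perm, scalarMatrix_apply, Algebra.algebraMap_self_apply]
    have h : ∀ r, s = σ ∘ r ↔ r = σ.symm ∘ s := fun r =>
      ⟨fun h => by rw [h, ← Function.comp_assoc]; simp, fun h => by
        rw [h, ← Function.comp_assoc]; simp⟩
    simp only [h, mul_ite, mul_one, mul_zero, ite_mul, one_mul, zero_mul, Finset.sum_ite_eq',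
      Finset.mem_univ, if_true]
    have h' : σ ∘ σ.symm ∘ s = s := ((h _).2 rfl).symm
    rw [← mapT_perm σ p.2 (σ.symm ∘ s) t, h']

/-- Evaluation of functions on the symmetric group. -/
def evalPerm {N : ℕ} (σ : Equiv.Perm (Fin N)) : (symmetricGroup N).alg →ₐ[ℂ] ℂ :=
  Pi.evalAlgHom ℂ (fun _ => ℂ) σ

theorem map_evalPerm {N : ℕ} (σ : Equiv.Perm (Fin N)) :
    (symmetricGroup N).u.map (evalPerm σ) =
      Matrix.of fun i j => if i = σ j then (1 : ℂ) else 0 := rfl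

theorem matrix_ext_evalPerm {N : ℕ} {m n : Type} {M M' : Matrix m n (symmetricGroup N).alg}
    (h : ∀ σ, M.map (evalPerm σ) = M'.map (evalPerm σ)) : M = M' :=
  Matrix.ext fun i j => funext fun σ => congrFun (congrFun (h σ) i) j

theorem relations_symmetricGroup (N : ℕ) (S : Gens) : Relations S (symmetricGroup N).u where
  selfAdjoint i j := funext fun σ => (relations_perm N S σ).selfAdjoint i j
  mul_transpose := matrix_ext_evalPerm fun σ => by
    rw [Matrix.map_mul, Matrix.transpose_map, map_evalPerm, (relations_perm N S σ).mul_transpose]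
    exact (Matrix.map_one _ (map_zero _) (map_one _)).symm
  transpose_mul := matrix_ext_evalPerm fun σ => by
    rw [Matrix.map_mul, Matrix.transpose_map, map_evalPerm, (relations_perm N S σ).transpose_mul]
    exact (Matrix.map_one _ (map_zero _) (map_one _)).symm
  intertwines p hp := by
    rw [mem_Mor]
    refine matrix_ext_evalPerm fun σ => ?_
    rw [Matrix.map_mul, Matrix.map_mul, scalarMatrix_map, ← tensorMatrix_map, ← tensorMatrix_map,
      map_evalPerm]
    exact mem_Mor.1 ((relations_perm N S σ).intertwines p hp)

/-- Functions on a finite set as diagonal operators. -/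
def diagonalRep (ι : Type) [Fintype ι] [DecidableEq ι] :
    (ι → ℂ) →⋆ₐ[ℂ] Op (EuclideanSpace ℂ ι) :=
  ((Matrix.toEuclideanCLM (n := ι) (𝕜 := ℂ) : Matrix ι ι ℂ ≃⋆ₐ[ℂ] _) :
    Matrix ι ι ℂ →⋆ₐ[ℂ] Op (EuclideanSpace ℂ ι)).comp
    { Matrix.diagonalAlgHom ℂ with
      map_star' := fun f => (Matrix.diagonal_conjTranspose f).symm }

theorem diagonalRep_injective (ι : Type) [Fintype ι] [DecidableEq ι] :
    Function.Injective (diagonalRep ι) :=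
  (Matrix.toEuclideanCLM (n := ι) (𝕜 := ℂ)).injective.comp Matrix.diagonal_injective

theorem symmetricGroup_isSubgroup (N : ℕ) (S : Gens) :
    (symmetricGroup N).IsSubgroup (quantumGroup N S) := by
  classical
  obtain ⟨φ, hφ⟩ := exists_lift (diagonalRep (Equiv.Perm (Fin N))) (diagonalRep_injective _)
    (relations_symmetricGroup N S)
  refine ⟨φ, fun f => ?_, hφ⟩
  set R : Subalgebra ℂ (Equiv.Perm (Fin N) → ℂ) := AlgHom.range
    (φ : (quantumGroup N S).alg →ₐ[ℂ] (Equiv.Perm (Fin N) → ℂ))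
  have hu : ∀ i j, (symmetricGroup N).u i j ∈ R := fun i j => ⟨_, hφ i j⟩
  have hsingle : ∀ σ : Equiv.Perm (Fin N), (Pi.single σ 1 : Equiv.Perm (Fin N) → ℂ) ∈ R := by
    intro σ
    -- A permutation is determined by its values, so its indicator function is `∏ⱼ u_{σ(j) j}`.
    -- These indicators span all functions on the group.
    have h : (Pi.single σ 1 : Equiv.Perm (Fin N) → ℂ) =
        ∏ j, (fun π : Equiv.Perm (Fin N) => if σ j = π j then (1 : ℂ) else 0) := by
      funext π
      rw [Finset.prod_apply, Pi.single_apply]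
      split_ifs with h
      · simp [h]
      · obtain ⟨j, hj⟩ : ∃ j, σ j ≠ π j := by
          by_contra! h'
          exact h (Equiv.ext h').symm
        exact (Finset.prod_eq_zero (Finset.mem_univ j) (if_neg hj)).symm
    rw [h]
    exact prod_mem fun j _ => hu (σ j) j
  have hf : ∀ g : Equiv.Perm (Fin N) → ℂ, g ∈ R := by
    intro g
    have h : g = ∑ σ, g σ • (Pi.single σ 1 : Equiv.Perm (Fin N) → ℂ) := by
      funext π
      simp [Finset.sum_apply, Pi.single_apply]
    rw [h]
    exact sum_mem fun σ _ => R.smul_mem (hsingle σ) _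
  exact hf f

theorem correspondsTo_quantumGroup {N : ℕ} (hN : 1 ≤ N) (S : Gens) :
    (quantumGroup N S).CorrespondsTo (generated N S) where
  isCMQG := isCMQG_quantumGroup N S
  symmetric_le := symmetricGroup_isSubgroup N S
  le_orthogonal := isSubgroup_freeOrthogonal N S
  mor_eq := Mor_quantumGroup hN S

/-! ### Conjugation by `T_τ` -/

theorem mapT_discPart (N : ℕ) (j i : Fin 1 → Fin N) : mapT N (single discPart) j i = 1 := by
  classical
  rw [mapT_single, mapOfPart_apply, if_pos]
  exact bot_le

theorem tauMatrix_apply (N : ℕ) (i j : Fin N) :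
    tauMatrix N i j = (if i = j then 1 else 0) - 2 / N := by
  rw [tauMatrix, Matrix.of_apply, tau, map_sub, map_smul, Matrix.sub_apply, Matrix.smul_apply,
    mapT_discPart, mapT_idPart, Matrix.one_apply, smul_eq_mul, mul_one]
  congr 2
  rw [funext_iff, eq_iff_iff, forall_const]

theorem tauMatrix_transpose (N : ℕ) : (tauMatrix N).transpose = tauMatrix N := by
  refine Matrix.ext fun i j => ?_
  simp only [Matrix.transpose_apply, tauMatrix_apply, eq_comm]

theorem star_tauMatrix (N : ℕ) (i j : Fin N) : star (tauMatrix N i j) = tauMatrix N i j := by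
  rw [tauMatrix_apply, star_sub, star_div₀]
  split_ifs <;> simp

theorem tensorMatrix_tauMatrix (N k : ℕ) :
    tensorMatrix (tauMatrix N) k = mapT N (tensorPow (tau N) k) := by
  induction k with
  | zero =>
    rw [tensorMatrix_zero]
    exact (mapT_idPow N 0).symm
  | succ k ih =>
    refine Matrix.ext fun s t => ?_
    rw [tensorMatrix_add, ih, tensorPow, mapT_tensor]
    congr 1
    rw [tensorMatrix, Matrix.of_apply]
    simp only [List.ofFn_succ, List.ofFn_zero, List.prod_singleton]
    rw [tauMatrix, Matrix.of_apply]
    have h : ∀ f : Fin 1 → Fin N, (fun _ => f 0) = f := fun f =>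
      funext fun x => by rw [Subsingleton.elim x 0]
    exact congrArg₂ (mapT N (tau N)) (h _) (h _)

theorem tauMatrix_mul_self {N : ℕ} (hN : 1 ≤ N) : tauMatrix N * tauMatrix N = 1 := by
  refine Matrix.ext fun i j => ?_
  have h := congrArg (mapT N) (tau_comp_tau hN)
  rw [mapT_comp, mapT_idPart] at h
  have h1 := congrFun (congrFun h fun _ => i) fun _ => j
  rw [Matrix.mul_apply, ← (Equiv.funUnique (Fin 1) (Fin N)).symm.sum_comp] at h1
  rw [Matrix.mul_apply]
  refine h1.trans ?_
  rw [Matrix.one_apply, Matrix.one_apply]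
  congr 1
  rw [funext_iff, eq_iff_iff, forall_const]

theorem isUnit_tauMatrix {N : ℕ} (hN : 1 ≤ N) : IsUnit (tauMatrix N) :=
  ⟨⟨_, _, tauMatrix_mul_self hN, tauMatrix_mul_self hN⟩, rfl⟩

theorem tauMatrix_inv {N : ℕ} (hN : 1 ≤ N) : (tauMatrix N)⁻¹ = tauMatrix N :=
  Matrix.inv_eq_right_inv (tauMatrix_mul_self hN)

theorem mapT_scriptT (N : ℕ) {k l : ℕ} (p : PLin k l) :
    mapT N (scriptT N k l p) =
      tensorMatrix (tauMatrix N) l * (mapT N p * tensorMatrix (tauMatrix N) k) := by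
  rw [scriptT_apply, mapT_comp, mapT_comp, tensorMatrix_tauMatrix, tensorMatrix_tauMatrix]

section Conjugate

variable {N : ℕ} {A : Type} [Ring A] [Algebra ℂ A]

/-- The matrix `T_τ u T_τ`. -/
def conjTau (u : Matrix (Fin N) (Fin N) A) : Matrix (Fin N) (Fin N) A :=
  scalarMatrix A (tauMatrix N) * u * scalarMatrix A (tauMatrix N)

theorem scalarMatrix_tau_mul_self (hN : 1 ≤ N) :
    scalarMatrix A (tauMatrix N) * scalarMatrix A (tauMatrix N) = 1 := by
  rw [← scalarMatrix_mul, tauMatrix_mul_self hN, scalarMatrix_one]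

theorem conjTau_conjTau (hN : 1 ≤ N) (u : Matrix (Fin N) (Fin N) A) : conjTau (conjTau u) = u := by
  rw [conjTau, conjTau, Matrix.mul_assoc, Matrix.mul_assoc, scalarMatrix_tau_mul_self hN,
    Matrix.mul_one, ← Matrix.mul_assoc, scalarMatrix_tau_mul_self hN, Matrix.one_mul]

theorem conjTau_mul (hN : 1 ≤ N) (u v : Matrix (Fin N) (Fin N) A) :
    conjTau u * conjTau v = conjTau (u * v) := by
  set a := scalarMatrix A (tauMatrix N) with ha
  calc a * u * a * (a * v * a) = a * u * ((a * a) * (v * a)) := by simp only [Matrix.mul_assoc]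
    _ = a * (u * v) * a := by
      rw [ha, scalarMatrix_tau_mul_self hN, Matrix.one_mul]
      simp only [Matrix.mul_assoc]

theorem conjTau_one (hN : 1 ≤ N) : conjTau (1 : Matrix (Fin N) (Fin N) A) = 1 := by
  rw [conjTau, Matrix.mul_one, scalarMatrix_tau_mul_self hN]

theorem map_conjTau {B : Type} [Ring B] [Algebra ℂ B] (φ : A →ₐ[ℂ] B)
    (u : Matrix (Fin N) (Fin N) A) : (conjTau u).map φ = conjTau (u.map φ) := by
  rw [conjTau, conjTau, Matrix.map_mul, Matrix.map_mul, scalarMatrix_map]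

theorem tensorMatrix_conjTau (u : Matrix (Fin N) (Fin N) A) (k : ℕ) :
    tensorMatrix (conjTau u) k = scalarMatrix A (tensorMatrix (tauMatrix N) k) *
      tensorMatrix u k * scalarMatrix A (tensorMatrix (tauMatrix N) k) := by
  rw [conjTau, tensorMatrix_mul, tensorMatrix_mul, tensorMatrix_scalarMatrix]
  · exact fun _ _ _ _ => Algebra.commute_algebraMap_left _ _
  · exact fun _ _ _ _ => Algebra.commute_algebraMap_right _ _

theorem tensorMatrix_tau_mul_self (hN : 1 ≤ N) (k : ℕ) :
    scalarMatrix A (tensorMatrix (tauMatrix N) k) *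
      scalarMatrix A (tensorMatrix (tauMatrix N) k) = 1 := by
  rw [← scalarMatrix_mul, ← tensorMatrix_mul fun _ _ _ _ => Commute.all _ _,
    tauMatrix_mul_self hN, tensorMatrix_one, scalarMatrix_one]

/-- Passing to `𝒯 p` and conjugating `u` insert the same matrices `T_τ^{⊗ k}`, which square to the
identity and cancel in the middle. -/
theorem scriptT_mem_Mor (hN : 1 ≤ N) {u : Matrix (Fin N) (Fin N) A} {k l : ℕ} {p : PLin k l}
    (h : mapT N p ∈ Mor u k l) : mapT N (scriptT N k l p) ∈ Mor (conjTau u) k l := by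
  rw [mem_Mor, mapT_scriptT, tensorMatrix_conjTau, tensorMatrix_conjTau, scalarMatrix_mul,
    scalarMatrix_mul]
  have hk := tensorMatrix_tau_mul_self (A := A) hN k
  have hl := tensorMatrix_tau_mul_self (A := A) hN l
  rw [mem_Mor] at h
  set a := scalarMatrix A (tensorMatrix (tauMatrix N) k)
  set b := scalarMatrix A (tensorMatrix (tauMatrix N) l)
  set X := scalarMatrix A (mapT N p)
  calc b * (X * a) * (a * tensorMatrix u k * a)
      = b * (X * (a * a) * tensorMatrix u k) * a := by simp only [Matrix.mul_assoc]
    _ = b * (tensorMatrix u l * ((b * b) * X)) * a := by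
        rw [hk, hl, Matrix.mul_one, Matrix.one_mul, h]
    _ = b * tensorMatrix u l * b * (b * (X * a)) := by simp only [Matrix.mul_assoc]

/-- The matrix of `τ` is symmetric with scalar entries, so the entries of `u` need not commute with
each other. -/
theorem transpose_conjTau (u : Matrix (Fin N) (Fin N) A) :
    (conjTau u).transpose = conjTau u.transpose := by
  have hT : ∀ i j, scalarMatrix A (tauMatrix N) i j = scalarMatrix A (tauMatrix N) j i := by
    intro i j
    rw [scalarMatrix_apply, ← Matrix.transpose_apply (tauMatrix N), tauMatrix_transpose]
    rfl
  refine Matrix.ext fun i j => ?_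
  rw [Matrix.transpose_apply, conjTau, conjTau, Matrix.mul_assoc]
  simp only [Matrix.mul_apply, Matrix.transpose_apply, Finset.mul_sum, Finset.sum_mul]
  rw [Finset.sum_comm]
  refine Eq.trans Finset.sum_comm
    (Finset.sum_congr rfl fun a _ => Finset.sum_congr rfl fun b _ => ?_)
  rw [hT j a, hT b i]
  simp only [scalarMatrix_apply]
  rw [← Algebra.commutes (tauMatrix N i b), Algebra.left_comm, Algebra.commutes (tauMatrix N a j),
    mul_assoc]

theorem relations_conjTau (hN : 1 ≤ N) [StarRing A] [StarModule ℂ A] {k l : ℕ} {p : PLin k l}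
    {u : Matrix (Fin N) (Fin N) A} (h : Relations (gen p) u) :
    Relations (gen (scriptT N k l p)) (conjTau u) where
  selfAdjoint i j := by
    rw [conjTau, Matrix.mul_apply]
    simp only [Matrix.mul_apply, Finset.sum_mul, star_sum]
    refine Finset.sum_congr rfl fun a _ => Finset.sum_congr rfl fun b _ => ?_
    rw [star_mul, star_mul, h.selfAdjoint, scalarMatrix_apply, scalarMatrix_apply,
      ← algebraMap_star_comm, ← algebraMap_star_comm, star_tauMatrix, star_tauMatrix,
      Algebra.commutes (tauMatrix N a j), ← Algebra.commutes (tauMatrix N i b)]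
  mul_transpose := by rw [transpose_conjTau, conjTau_mul hN, h.mul_transpose, conjTau_one hN]
  transpose_mul := by rw [transpose_conjTau, conjTau_mul hN, h.transpose_mul, conjTau_one hN]
  intertwines := by
    rintro _ rfl
    exact scriptT_mem_Mor hN (h.intertwines _ rfl)

end Conjugate

theorem exists_hom_conjTau {N : ℕ} (hN : 1 ≤ N) {k l : ℕ} (p : PLin k l) :
    ∃ φ : (quantumGroup N (gen (scriptT N k l p))).alg →⋆ₐ[ℂ] (quantumGroup N (gen p)).alg,
      ∀ i j, φ ((quantumGroup N (gen (scriptT N k l p))).u i j) =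
        conjTau (quantumGroup N (gen p)).u i j :=
  exists_lift (faithfulRep N _) (faithfulRep_injective N _)
    (relations_conjTau hN (relations_quantumGroup N (gen p)))

/-- Conjugating twice by `T_τ` is the identity, so both compositions fix the generators, and
continuous homomorphisms are determined there. -/
theorem similarVia_of_homs {N : ℕ} (hN : 1 ≤ N) {G H : MatrixPair N}
    (hG : (StarAlgebra.adjoin ℂ
      (Set.range fun ij : Fin N × Fin N => G.u ij.1 ij.2)).topologicalClosure = ⊤)
    (hH : (StarAlgebra.adjoin ℂ
      (Set.range fun ij : Fin N × Fin N => H.u ij.1 ij.2)).topologicalClosure = ⊤)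
    (φ : G.alg →⋆ₐ[ℂ] H.alg) (hφ : ∀ i j, φ (G.u i j) = conjTau H.u i j)
    (ψ : H.alg →⋆ₐ[ℂ] G.alg) (hψ : ∀ i j, ψ (H.u i j) = conjTau G.u i j) :
    G.SimilarVia (tauMatrix N) H := by
  have h1 : G.u.map (φ : G.alg →ₐ[ℂ] H.alg) = conjTau H.u := Matrix.ext hφ
  have h2 : H.u.map (ψ : H.alg →ₐ[ℂ] G.alg) = conjTau G.u := Matrix.ext hψ
  have h3 : ψ.comp φ = StarAlgHom.id ℂ G.alg := by
    refine hom_ext_of_generates hG fun i j => ?_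
    have h := map_conjTau (ψ : H.alg →ₐ[ℂ] G.alg) H.u
    rw [h2, conjTau_conjTau hN] at h
    exact (congrArg ψ (hφ i j)).trans (congrFun (congrFun h i) j)
  have h4 : φ.comp ψ = StarAlgHom.id ℂ H.alg := by
    refine hom_ext_of_generates hH fun i j => ?_
    have h := map_conjTau (φ : G.alg →ₐ[ℂ] H.alg) G.u
    rw [h1, conjTau_conjTau hN] at h
    exact (congrArg φ (hψ i j)).trans (congrFun (congrFun h i) j)
  refine ⟨isUnit_tauMatrix hN, StarAlgEquiv.ofStarAlgHom φ ψ h3 h4, fun i j => ?_⟩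
  rw [tauMatrix_inv hN]
  exact hφ i j

theorem similarVia_tauMatrix {N : ℕ} (hN : 1 ≤ N) {k l : ℕ} (p : PLin k l) :
    (quantumGroup N (gen (scriptT N k l p))).SimilarVia (tauMatrix N)
      (quantumGroup N (gen p)) := by
  obtain ⟨φ, hφ⟩ := exists_hom_conjTau hN p
  have hψ' := exists_hom_conjTau hN (scriptT N k l p)
  -- The inverse homomorphism is the same construction for `𝒯 p`, because `𝒯 (𝒯 p) = p`.
  rw [scriptT_scriptT hN] at hψ'
  obtain ⟨ψ, hψ⟩ := hψ'
  exact similarVia_of_homs hN (generates_quantumGroup N _) (generates_quantumGroup N _) φ hφ ψ hψ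

/-! ### Distinguishing the two quantum groups -/

/-- The diagonal matrix with entry `-1` at `a` and entries `1` elsewhere. -/
def reflection {N : ℕ} (a : Fin N) : Matrix (Fin N) (Fin N) ℂ :=
  Matrix.diagonal fun i => if i = a then -1 else 1

theorem reflection_mul_self {N : ℕ} (a : Fin N) : reflection a * reflection a = 1 := by
  rw [reflection, Matrix.diagonal_mul_diagonal, ← Matrix.diagonal_one]
  congr 1
  funext i
  split_ifs <;> norm_num

theorem tensorMatrix_diagonal {N : ℕ} (d : Fin N → ℂ) (k : ℕ) :
    tensorMatrix (Matrix.diagonal d) k = Matrix.diagonal fun s => ∏ x, d (s x) := by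
  induction k with
  | zero =>
    rw [tensorMatrix_zero, ← Matrix.diagonal_one]
    rfl
  | succ k ih =>
    refine Matrix.ext fun s t => ?_
    induction s using forall_fun_succ with
    | h a s =>
    induction t using forall_fun_succ with
    | h b t =>
    rw [tensorMatrix_cons, ih, Matrix.diagonal_apply, Matrix.diagonal_apply, Matrix.diagonal_apply,
      Fin.prod_univ_succ]
    simp only [cons_eq_cons_iff, Fin.cons_zero, Fin.cons_succ]
    by_cases hab : a = b <;> simp [hab]

theorem mem_Mor_diagonal_iff {N : ℕ} (d : Fin N → ℂ) {l : ℕ}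
    {T : Matrix (Fin l → Fin N) (Fin 0 → Fin N) ℂ} :
    T ∈ Mor (Matrix.diagonal d) 0 l ↔ ∀ s t, T s t = (∏ x, d (s x)) * T s t := by
  rw [mem_Mor, tensorMatrix_zero, Matrix.mul_one, tensorMatrix_diagonal, ← Matrix.ext_iff]
  simp only [Matrix.diagonal_mul, scalarMatrix_apply, Algebra.algebraMap_self_apply]

/-- On labels admitted by `b_4` the same sign occurs four times, and its fourth power is 1. So the
sign matrices are points of `H_N⁺`. -/
theorem relations_reflection {N : ℕ} (a : Fin N) :
    Relations (gen (single fourPart)) (reflection a) where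
  selfAdjoint i j := by
    rw [reflection, Matrix.diagonal_apply]
    split_ifs <;> simp
  mul_transpose := by
    rw [reflection, Matrix.diagonal_transpose]
    exact reflection_mul_self a
  transpose_mul := by
    rw [reflection, Matrix.diagonal_transpose]
    exact reflection_mul_self a
  intertwines := by
    rintro _ rfl
    refine (mem_Mor_diagonal_iff _).2 fun s t => ?_
    change mapT N (single fourPart) s t = _ * mapT N (single fourPart) s t
    rw [mapT_single, mapOfPart, Matrix.of_apply]
    split_ifs with h
    · have hs : ∀ x, s x = s 0 := fun x => h (Sum.inr x) (Sum.inr 0) trivial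
      simp only [hs, Finset.prod_const, Finset.card_univ, Fintype.card_fin, mul_one]
      split_ifs <;> norm_num
    · simp

/-- An identification would make each reflection a character of the other algebra as well. The
reflection would then fix `T_p`, but it changes the sign of the entries where the label `a` occurs
an odd number of times. -/
theorem mapT_eq_zero_of_identical {N : ℕ} {p : PLin 0 4}
    (h : (quantumGroup N (gen p)).Identical (quantumGroup N (gen (single fourPart)))) (a : Fin N)
    {s : Fin 4 → Fin N} (hs : ∏ x, (if s x = a then (-1 : ℂ) else 1) = -1) (t : Fin 0 → Fin N) :
    mapT N p s t = 0 := by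
  obtain ⟨φ, hφ⟩ := h
  obtain ⟨χ, hχ⟩ := exists_lift (StarAlgHom.ofId ℂ (Op ℂ)) (algebraMap ℂ (Op ℂ)).injective
    (relations_reflection a)
  set π : (quantumGroup N (gen p)).alg →⋆ₐ[ℂ] ℂ := χ.comp φ.toStarAlgHom
  have h1 := (relations_map π (relations_quantumGroup N (gen p))).intertwines _ rfl
  have h2 : (quantumGroup N (gen p)).u.map π = reflection a :=
    Matrix.ext fun i j => (congrArg χ (hφ i j)).trans (hχ i j)
  rw [h2] at h1
  have h3 := (mem_Mor_diagonal_iff _).1 h1 s t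
  rw [hs] at h3
  change mapT N p s t = -1 * mapT N p s t at h3
  linear_combination h3 / 2

theorem mapT_blockWithSingletons (N : ℕ) {n : ℕ} (I : Finset (Fin n)) (s : Fin n → Fin N)
    (t : Fin 0 → Fin N) : mapT N (single (blockWithSingletons I)) s t =
      if ∀ a ∉ I, ∀ b ∉ I, s a = s b then 1 else 0 := by
  classical
  rw [mapT_single, mapOfPart_apply]
  simp only [blockWithSingletons_le_ker_iff]

/-- At labels `(a, b, b, b)` the contributions are `-2/N` from cutting the first leg, `3 · 4/N²`
from cutting it and one other leg, and `-16/N³` from four singletons. -/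
theorem mapT_scriptT_fourPart {N : ℕ} (hN : 1 ≤ N) {f : Fin 2 → Fin N}
    (hf : Function.Injective f) (t : Fin 0 → Fin N) :
    mapT N (scriptT N 0 4 (single fourPart)) (f ∘ ![0, 1, 1, 1]) t =
      -2 * ((N : ℂ) - 2) * (N - 4) / N ^ 3 := by
  have hN' : (N : ℂ) ≠ 0 := by exact_mod_cast (by omega : N ≠ 0)
  have h4 : fourPart = blockWithSingletons (∅ : Finset (Fin 4)) :=
    (blockWithSingletons_empty 4).symm
  rw [scriptT_fourPart hN, h4]
  simp only [map_sub, map_add, map_smul, Matrix.sub_apply, Matrix.add_apply, Matrix.smul_apply,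
    mapT_blockWithSingletons, Function.comp_apply, hf.eq_iff]
  simp +decide only [smul_eq_mul, if_true, if_false]
  field_simp
  ring

theorem mapT_scriptT_fourPart_of_injective {N : ℕ} (hN : 1 ≤ N) {s : Fin 4 → Fin N}
    (hs : Function.Injective s) (t : Fin 0 → Fin N) :
    mapT N (scriptT N 0 4 (single fourPart)) s t = -16 / N ^ 3 := by
  have hN' : (N : ℂ) ≠ 0 := by exact_mod_cast (by omega : N ≠ 0)
  have h4 : fourPart = blockWithSingletons (∅ : Finset (Fin 4)) :=
    (blockWithSingletons_empty 4).symm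
  rw [scriptT_fourPart hN, h4]
  simp only [map_sub, map_add, map_smul, Matrix.sub_apply, Matrix.add_apply, Matrix.smul_apply,
    mapT_blockWithSingletons, hs.eq_iff]
  simp +decide only [smul_eq_mul, if_true, if_false]
  field_simp
  ring

theorem not_identical {N : ℕ} (hN : 3 ≤ N) :
    ¬ (quantumGroup N (gen (scriptT N 0 4 (single fourPart)))).Identical
      (quantumGroup N (gen (single fourPart))) := by
  intro h
  have hN' : (N : ℂ) ≠ 0 := by exact_mod_cast (by omega : N ≠ 0)
  by_cases h4 : N = 4
  -- For `N = 4` the entry at `(a, b, b, b)` vanishes; four distinct labels are then available and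
  -- give `-16/N³`.
  · subst h4
    have h1 := mapT_eq_zero_of_identical h 0 (s := id) (by simp) Fin.elim0
    rw [mapT_scriptT_fourPart_of_injective (by norm_num) Function.injective_id] at h1
    norm_num at h1
  · set f : Fin 2 → Fin N := Fin.castLE (by omega)
    have hf : Function.Injective f := Fin.castLE_injective _
    have h1 := mapT_eq_zero_of_identical h (f 0) (s := f ∘ ![0, 1, 1, 1])
      (by simp [Fin.prod_univ_succ, hf.eq_iff]) Fin.elim0
    rw [mapT_scriptT_fourPart (by omega) hf, div_eq_zero_iff] at h1
    have h2 : (N : ℂ) - 2 ≠ 0 := sub_ne_zero.2 (by exact_mod_cast (by omega : N ≠ 2))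
    have h3 : (N : ℂ) - 4 ≠ 0 := sub_ne_zero.2 (by exact_mod_cast h4)
    simp [hN', h2, h3] at h1

end LinPart

end

theorem mainTheorem10 (N : ℕ) (hN : 1 ≤ N) :
    let b : Finset (Fin 4) → LinPart.PLin 0 4 :=
      fun I => LinPart.single (LinPart.blockWithSingletons I)
    let four : LinPart.PLin 0 4 := LinPart.single LinPart.fourPart
    let Tfour : LinPart.PLin 0 4 := LinPart.scriptT N 0 4 four
    let K : LinPart.LinCat N := LinPart.generated N (LinPart.gen four)
    let L : LinPart.LinCat N := LinPart.generated N (LinPart.gen Tfour)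
    let H : LinPart.MatrixPair N := LinPart.freeHyperoctahedral N
    let G : LinPart.MatrixPair N := LinPart.quantumGroup N (LinPart.gen Tfour)
    -- the explicit linear combination
    (Tfour = four
        - (2 / (N : ℂ)) • (b {3} + b {2} + b {1} + b {0})
        + (4 / (N : ℂ) ^ 2) •
          (b {2, 3} + b {1, 3} + b {0, 3} + b {1, 2} + b {0, 2} + b {0, 1})
        - (16 / (N : ℂ) ^ 3) • b {0, 1, 2, 3}) ∧
    -- the two categories are isomorphic, but not equal, and the second one is not easy
    LinPart.IsMonoidalStarIso (LinPart.scriptT N) K L ∧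
    Tfour ∉ K.hom 0 4 ∧
    K ≠ L ∧
    ¬ L.IsEasy ∧
    -- the corresponding quantum groups are similar, but not identical
    H.CorrespondsTo K ∧
    G.CorrespondsTo L ∧
    G.SimilarVia (LinPart.tauMatrix N) H ∧
    (3 ≤ N → ¬ G.Identical H) := by
  exact ⟨LinPart.scriptT_fourPart hN, LinPart.isMonoidalStarIso_scriptT hN _,
    LinPart.scriptT_fourPart_notMem hN,
    fun h => LinPart.scriptT_fourPart_notMem hN (h ▸ LinPart.mem_generated_gen N _),
    LinPart.not_isEasy_generated_scriptT_fourPart hN,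
    LinPart.correspondsTo_quantumGroup hN _, LinPart.correspondsTo_quantumGroup hN _,
    LinPart.similarVia_tauMatrix hN _, LinPart.not_identical⟩
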